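/- **Setting.** Identify $\mathbf R^2$ with $\mathbf C$. Let $\overline{\mathcal M}$ be the set of signed real regular Borel measures on $\mathbf R^2$ (differences $\mu=\mu_+-\mu_-$ of mutually singular locally finite positive Borel measures; $\mu(S)$ is considered for bounded Borel sets $S$, and for all Borel sets if the total variation is finite). Every $\mu\in\overline{\mathcal M}$ can be written uniquely as $$\mu=\mu^*+2\pi\sum_j n_j\delta_{z_j},\qquad n_j\in\mathbf Z\setminus\{0\},$$ where $\mu^*\in\overline{\mathcal M}$, $\mu^*(\{x\})\in[-\pi,\pi)$ for every $x\in\mathbf R^2$, and the $z_j$ are distinct points without accumulation point in $\mathbf R^2$. The measure $\mu^*$ is called the reduction of $\mu$. For a real function $h\in L^1_{loc}(\mathbf R^2)$ put, for $\psi=(\psi_+,\psi_-)$ and $\xi=(\xi_+,\xi_-)$, $$\pi^h(\psi,\xi)=4\int\overline{\partial_{\bar z}(e^{-h}\psi_+)}\,\partial_{\bar z}(e^{-h}\xi_+)\,e^{2h}+4\int\overline{\partial_{z}(e^{h}\psi_-)}\,\partial_{z}(e^{h}\xi_-)\,e^{-2h}$$ (distributional derivatives) on the maximal domain $\mathcal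 D(\pi^h)=\{\psi\in L^2(\mathbf R^2,\mathbf C^2):\pi^h(\psi,\psi)<\infty\}$, and let $H_h$ be the operator associated with this form: $\psi\in\mathcal D(H_h)$ and $H_h\psi=\eta$ if and only if $\psi\in\mathcal D(\pi^h)$, $\eta\in L^2(\mathbf R^2,\mathbf C^2)$ and $(\eta,\xi)=\pi^h(\psi,\xi)$ for all $\xi\in\mathcal D(\pi^h)$. A *Pauli operator with magnetic field* $\mu\in\overline{\mathcal M}$ is an operator $H=U^*H_hU$, where $h\in L^1_{loc}$ is real with $\Delta h=\mu^*$ in the sense of distributions, and $U$ is the unitary multiplication by $L/|L|$ with $L=F\,\overline{G}$, where $F$ and $G$ are entire functions, $F$ has zeros exactly at the $z_j$ with $n_j>0$, with multiplicities $n_j$, and $G$ has zeros exactly at the $z_j$ with $n_j<0$, with multiplicities $-n_j$. **Theorem 3.1.** Let $\mu\in\overline{\mathcal M}$, assume that the reduction $\mu^*$ has finite total variation, and let $\Phi=\frac1{2\pi}\int\mu^*$. Let $H$ be any Pauli operator with magnetic field $\mu$. Then, with $[a]$ denoting the integer part of $a$, $$\dim\operatorname{Ker}H=\begin{cases}[|\Phi|]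 & \text{if }\Phi\notin\mathbf Z\text{ or }\Phi=0,\\ [|\Phi|]\ \text{or}\ [|\Phi|]-1 & \text{if }\Phi\in\mathbf Z\setminus\{0\}.\end{cases}$$ If $\Phi\in\mathbf Z\setminus\{0\}$ and, additionally, $\mu^*$ has compact support or has a definite sign, then $\dim\operatorname{Ker}H=[|\Phi|]-1$. In all cases every $\psi\in\operatorname{Ker}H$ satisfies $\sigma_3\psi=-s\psi$ with $\sigma_3=\begin{pmatrix}1&0\\0&-1\end{pmatrix}$ and $s=\operatorname{sign}\Phi$ (where $\operatorname{sign}0=0$). Finally, for every nonzero integer $N$ both cases occur: there are a measure $\mu$ as above with $\Phi=N$ and a Pauli operator with magnetic field $\mu$ whose kernel has dimension $|N|$, and likewise a measure and an operator for which the dimension is $|N|-1$. -/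

import Mathlib

open MeasureTheory Set Complex
open scoped ContDiff Laplacian InnerProductSpace ComplexConjugate

namespace PauliMeasure

/-! ### Signed regular Borel measures on the plane

The plane is identified with `ℂ`. -/

/-- A signed real regular Borel measure on the plane, given by its Jordan decomposition: a pair of
mutually singular locally finite (hence, on the plane, regular) Borel measures, the positive and
the negative part. Either part may have infinite total mass. -/
@[ext]
structure SignedRadonMeasure where
  /-- the positive part -/
  pos : Measure ℂ
  /-- the negative part -/
  neg : Measure ℂ
  locallyFinite_pos : IsLocallyFiniteMeasure pos
  locallyFinite_neg : IsLocallyFiniteMeasure neg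
  mutuallySingular : pos.MutuallySingular neg

attribute [instance] SignedRadonMeasure.locallyFinite_pos SignedRadonMeasure.locallyFinite_neg

namespace SignedRadonMeasure

/-- The value `μ(S)`, for bounded Borel sets `S` (and for all Borel sets if the total variation is
finite). -/
noncomputable def value (μ : SignedRadonMeasure) (S : Set ℂ) : ℝ := μ.pos.real S - μ.neg.real S

/-- The total variation measure `|μ|`. -/
noncomputable def variation (μ : SignedRadonMeasure) : Measure ℂ := μ.pos + μ.neg

/-- `|μ|(ℝ²) < ⊤`. -/
def HasFiniteTotalVariation (μ : SignedRadonMeasure) : Prop := μ.variation univ < ⊤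

/-- The flux `(1/2π) ∫ dμ` of a measure with finite total variation. -/
noncomputable def flux (μ : SignedRadonMeasure) : ℝ := μ.value univ / (2 * Real.pi)

/-- `μ` is supported in a compact set. -/
def HasCompactSupport (μ : SignedRadonMeasure) : Prop :=
  ∃ K : Set ℂ, IsCompact K ∧ μ.variation Kᶜ = 0

/-- `μ ≥ 0` or `μ ≤ 0`. -/
def HasDefiniteSign (μ : SignedRadonMeasure) : Prop := μ.neg = 0 ∨ μ.pos = 0

/-- `μ - μ' = 2π ∑ⱼ nⱼ δ_{zⱼ}`. The integers `nⱼ` are encoded by `n : ℂ → ℤ`, which is nonzero at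
finitely many points only of every bounded set; the two sides are compared on bounded Borel
sets. -/
def IsIntegerFluxDifference (μ μ' : SignedRadonMeasure) (n : ℂ → ℤ) : Prop :=
  (∀ R : ℝ, {z : ℂ | n z ≠ 0 ∧ ‖z‖ ≤ R}.Finite) ∧
  ∀ S : Set ℂ, MeasurableSet S → Bornology.IsBounded S →
    μ.value S - μ'.value S = 2 * Real.pi * ∑ᶠ (z : ℂ) (_ : z ∈ S), (n z : ℝ)

/-- Equivalence of measures: they differ by integer point fluxes. -/
def Equivalent (μ μ' : SignedRadonMeasure) : Prop :=
  ∃ n : ℂ → ℤ, IsIntegerFluxDifference μ μ' n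

/-- `ν` is equivalent to `μ`, and all its point masses are in `[-π, π)`. -/
def IsReduction (μ ν : SignedRadonMeasure) : Prop :=
  Equivalent μ ν ∧ ∀ z : ℂ, ν.value {z} ∈ Ico (-Real.pi) Real.pi

lemma value_eq_of_isReduction {μ ν ν' : SignedRadonMeasure} (h : IsReduction μ ν)
    (h' : IsReduction μ ν') {S : Set ℂ} (hS : MeasurableSet S) (hb : Bornology.IsBounded S) :
    ν.value S = ν'.value S := by
  obtain ⟨⟨n, -, hn⟩, hr⟩ := h
  obtain ⟨⟨n', -, hn'⟩, hr'⟩ := h'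
  have key : ∀ z, n z = n' z := by
    intro z
    have h1 := hn {z} (measurableSet_singleton z) Bornology.isBounded_singleton
    have h2 := hn' {z} (measurableSet_singleton z) Bornology.isBounded_singleton
    simp only [mem_singleton_iff, finsum_cond_eq_left]
      at h1 h2
    obtain ⟨a1, a2⟩ := hr z
    obtain ⟨b1, b2⟩ := hr' z
    have hpi := Real.pi_pos
    have hlt : ((n z - n' z : ℤ) : ℝ) < 1 := by push_cast; nlinarith
    have hgt : (-1 : ℝ) < ((n z - n' z : ℤ) : ℝ) := by push_cast; nlinarith
    have hlt' : n z - n' z < 1 := by exact_mod_cast hlt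
    have hgt' : -1 < n z - n' z := by exact_mod_cast hgt
    omega
  have h1 := hn S hS hb
  have h2 := hn' S hS hb
  simp only [key] at h1
  linarith

lemma measure_ext_of_bounded {P Q : Measure ℂ}
    (h : ∀ S : Set ℂ, MeasurableSet S → Bornology.IsBounded S → P S = Q S) : P = Q := by
  refine Measure.ext_of_iUnion_eq_univ (s := fun k : ℕ => Metric.closedBall (0 : ℂ) k)
    (Metric.iUnion_closedBall_nat 0) fun k => ?_
  ext S hS
  rw [Measure.restrict_apply hS, Measure.restrict_apply hS]
  exact h _ (hS.inter measurableSet_closedBall) (Metric.isBounded_closedBall.subset inter_subset_right)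

lemma pos_le_of_value_eq {ν ν' : SignedRadonMeasure}
    (h : ∀ S : Set ℂ, MeasurableSet S → Bornology.IsBounded S → ν.value S = ν'.value S)
    {S : Set ℂ} (hS : MeasurableSet S) (hb : Bornology.IsBounded S) : ν.pos S ≤ ν'.pos S := by
  obtain ⟨s, hs, h0, h1⟩ := ν.mutuallySingular
  have hT := hS.inter hs.compl
  have hTb : Bornology.IsBounded (S ∩ sᶜ) := hb.subset inter_subset_left
  have hv := h _ hT hTb
  have e1 : ν.neg.real (S ∩ sᶜ) = 0 := by
    simp [measureReal_def, measure_mono_null inter_subset_right h1]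
  have e2 : ν.pos S = ν.pos (S ∩ sᶜ) := by
    rw [← measure_inter_add_sdiff S hs, measure_mono_null inter_subset_right h0, zero_add,
      sdiff_eq]
  have e3 : ν.pos.real (S ∩ sᶜ) ≤ ν'.pos.real (S ∩ sᶜ) := by
    have : 0 ≤ ν'.neg.real (S ∩ sᶜ) := measureReal_nonneg
    simp only [value, e1] at hv
    linarith
  rw [e2]
  refine le_trans ?_ (measure_mono (inter_subset_left (t := sᶜ)))
  exact (ENNReal.toReal_le_toReal hTb.measure_lt_top.ne hTb.measure_lt_top.ne).1 e3

lemma ext_value {ν ν' : SignedRadonMeasure}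
    (h : ∀ S : Set ℂ, MeasurableSet S → Bornology.IsBounded S → ν.value S = ν'.value S) :
    ν = ν' := by
  have hp : ν.pos = ν'.pos := measure_ext_of_bounded fun S hS hb =>
    le_antisymm (pos_le_of_value_eq h hS hb)
      (pos_le_of_value_eq (fun T hT hTb => (h T hT hTb).symm) hS hb)
  refine SignedRadonMeasure.ext hp (measure_ext_of_bounded fun S hS hb => ?_)
  have := h S hS hb
  rw [value, value, hp, sub_right_inj] at this
  exact (ENNReal.toReal_eq_toReal_iff' hb.measure_lt_top.ne hb.measure_lt_top.ne).1 this

/-- The atomic measure with mass `w⁺` at the points of `A`. -/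
noncomputable def atomic (A : Set ℂ) (w : ℂ → ℝ) : Measure ℂ :=
  Measure.sum fun z : A => ENNReal.ofReal (w z) • Measure.dirac (z : ℂ)

lemma atomic_apply {A : Set ℂ} (w : ℂ → ℝ) {S : Set ℂ} (hS : MeasurableSet S)
    (hf : (A ∩ S).Finite) :
    atomic A w S = ∑ z ∈ hf.toFinset, ENNReal.ofReal (w z) := by
  classical
  rw [atomic, Measure.sum_apply _ hS]
  simp only [Measure.smul_apply, Measure.dirac_apply' _ hS, smul_eq_mul]
  rw [tsum_subtype A (fun z => ENNReal.ofReal (w z) * S.indicator 1 z),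
    tsum_eq_sum (s := hf.toFinset)]
  · refine Finset.sum_congr rfl fun z hz => ?_
    have hz' : z ∈ A ∩ S := by simpa using hz
    simp [hz'.1, hz'.2]
  · intro z hz
    have hz' : ¬ (z ∈ A ∧ z ∈ S) := by simpa using hz
    by_cases hA : z ∈ A
    · have : z ∉ S := fun h => hz' ⟨hA, h⟩
      simp [this]
    · simp [hA]

lemma exists_isReduction (μ : SignedRadonMeasure) : ∃ ν, IsReduction μ ν := by
  classical
  have hpi := Real.pi_pos
  set m : ℂ → ℝ := fun z => μ.value {z} with hm
  set n : ℂ → ℤ := fun z => ⌊(m z + Real.pi) / (2 * Real.pi)⌋ with hn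
  set A : Set ℂ := {z | n z ≠ 0} with hA
  set r : ℂ → ℝ := fun z => m z - 2 * Real.pi * n z with hr
  have hrange : ∀ z, r z ∈ Ico (-Real.pi) Real.pi := by
    intro z
    have h1 := Int.floor_le ((m z + Real.pi) / (2 * Real.pi))
    have h2 := Int.lt_floor_add_one ((m z + Real.pi) / (2 * Real.pi))
    rw [le_div_iff₀ (by positivity)] at h1
    rw [div_lt_iff₀ (by positivity)] at h2
    simp only [hr, hn]
    constructor <;> nlinarith
  have hmA : ∀ z ∈ A, Real.pi ≤ |m z| := by
    intro z hz
    by_contra hlt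
    push Not at hlt
    obtain ⟨h1, h2⟩ := abs_lt.1 hlt
    apply hz
    simp only [hn]
    rw [Int.floor_eq_zero_iff]
    constructor
    · apply div_nonneg <;> linarith
    · rw [div_lt_one (by positivity)]; linarith
  have hfin : ∀ S : Set ℂ, Bornology.IsBounded S → (A ∩ S).Finite := by
    intro S hb
    have hfm : μ.variation (toMeasurable μ.variation (A ∩ S)) ≠ ⊤ := by
      have : μ.variation (A ∩ S) < ⊤ := by
        have hb' := hb.subset (inter_subset_right (s := A))
        simp only [variation, Measure.add_apply]
        exact ENNReal.add_lt_top.2 ⟨hb'.measure_lt_top, hb'.measure_lt_top⟩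
      rw [measure_toMeasurable]; exact this.ne
    have hle : ∀ z ∈ A, ENNReal.ofReal Real.pi ≤ μ.variation {z} := by
      intro z hz
      have hz2 := hmA z hz
      have hfin1 : μ.pos {z} ≠ ⊤ := (Bornology.isBounded_singleton.measure_lt_top).ne
      have hfin2 : μ.neg {z} ≠ ⊤ := (Bornology.isBounded_singleton.measure_lt_top).ne
      have e : μ.variation {z} = ENNReal.ofReal (μ.pos.real {z} + μ.neg.real {z}) := by
        rw [ENNReal.ofReal_add measureReal_nonneg measureReal_nonneg]
        simp [variation, measureReal_def, hfin1, hfin2]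
      rw [e]
      apply ENNReal.ofReal_le_ofReal
      refine hz2.trans ?_
      have p1 : 0 ≤ μ.pos.real {z} := measureReal_nonneg
      have p2 : 0 ≤ μ.neg.real {z} := measureReal_nonneg
      simp only [hm, value]
      rw [abs_le]; constructor <;> linarith
    have hmeas : μ.variation (⋃ z : ↥(A ∩ S), {(z : ℂ)}) ≠ ⊤ := by
      rw [iUnion_of_singleton_coe]
      rwa [measure_toMeasurable] at hfm
    have := Measure.finite_const_le_meas_of_disjoint_iUnion μ.variation
      (ε := ENNReal.ofReal Real.pi) (by simpa using hpi)
      (As := fun z : ↥(A ∩ S) => {(z : ℂ)}) (fun _ => measurableSet_singleton _)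
      (fun a b hab => by simpa [Function.onFun, Subtype.ext_iff] using hab) hmeas
    have huniv : {i : ↥(A ∩ S) | ENNReal.ofReal Real.pi ≤ μ.variation {(i : ℂ)}} = univ := by
      ext i; simpa using hle i i.2.1
    rw [huniv] at this
    exact Set.finite_coe_iff.1 (Set.finite_univ_iff.1 this)
  have hAc : A.Countable := by
    have : A = ⋃ k : ℕ, A ∩ Metric.closedBall (0 : ℂ) k := by
      rw [← inter_iUnion, Metric.iUnion_closedBall_nat, inter_univ]
    rw [this]
    exact countable_iUnion fun k => (hfin _ Metric.isBounded_closedBall).countable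
  have hAm : MeasurableSet A := hAc.measurableSet
  have hlf : ∀ (P : Measure ℂ) [IsLocallyFiniteMeasure P] (w : ℂ → ℝ),
      IsLocallyFiniteMeasure (P.restrict Aᶜ + atomic A w) := by
    intro P _ w
    refine ⟨fun x => ⟨Metric.ball x 1, Metric.ball_mem_nhds x one_pos, ?_⟩⟩
    rw [Measure.add_apply, ENNReal.add_lt_top]
    constructor
    · exact (Measure.restrict_apply_le _ _).trans_lt Metric.isBounded_ball.measure_lt_top
    · rw [atomic_apply w measurableSet_ball (hfin _ Metric.isBounded_ball)]
      exact ENNReal.sum_lt_top.2 fun _ _ => ENNReal.ofReal_lt_top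
  have hsing : (μ.pos.restrict Aᶜ + atomic A r).MutuallySingular
      (μ.neg.restrict Aᶜ + atomic A (fun z => -r z)) := by
    obtain ⟨s, hs, h0, h1⟩ := μ.mutuallySingular
    have hA1 : MeasurableSet {z ∈ A | r z ≤ 0} := (hAc.mono (sep_subset _ _)).measurableSet
    refine ⟨(s \ A) ∪ {z ∈ A | r z ≤ 0}, (hs.diff hAm).union hA1, ?_, ?_⟩
    · have hmT := (hs.diff hAm).union hA1
      rw [Measure.add_apply, Measure.restrict_apply hmT, atomic, Measure.sum_apply _ hmT]
      have : μ.pos ((s \ A ∪ {z ∈ A | r z ≤ 0}) ∩ Aᶜ) = 0 := by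
        refine measure_mono_null ?_ h0
        rintro z ⟨h | h, h'⟩
        · exact h.1
        · exact absurd h.1 h'
      rw [this, zero_add, ENNReal.tsum_eq_zero]
      rintro ⟨z, hz⟩
      by_cases hz0 : r z ≤ 0
      · simp [ENNReal.ofReal_eq_zero.2 hz0]
      · simp [hz, hz0]
    · have hmT := ((hs.diff hAm).union hA1).compl
      rw [Measure.add_apply, Measure.restrict_apply hmT, atomic, Measure.sum_apply _ hmT]
      have : μ.neg ((s \ A ∪ {z ∈ A | r z ≤ 0})ᶜ ∩ Aᶜ) = 0 := by
        refine measure_mono_null ?_ h1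
        rintro z ⟨h, h'⟩ hzs
        exact h (Or.inl ⟨hzs, h'⟩)
      rw [this, zero_add, ENNReal.tsum_eq_zero]
      rintro ⟨z, hz⟩
      by_cases hz0 : r z ≤ 0
      · simp [Measure.dirac_apply' _ hmT, hz, hz0]
      · simp [ENNReal.ofReal_eq_zero.2 (by linarith : -r z ≤ 0)]
  let ν : SignedRadonMeasure :=
    { pos := μ.pos.restrict Aᶜ + atomic A r
      neg := μ.neg.restrict Aᶜ + atomic A (fun z => -r z)
      locallyFinite_pos := hlf _ _
      locallyFinite_neg := hlf _ _
      mutuallySingular := hsing }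
  have hreal : ∀ (w : ℂ → ℝ) (S : Set ℂ) (hS : MeasurableSet S) (hb : Bornology.IsBounded S),
      (atomic A w).real S = ∑ z ∈ (hfin S hb).toFinset, max (w z) 0 := by
    intro w S hS hb
    rw [measureReal_def, atomic_apply w hS (hfin S hb),
      ENNReal.toReal_sum fun _ _ => ENNReal.ofReal_ne_top]
    simp [ENNReal.toReal_ofReal']
  have hpart : ∀ (P : Measure ℂ) [IsLocallyFiniteMeasure P] (S : Set ℂ) (hS : MeasurableSet S)
      (hb : Bornology.IsBounded S), P.real S =
        P.real (S ∩ Aᶜ) + ∑ z ∈ (hfin S hb).toFinset, P.real {z} := by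
    intro P _ S hS hb
    have hfinS : P S ≠ ⊤ := hb.measure_lt_top.ne
    rw [← measureReal_inter_add_sdiff₀ (s := S) (t := A) hAm.nullMeasurableSet hfinS, add_comm,
      sdiff_eq]
    congr 1
    have : S ∩ A = ((hfin S hb).toFinset : Set ℂ) := by simp [inter_comm]
    rw [this, ← sum_measureReal_singleton]
  have hν : ∀ (S : Set ℂ) (hS : MeasurableSet S) (hb : Bornology.IsBounded S),
      μ.value S - ν.value S = 2 * Real.pi * ∑ z ∈ (hfin S hb).toFinset, (n z : ℝ) := by
    intro S hS hb
    have e1 : ∀ (P : Measure ℂ) [IsLocallyFiniteMeasure P] (w : ℂ → ℝ),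
        (P.restrict Aᶜ + atomic A w).real S =
          P.real (S ∩ Aᶜ) + ∑ z ∈ (hfin S hb).toFinset, max (w z) 0 := by
      intro P _ w
      rw [← hreal w S hS hb, measureReal_add_apply (h₁ := ?_) (h₂ := ?_),
        measureReal_restrict_apply hS]
      · exact ((Measure.restrict_apply_le _ _).trans_lt hb.measure_lt_top).ne
      · rw [atomic_apply w hS (hfin _ hb)]
        exact (ENNReal.sum_lt_top.2 fun _ _ => ENNReal.ofReal_lt_top).ne
    have e2 : ∑ z ∈ (hfin S hb).toFinset, μ.pos.real {z} -
        ∑ z ∈ (hfin S hb).toFinset, μ.neg.real {z} -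
        (∑ z ∈ (hfin S hb).toFinset, max (r z) 0 - ∑ z ∈ (hfin S hb).toFinset, max (-r z) 0) =
        2 * Real.pi * ∑ z ∈ (hfin S hb).toFinset, (n z : ℝ) := by
      rw [← Finset.sum_sub_distrib, ← Finset.sum_sub_distrib, ← Finset.sum_sub_distrib,
        Finset.mul_sum]
      refine Finset.sum_congr rfl fun z _ => ?_
      have : max (r z) 0 - max (-r z) 0 = r z := by
        rcases le_total (r z) 0 with h | h
        · rw [max_eq_right h, max_eq_left (by linarith)]; ring
        · rw [max_eq_left h, max_eq_right (by linarith)]; ring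
      rw [this]
      simp only [hr, hm, value]
      ring
    rw [← e2]
    simp only [value, ν]
    rw [e1, e1, hpart μ.pos S hS hb, hpart μ.neg S hS hb]
    ring
  have hsum : ∀ (S : Set ℂ) (hb : Bornology.IsBounded S),
      ∑ᶠ (z : ℂ) (_ : z ∈ S), (n z : ℝ) = ∑ z ∈ (hfin S hb).toFinset, (n z : ℝ) := by
    intro S hb
    apply finsum_mem_eq_sum_of_inter_support_eq
    ext z
    simp only [mem_inter_iff, Function.mem_support, ne_eq, Int.cast_eq_zero, Finite.coe_toFinset,
      hA, mem_ofPred_eq]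
    tauto
  have hdiff : IsIntegerFluxDifference μ ν n := by
    refine ⟨fun R => ?_, fun S hS hb => by rw [hν S hS hb, hsum S hb]⟩
    refine (hfin (Metric.closedBall 0 R) Metric.isBounded_closedBall).subset ?_
    rintro z ⟨hz, hz'⟩
    exact ⟨hz, by simpa using hz'⟩
  refine ⟨ν, ⟨n, hdiff⟩, fun z => ?_⟩
  have h1 := hdiff.2 {z} (measurableSet_singleton z) Bornology.isBounded_singleton
  simp only [mem_singleton_iff, finsum_cond_eq_left] at h1
  have : ν.value {z} = r z := by simp only [hr, hm]; linarith
  rw [this]; exact hrange z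

/-- The equivalence class of any measure contains exactly one measure with all point masses in
`[-π, π)`. -/
theorem existsUnique_isReduction (μ : SignedRadonMeasure) : ∃! ν, IsReduction μ ν := by
  obtain ⟨ν, hν⟩ := exists_isReduction μ
  exact ⟨ν, hν, fun ν' hν' => ext_value fun S hS hb => value_eq_of_isReduction hν' hν hS hb⟩

/-- The reduction `μ*` of `μ`. -/
noncomputable def reduction (μ : SignedRadonMeasure) : SignedRadonMeasure :=
  (existsUnique_isReduction μ).choose

theorem reduction_spec (μ : SignedRadonMeasure) : IsReduction μ μ.reduction :=
  (existsUnique_isReduction μ).choose_spec.1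

end SignedRadonMeasure

/-! ### Distributional derivatives -/

/-- The Wirtinger derivative `∂_z = (∂₁ - i ∂₂) / 2` of a smooth function. -/
noncomputable def dz (φ : ℂ → ℂ) (x : ℂ) : ℂ := (fderiv ℝ φ x 1 - I * fderiv ℝ φ x I) / 2

/-- The Wirtinger derivative `∂_z̄ = (∂₁ + i ∂₂) / 2` of a smooth function. -/
noncomputable def dzbar (φ : ℂ → ℂ) (x : ℂ) : ℂ := (fderiv ℝ φ x 1 + I * fderiv ℝ φ x I) / 2

/-- `∂_z f = u` in the sense of distributions, for locally integrable `f` and `u`. -/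
def HasWeakDz (f u : ℂ → ℂ) : Prop :=
  LocallyIntegrable f ∧ LocallyIntegrable u ∧
  ∀ φ : ℂ → ℂ, ContDiff ℝ ∞ φ → HasCompactSupport φ → ∫ x, f x * dz φ x = - ∫ x, u x * φ x

/-- `∂_z̄ f = u` in the sense of distributions, for locally integrable `f` and `u`. -/
def HasWeakDzbar (f u : ℂ → ℂ) : Prop :=
  LocallyIntegrable f ∧ LocallyIntegrable u ∧
  ∀ φ : ℂ → ℂ, ContDiff ℝ ∞ φ → HasCompactSupport φ → ∫ x, f x * dzbar φ x = - ∫ x, u x * φ x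

open Classical in
/-- The distributional derivative `∂_z f`, if it is a locally integrable function (it is then
unique up to a null set), and `0` otherwise. -/
noncomputable def weakDz (f : ℂ → ℂ) : ℂ → ℂ :=
  if h : ∃ u, HasWeakDz f u then h.choose else 0

open Classical in
/-- The distributional derivative `∂_z̄ f`, if it is a locally integrable function (it is then
unique up to a null set), and `0` otherwise. -/
noncomputable def weakDzbar (f : ℂ → ℂ) : ℂ → ℂ :=
  if h : ∃ u, HasWeakDzbar f u then h.choose else 0

/-- `h ∈ L¹_loc` is a real function with `Δ h = μ` in the sense of distributions. -/
def IsPotential (h : ℂ → ℝ) (μ : SignedRadonMeasure) : Prop :=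
  LocallyIntegrable h ∧
  ∀ φ : ℂ → ℝ, ContDiff ℝ ∞ φ → HasCompactSupport φ →
    ∫ x, h x * (Δ φ) x = ∫ x, φ x ∂μ.pos - ∫ x, φ x ∂μ.neg

/-! ### The Pauli quadratic form and the Pauli operators -/

/-- The Hilbert space `L²(ℝ², ℂ²)` of spinors `ψ = (ψ₊, ψ₋)`. -/
abbrev Spinor : Type := Lp (EuclideanSpace ℂ (Fin 2)) 2 (volume : Measure ℂ)

/-- The function `e^{-h} ψ₊`. -/
noncomputable def upPart (h : ℂ → ℝ) (ψ : Spinor) (x : ℂ) : ℂ := (Real.exp (-h x) : ℂ) * ψ x 0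

/-- The function `e^{h} ψ₋`. -/
noncomputable def downPart (h : ℂ → ℝ) (ψ : Spinor) (x : ℂ) : ℂ := (Real.exp (h x) : ℂ) * ψ x 1

/-- The maximal form domain: the `ψ ∈ L²` such that `∂_z̄ (e^{-h} ψ₊)` is a function in
`L²(e^{2h} dx)` and `∂_z (e^{h} ψ₋)` is a function in `L²(e^{-2h} dx)`. -/
def pauliFormDomain (h : ℂ → ℝ) : Set Spinor :=
  {ψ | (∃ u, HasWeakDzbar (upPart h ψ) u ∧ MemLp (fun x => (Real.exp (h x) : ℂ) * u x) 2) ∧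
       (∃ v, HasWeakDz (downPart h ψ) v ∧ MemLp (fun x => (Real.exp (-h x) : ℂ) * v x) 2)}

/-- The Pauli quadratic (sesquilinear) form
`π^h(ψ, ξ) = 4 ∫ conj (∂_z̄ (e^{-h} ψ₊)) ∂_z̄ (e^{-h} ξ₊) e^{2h}
  + 4 ∫ conj (∂_z (e^{h} ψ₋)) ∂_z (e^{h} ξ₋) e^{-2h}`, for `ψ`, `ξ` in the form domain. -/
noncomputable def pauliForm (h : ℂ → ℝ) (ψ ξ : Spinor) : ℂ :=
  4 * (∫ x, conj (weakDzbar (upPart h ψ) x) * weakDzbar (upPart h ξ) x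
      * (Real.exp (2 * h x) : ℂ)) +
  4 * ∫ x, conj (weakDz (downPart h ψ) x) * weakDz (downPart h ξ) x
      * (Real.exp (-(2 * h x)) : ℂ)

/-- `H` is the operator `H_h` of the form `π^h`: `ψ ∈ D(H)` and `H ψ = η` if and only if
`ψ ∈ D(π^h)` and `(η, ξ) = π^h(ψ, ξ)` for all `ξ ∈ D(π^h)`. -/
def IsFormOperator (h : ℂ → ℝ) (H : Spinor →ₗ.[ℂ] Spinor) : Prop :=
  ∀ ψ η : Spinor, (ψ, η) ∈ H.graph ↔
    ψ ∈ pauliFormDomain h ∧ ∀ ξ ∈ pauliFormDomain h, ⟪η, ξ⟫_ℂ = pauliForm h ψ ξ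

/-- `U` is a gauge transformation `ψ ↦ (L / |L|) ψ` belonging to the integer point fluxes `n`:
`L = F · conj G`, where the entire function `F` has zeros exactly at the points with `n > 0`, of
multiplicity `n`, and the entire function `G` has zeros exactly at the points with `n < 0`, of
multiplicity `-n`. -/
def IsGaugeTransformation (n : ℂ → ℤ) (U : Spinor ≃ₗᵢ[ℂ] Spinor) : Prop :=
  ∃ F G : ℂ → ℂ, Differentiable ℂ F ∧ Differentiable ℂ G ∧
    (∀ z, analyticOrderAt F z = ((n z).toNat : ℕ∞)) ∧
    (∀ z, analyticOrderAt G z = ((-n z).toNat : ℕ∞)) ∧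
    ∀ ψ : Spinor, ∀ᵐ x : ℂ,
      (U ψ) x = ((F x * conj (G x)) / (‖F x * conj (G x)‖ : ℂ)) • ψ x

/-- `H` is a Pauli operator with magnetic field `μ`: `H = U* H_h U`, where `Δ h = μ*` and `U` is a
gauge transformation that belongs to the integer point fluxes `μ - μ*`. -/
def IsPauliOperator (μ : SignedRadonMeasure) (H : Spinor →ₗ.[ℂ] Spinor) : Prop :=
  ∃ (h : ℂ → ℝ) (H₀ : Spinor →ₗ.[ℂ] Spinor) (n : ℂ → ℤ) (U : Spinor ≃ₗᵢ[ℂ] Spinor),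
    IsPotential h μ.reduction ∧ IsFormOperator h H₀ ∧
    SignedRadonMeasure.IsIntegerFluxDifference μ μ.reduction n ∧ IsGaugeTransformation n U ∧
    ∀ ψ η : Spinor, (ψ, η) ∈ H.graph ↔ (U ψ, U η) ∈ H₀.graph

/-- The dimension of the kernel of an operator. -/
noncomputable def dimKer (H : Spinor →ₗ.[ℂ] Spinor) : Cardinal :=
  Module.rank ℂ (LinearMap.ker H.toFun)

/-- The third Pauli matrix. -/
def sigma3 : Matrix (Fin 2) (Fin 2) ℂ := !![1, 0; 0, -1]

end PauliMeasure

/-!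
Zero modes of Pauli operators (the Aharonov-Casher theorem) for measure valued magnetic fields.

The gauge transformation is unitary and multiplies by a function that is nonzero almost everywhere,
so the kernel may be computed for the form operator `H_h`. Since `(H_h ψ, ψ) = π^h(ψ, ψ)` is a sum
of two squares, `H_h ψ = 0` means `∂_z̄ (e^{-h} ψ₊) = 0` and `∂_z (e^h ψ₋) = 0` weakly, and by Weyl's
lemma (`exists_entire_ae_eq`) `ψ₊ = e^h f` and `ψ₋ = e^{-h} conj g` with entire `f` and `g`
(`mem_graph_zero_iff`).

Let `P` and `Q` be the positive and the negative part of `μ*`, and `Φ` its flux. The explicit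
potential `signedPotential P Q` also has the Laplacian `μ*`, so by Weyl's lemma
(`exists_entire_re_ae_eq`) `h` differs from it by the real part of an entire function, which can be
absorbed in `f` and `g`. Thus `h` may be taken to be `signedPotential P Q`, and the question is which
entire functions are square integrable against `e^{-2h}` or `e^{2h}`.

The analytic core is `lintegral_exp_logPotential_lt_top`: for a finite measure `Q` whose point masses
are less than `2π`, the exponential `exp(p_Q / π)` of its (nonnegative) logarithmic potential is
integrable against `(1 + |x|)^{-2-ε}` for every `ε > 0`. This follows from Jensen's inequality,
applied on small balls, where the mass is less than `2π`, and outside of large balls, where it is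
arbitrarily small. Hence `e^{±2h}` is bounded in the mean by `|x|^{±2Φ}`, up to arbitrarily small
powers (`integrable_exp_two_mul_signedPotential`). With the Cauchy-Schwarz inequality, an entire
function `E` with `e^{-h} E ∈ L²` is integrable against a power of `1 + |x|`, hence a polynomial, of
degree at most `Φ - 1` (`exists_polynomial_of_integrable`, `exists_polynomial_of_memLp`); conversely
all monomials of degree less than `Φ - 1` occur (`memLp_exp_neg_signedPotential_mul_pow`). This is
the dimension count for nonintegral `Φ`, and it leaves only the degree `Φ - 1` undecided when `Φ` is
a positive integer. If the field has compact support or a definite sign, then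
`h ≤ Φ log |x| + O(1)` at infinity, which excludes this degree (`coeff_eq_zero_of_memLp`). The
other sign of `Φ` is the same with the roles of `P`, `Q` and of the two components exchanged
(`rank_bounds_of_flux_nonneg`, `zeroModes_bounds`).

For the examples with flux `N` the potential is `(N / 2) log (e + |x|²)`, whose Laplacian has a
definite sign, for the smaller dimension. With the additional term `± log log (e + |x|²)`, which
does not change the flux, the critical monomial becomes square integrable, by the convergence of
`∫ dr / (r log² r)` at infinity (`radialPotential`, `exists_dimKer_of_integer_flux`).
-/

namespace PauliMeasure

/-! ### Radial integrals in the plane -/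

lemma integrableOn_norm_rpow_neg {a : ℝ} (ha : a < 2) (r : ℝ) :
    IntegrableOn (fun x : ℂ => ‖x‖ ^ (-a)) (Metric.ball 0 r) := by
  rw [integrableOn_fun_norm_addHaar volume (f := fun t => t ^ (-a)), Complex.finrank_real_complex]
  rcases le_or_gt r 0 with hr | hr
  · simp [Ioo_eq_empty (not_lt.2 hr)]
  have h : IntegrableOn (fun t : ℝ => t ^ (1 - a)) (Ioo 0 r) :=
    (intervalIntegral.integrableOn_Ioo_rpow_iff hr).2 (by linarith)
  refine h.congr_fun (fun t ht => ?_) measurableSet_Ioo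
  simp only [smul_eq_mul]
  rw [sub_eq_add_neg, Real.rpow_add ht.1]
  simp

lemma lintegral_norm_rpow_neg_ball_lt_top {a : ℝ} (ha : a < 2) (r : ℝ) :
    ∫⁻ x in Metric.ball (0 : ℂ) r, ENNReal.ofReal (‖x‖ ^ (-a)) < ⊤ :=
  (integrableOn_norm_rpow_neg ha r).lintegral_lt_top

lemma integrable_one_add_norm_rpow_neg {s : ℝ} (hs : 2 < s) :
    Integrable (fun x : ℂ => (1 + ‖x‖) ^ (-s)) :=
  integrable_one_add_norm (by simpa using hs)

/-- The kernel `1 / |x - y|`, against a decaying weight, has an integral bounded uniformly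
in the position `y` of the singularity. -/
lemma exists_lintegral_weight_kernel_le {δ : ℝ} (hδ : 0 < δ) :
    ∃ C : ENNReal, C ≠ ⊤ ∧ ∀ y : ℂ, ∫⁻ x : ℂ, ENNReal.ofReal
      ((1 + ‖x‖) ^ (-(2 + δ)) * (1 + (1 + ‖x‖) / ‖x - y‖)) ≤ C := by
  set w : ℂ → ℝ := fun x => (1 + ‖x‖) ^ (-(2 + δ)) with hw
  have hw0 : ∀ x, 0 ≤ w x := fun x => by positivity
  set g : ℂ → ℝ := fun u => (Metric.ball (0 : ℂ) 1).indicator (fun u => ‖u‖ ^ (-1 : ℝ)) u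
    + 2 ^ (2 + δ) * w u with hg
  have hwi : Integrable w := integrable_one_add_norm_rpow_neg (by linarith)
  have hgi : Integrable g := by
    refine Integrable.add ?_ (hwi.const_mul _)
    exact (integrable_indicator_iff measurableSet_ball).2
      (integrableOn_norm_rpow_neg (by norm_num) 1)
  have key : ∀ x y : ℂ, w x * (1 + (1 + ‖x‖) / ‖x - y‖) ≤ 2 * w x + g (x - y) := by
    intro x y
    set t := ‖x - y‖ with ht
    have hx : 0 ≤ ‖x‖ := norm_nonneg x
    have ht0 : 0 ≤ t := norm_nonneg _
    have hwx : w x * (1 + ‖x‖) = (1 + ‖x‖) ^ (-(1 + δ)) := by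
      have h1 : 0 < 1 + ‖x‖ := by positivity
      rw [show -(1 + δ) = -(2 + δ) + 1 by ring, Real.rpow_add h1, Real.rpow_one]
    have e : w x * (1 + (1 + ‖x‖) / t) = w x + (1 + ‖x‖) ^ (-(1 + δ)) * t⁻¹ := by
      rw [← hwx]; ring
    rw [e]
    rcases lt_or_ge t 1 with h1 | h1
    -- for `|x - y| < 1` the local singularity dominates; otherwise the decay of one of the two
    -- weights is shared with the kernel, according to which of `1 + |x|` and `|x - y|` is larger
    · have hmem : x - y ∈ Metric.ball (0 : ℂ) 1 := by simpa [ht] using h1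
      have : (1 + ‖x‖) ^ (-(1 + δ)) ≤ 1 :=
        Real.rpow_le_one_of_one_le_of_nonpos (by linarith) (by linarith)
      have h2 : (1 + ‖x‖) ^ (-(1 + δ)) * t⁻¹ ≤ 1 * t⁻¹ := by gcongr
      have h3 : 0 ≤ 2 ^ (2 + δ) * w (x - y) := mul_nonneg (by positivity) (hw0 _)
      simp only [hg, indicator_of_mem hmem, Real.rpow_neg_one, ← ht]
      have := hw0 x
      linarith
    · have hnm : x - y ∉ Metric.ball (0 : ℂ) 1 := by simpa [ht] using h1
      simp only [hg, indicator_of_notMem hnm]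
      have hpos : 0 < t := by linarith
      rcases le_total (1 + ‖x‖) t with h2 | h2
      · have h3 : (1 + ‖x‖) ^ (-(1 + δ)) * t⁻¹ ≤ (1 + ‖x‖) ^ (-(1 + δ)) * (1 + ‖x‖)⁻¹ := by
          gcongr
        have h4 : (1 + ‖x‖) ^ (-(1 + δ)) * (1 + ‖x‖)⁻¹ = w x := by
          rw [← hwx, mul_assoc, mul_inv_cancel₀ (by positivity), mul_one]
        have h5 : 0 ≤ 2 ^ (2 + δ) * w (x - y) := mul_nonneg (by positivity) (hw0 _)
        linarith
      · have h3 : (1 + ‖x‖) ^ (-(1 + δ)) * t⁻¹ ≤ t ^ (-(1 + δ)) * t⁻¹ := by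
          have := Real.rpow_le_rpow_of_nonpos hpos h2 (by linarith : -(1 + δ) ≤ 0)
          gcongr
        have h4 : t ^ (-(1 + δ)) * t⁻¹ = t ^ (-(2 + δ)) := by
          rw [← Real.rpow_neg_one t, ← Real.rpow_add hpos]; congr 1; ring
        have h5 : t ^ (-(2 + δ)) ≤ 2 ^ (2 + δ) * w (x - y) := by
          have : ((1 + t) / 2) ^ (-(2 + δ)) = 2 ^ (2 + δ) * w (x - y) := by
            rw [Real.div_rpow (by positivity) (by positivity), Real.rpow_neg (by norm_num : (0:ℝ) ≤ 2),
              div_inv_eq_mul, mul_comm]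
          rw [← this]
          exact Real.rpow_le_rpow_of_nonpos (by positivity) (by linarith) (by linarith)
        have := hw0 x
        linarith
  refine ⟨(∫⁻ x, ENNReal.ofReal (2 * w x)) + ∫⁻ x, ENNReal.ofReal (g x), ?_, fun y => ?_⟩
  · exact ENNReal.add_ne_top.2 ⟨(hwi.const_mul 2).lintegral_lt_top.ne, hgi.lintegral_lt_top.ne⟩
  · calc _ ≤ ∫⁻ x, (ENNReal.ofReal (2 * w x) + ENNReal.ofReal (g (x - y))) :=
          lintegral_mono fun x => (ENNReal.ofReal_le_ofReal (key x y)).trans ENNReal.ofReal_add_le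
      _ = _ := by
          rw [lintegral_add_left (by fun_prop)]
          congr 1
          exact lintegral_sub_right_eq_self (fun x => ENNReal.ofReal (g x)) y

/-! ### The logarithmic kernel and exponential integrability of its potentials -/

/-- The logarithmic kernel `-log |x - y|`, normalized to be nonnegative on the whole plane by adding
`log (1 + |x|) + log (1 + |y|)`. On the diagonal it has the junk value `0`. -/
noncomputable def logKernel (x y : ℂ) : ℝ := Real.log ((1 + ‖x‖) * (1 + ‖y‖) / ‖x - y‖)

/-- The potential `x ↦ ∫ logKernel x y ∂Q(y)` of a positive measure. -/
noncomputable def logPotential (Q : Measure ℂ) (x : ℂ) : ℝ := ∫ y, logKernel x y ∂Q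

lemma logKernel_nonneg (x y : ℂ) : 0 ≤ logKernel x y := by
  rcases eq_or_ne x y with rfl | h
  · simp [logKernel]
  refine Real.log_nonneg ?_
  have h1 : 0 < ‖x - y‖ := norm_pos_iff.2 (sub_ne_zero.2 h)
  rw [one_le_div h1]
  nlinarith [norm_sub_le x y, norm_nonneg x, norm_nonneg y]

lemma logPotential_nonneg (Q : Measure ℂ) (x : ℂ) : 0 ≤ logPotential Q x :=
  integral_nonneg fun y => logKernel_nonneg x y

lemma measurable_logKernel : Measurable (Function.uncurry logKernel) := by
  unfold logKernel Function.uncurry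
  fun_prop

lemma measurable_logKernel_right (x : ℂ) : Measurable (logKernel x) :=
  measurable_logKernel.comp measurable_prodMk_left

lemma measurable_logPotential (Q : Measure ℂ) [SFinite Q] : Measurable (logPotential Q) :=
  (measurable_logKernel.stronglyMeasurable.integral_prod_right (ν := Q)).measurable

lemma logKernel_eq {x y : ℂ} (h : x ≠ y) :
    logKernel x y = Real.log (1 + ‖x‖) + Real.log (1 + ‖y‖) - Real.log ‖x - y‖ := by
  have h1 : 0 < ‖x - y‖ := norm_pos_iff.2 (sub_ne_zero.2 h)
  rw [logKernel, Real.log_div (by positivity) h1.ne', Real.log_mul (by positivity) (by positivity)]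

lemma exp_logKernel_le (x y : ℂ) :
    Real.exp (logKernel x y) ≤ (1 + ‖x‖) * (1 + (1 + ‖x‖) / ‖x - y‖) := by
  rcases eq_or_ne x y with rfl | h
  · simp [logKernel]
  have h1 : 0 < ‖x - y‖ := norm_pos_iff.2 (sub_ne_zero.2 h)
  rw [logKernel, Real.exp_log (by positivity), mul_div_assoc]
  gcongr
  rw [div_le_iff₀ h1, add_mul, div_mul_cancel₀ _ h1.ne']
  have : ‖y‖ ≤ ‖x‖ + ‖x - y‖ := by
    have := norm_sub_le x (x - y); simpa using this
  linarith

lemma exp_mul_logKernel_le {a : ℝ} (ha : 0 ≤ a) (x y : ℂ) :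
    Real.exp (a * logKernel x y) ≤ ((1 + ‖x‖) * (1 + (1 + ‖x‖) / ‖x - y‖)) ^ a := by
  rw [mul_comm, Real.exp_mul]
  exact Real.rpow_le_rpow (Real.exp_nonneg _) (exp_logKernel_le x y) ha

/-- Jensen's inequality for the exponential of an integral. -/
lemma ofReal_exp_mul_integral_le {α : Type*} [MeasurableSpace α] (Q : Measure α)
    [IsFiniteMeasure Q] {f : α → ℝ} (hf : Measurable f) (c : ℝ) :
    ENNReal.ofReal (Real.exp (c * ∫ y, f y ∂Q)) ≤
      1 + (Q univ)⁻¹ * ∫⁻ y, ENNReal.ofReal (Real.exp (c * Q.real univ * f y)) ∂Q := by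
  rcases eq_zero_or_neZero Q with rfl | hQ
  · simp
  have hM : Q univ ≠ 0 := NeZero.ne _
  by_cases hfi : Integrable f Q
  swap
  · -- the integral then has the junk value `0`, and the summand `1` suffices
    rw [integral_undef hfi]; simp
  refine le_trans ?_ le_add_self
  by_cases hei : Integrable (fun y => Real.exp (c * Q.real univ * f y)) Q
  swap
  · have : ∫⁻ y, ENNReal.ofReal (Real.exp (c * Q.real univ * f y)) ∂Q = ⊤ := by
      by_contra hne
      refine hei ⟨(by fun_prop), ?_⟩
      rw [hasFiniteIntegral_iff_ofReal (ae_of_all _ fun y => Real.exp_nonneg _)]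
      exact lt_top_iff_ne_top.2 hne
    rw [this, ENNReal.mul_top (by simp)]
    exact le_top
  have hJ := convexOn_exp.map_average_le (μ := Q) Real.continuous_exp.continuousOn isClosed_univ
    (f := fun y => c * Q.real univ * f y) (by simp) (hfi.const_mul _) hei
  have hM' : Q.real univ ≠ 0 := by
    simpa [measureReal_def, ENNReal.toReal_eq_zero_iff] using NeZero.ne Q
  rw [average_eq, average_eq, integral_const_mul, smul_eq_mul, smul_eq_mul,
    show (Q.real univ)⁻¹ * (c * Q.real univ * ∫ y, f y ∂Q) = c * ∫ y, f y ∂Q by field_simp] at hJ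
  refine (ENNReal.ofReal_le_ofReal hJ).trans ?_
  rw [ENNReal.ofReal_mul (by positivity), ofReal_integral_eq_lintegral_ofReal hei
    (ae_of_all _ fun y => Real.exp_nonneg _), ENNReal.ofReal_inv_of_pos (by positivity),
    ofReal_measureReal]

/-- The potential is split into the contribution of the sources in `B`, to which Jensen's inequality
applies, and the rest, where the kernel is at most `C`. -/
lemma ofReal_exp_logPotential_le (Q : Measure ℂ) [IsFiniteMeasure Q] {B : Set ℂ}
    (hB : MeasurableSet B) {x : ℂ} {C : ℝ} (hC : ∀ y ∉ B, logKernel x y ≤ C) :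
    ENNReal.ofReal (Real.exp (Real.pi⁻¹ * logPotential Q x)) ≤
      ENNReal.ofReal (Real.exp (Real.pi⁻¹ * (C * Q.real Bᶜ))) * (1 + (Q B)⁻¹ *
        ∫⁻ y in B, ENNReal.ofReal (Real.exp (Real.pi⁻¹ * Q.real B * logKernel x y)) ∂Q) := by
  have hpi := Real.pi_pos
  have h1 : logPotential Q x ≤ (∫ y in B, logKernel x y ∂Q) + C * Q.real Bᶜ := by
    by_cases hi : Integrable (logKernel x) Q
    · rw [logPotential, ← integral_add_compl hB hi]
      gcongr
      have := setIntegral_mono_on (μ := Q) (s := Bᶜ) (f := logKernel x) (g := fun _ => C)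
        hi.integrableOn (integrable_const _) hB.compl (fun y hy => hC y hy)
      simpa [mul_comm] using this
    · rw [logPotential, integral_undef hi]
      have h0 : 0 ≤ ∫ y in B, logKernel x y ∂Q := integral_nonneg fun y => logKernel_nonneg x y
      rcases Bᶜ.eq_empty_or_nonempty with h | ⟨y, hy⟩
      · simpa [h] using h0
      · have : 0 ≤ C := (logKernel_nonneg x y).trans (hC y hy)
        positivity
  have h2 := ofReal_exp_mul_integral_le (Q.restrict B) (measurable_logKernel_right x) Real.pi⁻¹
  simp only [Measure.restrict_apply_univ, measureReal_restrict_apply_univ] at h2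
  have h3 : Real.exp (Real.pi⁻¹ * logPotential Q x) ≤ Real.exp (Real.pi⁻¹ * (C * Q.real Bᶜ)) *
      Real.exp (Real.pi⁻¹ * ∫ y in B, logKernel x y ∂Q) := by
    rw [← Real.exp_add, ← mul_add, add_comm]
    gcongr
  refine (ENNReal.ofReal_le_ofReal h3).trans ?_
  rw [ENNReal.ofReal_mul (Real.exp_nonneg _)]
  exact mul_le_mul_right h2 _

/-- A weighted integral of a `y`-average is bounded by any uniform bound, in `y`, of the weighted
integrals. -/
lemma setLIntegral_mul_average_le (Q : Measure ℂ) [IsFiniteMeasure Q] {S B : Set ℂ}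
    (hB : MeasurableSet B) {w : ℂ → ENNReal} (hw : Measurable w)
    {f : ℂ → ℂ → ENNReal} (hf : Measurable (Function.uncurry f)) {D : ENNReal}
    (hD : ∀ y ∈ B, ∫⁻ x in S, w x * f x y ≤ D) :
    ∫⁻ x in S, w x * (1 + (Q B)⁻¹ * ∫⁻ y in B, f x y ∂Q) ≤ (∫⁻ x in S, w x) + D := by
  have hm2 : ∀ x, Measurable (f x) := fun x => hf.comp measurable_prodMk_left
  have hm : Measurable (Function.uncurry fun x y => w x * f x y) :=
    (hw.comp measurable_fst).mul hf
  have e : ∀ x, w x * (1 + (Q B)⁻¹ * ∫⁻ y in B, f x y ∂Q) =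
      w x + (Q B)⁻¹ * ∫⁻ y in B, w x * f x y ∂Q := by
    intro x
    rw [lintegral_const_mul _ (hm2 x)]
    ring
  have hm3 : Measurable fun x => ∫⁻ y in B, w x * f x y ∂Q := hm.lintegral_prod_right'
  simp_rw [e]
  rw [lintegral_add_left hw, lintegral_const_mul _ hm3, lintegral_lintegral_swap hm.aemeasurable]
  refine add_le_add le_rfl ?_
  have h1 : ∫⁻ y in B, (∫⁻ x in S, w x * f x y) ∂Q ≤ D * Q B := by
    rw [← setLIntegral_const]
    exact setLIntegral_mono' hB hD
  refine (mul_le_mul_right h1 _).trans ?_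
  rw [mul_comm D, ← mul_assoc]
  exact mul_le_of_le_one_left' (ENNReal.inv_mul_le_one _)

/-- The integrated form of `ofReal_exp_logPotential_le` over a region `S`. By Jensen's inequality the
exponent of the kernel is the mass of `B` divided by `π`, which is small if `B` is. -/
lemma setLIntegral_exp_logPotential_le (Q : Measure ℂ) [IsFiniteMeasure Q] {S B : Set ℂ}
    (hS : MeasurableSet S) (hB : MeasurableSet B) {w : ℂ → ENNReal} (hw : Measurable w)
    {C : ℝ} (hC : ∀ x ∈ S, ∀ y ∉ B, logKernel x y ≤ C) {D : ENNReal}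
    (hD : ∀ y ∈ B, ∫⁻ x in S, w x *
      ENNReal.ofReal (Real.exp (Real.pi⁻¹ * Q.real B * logKernel x y)) ≤ D) :
    ∫⁻ x in S, w x * ENNReal.ofReal (Real.exp (Real.pi⁻¹ * logPotential Q x)) ≤
      ENNReal.ofReal (Real.exp (Real.pi⁻¹ * (C * Q.real Bᶜ))) * ((∫⁻ x in S, w x) + D) := by
  have hfm : Measurable (Function.uncurry fun x y =>
      ENNReal.ofReal (Real.exp (Real.pi⁻¹ * Q.real B * logKernel x y))) :=
    (Real.measurable_exp.comp (measurable_logKernel.const_mul _)).ennreal_ofReal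
  refine le_trans ?_ (mul_le_mul_right (setLIntegral_mul_average_le Q hB hw hfm hD) _)
  rw [← lintegral_const_mul' _ _ ENNReal.ofReal_ne_top]
  refine setLIntegral_mono' hS fun x hx => ?_
  rw [mul_left_comm]
  exact mul_le_mul_right (ofReal_exp_logPotential_le Q hB (hC x hx)) _

/-- Near a point of mass less than `2π` the exponential of the potential is integrable. -/
lemma exists_ball_lintegral_exp_logPotential_lt_top (Q : Measure ℂ) [IsFiniteMeasure Q] {x₀ : ℂ}
    (hQ : Q {x₀} < ENNReal.ofReal (2 * Real.pi)) :
    ∃ r > 0, ∫⁻ x in Metric.ball x₀ r,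
      ENNReal.ofReal (Real.exp (Real.pi⁻¹ * logPotential Q x)) < ⊤ := by
  have hpi := Real.pi_pos
  -- the mass of a small ball is still less than `2π`, so that its `1/π`-fold is an integrable
  -- exponent
  obtain ⟨U, hU, hUo, hQU⟩ := Set.exists_isOpen_lt_of_lt {x₀} _ hQ
  obtain ⟨ρ, hρ, hball⟩ := Metric.isOpen_iff.1 hUo x₀ (hU rfl)
  set r := ρ / 2 with hr
  have hr0 : 0 < r := by positivity
  set B := Metric.ball x₀ (2 * r) with hB
  have hBU : Q B < ENNReal.ofReal (2 * Real.pi) :=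
    (measure_mono (by rwa [hB, show 2 * r = ρ by rw [hr]; ring])).trans_lt hQU
  set a := Real.pi⁻¹ * Q.real B with ha
  have ha0 : 0 ≤ a := by positivity
  have ha2 : a < 2 := by
    have := ENNReal.toReal_lt_of_lt_ofReal hBU
    rw [ha, inv_mul_lt_iff₀ hpi, mul_comm]
    exact this
  set A := 1 + ‖x₀‖ + r with hA
  have hA0 : 0 < A := by positivity
  have hxA : ∀ x ∈ Metric.ball x₀ r, 1 + ‖x‖ ≤ A := by
    intro x hx
    have h1 : ‖x - x₀‖ < r := by simpa [dist_eq_norm] using hx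
    have h2 := norm_le_norm_add_norm_sub' x x₀
    linarith
  refine ⟨r, hr0, ?_⟩
  have h3r : ∀ x ∈ Metric.ball x₀ r, ∀ y ∈ B, x - y ∈ Metric.ball (0 : ℂ) (3 * r) := by
    intro x hx y hy
    have h1 : dist x x₀ < r := hx
    have h2 : dist y x₀ < 2 * r := hy
    have h3 := dist_triangle_right x y x₀
    rw [mem_ball_zero_iff, ← dist_eq_norm]
    linarith
  set c := (A * (3 * r + A)) ^ a with hc
  have hc0 : 0 ≤ c := by positivity
  set D : ENNReal := volume (Metric.ball x₀ r) + ENNReal.ofReal c *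
    ∫⁻ u in Metric.ball (0 : ℂ) (3 * r), ENNReal.ofReal (‖u‖ ^ (-a)) with hD
  have hDtop : D ≠ ⊤ := ENNReal.add_ne_top.2 ⟨measure_ball_lt_top.ne, ENNReal.mul_ne_top
    ENNReal.ofReal_ne_top (lintegral_norm_rpow_neg_ball_lt_top ha2 _).ne⟩
  have main := setLIntegral_exp_logPotential_le Q (S := Metric.ball x₀ r) (B := B)
    measurableSet_ball measurableSet_ball (w := fun _ => 1) measurable_const
    (C := Real.log (A * (1 + A / r))) ?_ (D := D) ?_
  · simp only [one_mul] at main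
    refine main.trans_lt (ENNReal.mul_lt_top ENNReal.ofReal_lt_top ?_)
    refine ENNReal.add_lt_top.2 ⟨?_, lt_top_iff_ne_top.2 hDtop⟩
    rw [setLIntegral_const, one_mul]
    exact measure_ball_lt_top
  · intro x hx y hy
    have h1 : r ≤ ‖x - y‖ := by
      have h1 : dist x x₀ < r := hx
      have h2 : 2 * r ≤ dist y x₀ := not_lt.1 hy
      have h3 := dist_triangle_left y x₀ x
      rw [← dist_eq_norm]
      linarith
    rw [Real.le_log_iff_exp_le (by positivity)]
    refine (exp_logKernel_le x y).trans ?_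
    have := hxA x hx
    gcongr
  · intro y hy
    have hb : ∀ x ∈ Metric.ball x₀ r, Real.exp (a * logKernel x y) ≤
        1 + c * ‖x - y‖ ^ (-a) := by
      intro x hx
      rcases eq_or_ne x y with rfl | h
      · have : 0 ≤ c * ‖x - x‖ ^ (-a) := by positivity
        simp only [logKernel, sub_self, norm_zero, div_zero, Real.log_zero, mul_zero, Real.exp_zero]
        simp only [sub_self, norm_zero] at this
        linarith
      have ht : 0 < ‖x - y‖ := norm_pos_iff.2 (sub_ne_zero.2 h)
      have ht3 : ‖x - y‖ < 3 * r := by simpa using h3r x hx y hy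
      have h1 := exp_mul_logKernel_le ha0 x y
      have h2 : (1 + ‖x‖) * (1 + (1 + ‖x‖) / ‖x - y‖) ≤ (A * (3 * r + A)) / ‖x - y‖ := by
        rw [le_div_iff₀ ht, mul_assoc, add_mul _ _ ‖x - y‖, div_mul_cancel₀ _ ht.ne', one_mul]
        have := hxA x hx
        gcongr
      have h3 : ((A * (3 * r + A)) / ‖x - y‖) ^ a = c * ‖x - y‖ ^ (-a) := by
        rw [Real.div_rpow (by positivity) ht.le, Real.rpow_neg ht.le, div_eq_mul_inv]
      have h4 := Real.rpow_le_rpow (by positivity) h2 ha0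
      linarith
    calc _ ≤ ∫⁻ x in Metric.ball x₀ r, (1 + ENNReal.ofReal c *
          (Metric.ball (0 : ℂ) (3 * r)).indicator (fun u => ENNReal.ofReal (‖u‖ ^ (-a))) (x - y)) := by
          refine setLIntegral_mono' measurableSet_ball fun x hx => ?_
          rw [indicator_of_mem (h3r x hx y hy), one_mul, ← ENNReal.ofReal_mul hc0]
          refine (ENNReal.ofReal_le_ofReal (hb x hx)).trans ENNReal.ofReal_add_le |>.trans ?_
          simp
      _ ≤ D := by
          rw [lintegral_add_left measurable_const, lintegral_const_mul' _ _ ENNReal.ofReal_ne_top,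
            setLIntegral_const, one_mul]
          refine add_le_add le_rfl (mul_le_mul_right ?_ _)
          refine (setLIntegral_le_lintegral _ _).trans ?_
          rw [lintegral_sub_right_eq_self (μ := volume), lintegral_indicator measurableSet_ball]

/-- At infinity the exponential of the potential grows slower than any power, in the mean. -/
lemma exists_compl_ball_lintegral_exp_logPotential_lt_top (Q : Measure ℂ) [IsFiniteMeasure Q]
    {ε : ℝ} (hε : 0 < ε) :
    ∃ R : ℝ, ∫⁻ x in (Metric.closedBall (0 : ℂ) R)ᶜ, ENNReal.ofReal ((1 + ‖x‖) ^ (-(2 + ε))) *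
      ENNReal.ofReal (Real.exp (Real.pi⁻¹ * logPotential Q x)) < ⊤ := by
  have hpi := Real.pi_pos
  -- the mass outside a large ball is so small that the exponent is at most `1` and `ε / 2`
  have hη : 0 < min 1 (ε / 2) := by positivity
  obtain ⟨K, -, hK, hQK⟩ := MeasurableSet.univ.exists_isCompact_sdiff_lt (measure_ne_top Q _)
    (ε := ENNReal.ofReal (Real.pi * min 1 (ε / 2))) (by simpa using mul_pos hpi hη)
  obtain ⟨R', hR'⟩ := hK.isBounded.subset_closedBall 0
  set R := max R' 1 with hR
  have hR1 : 1 ≤ R := le_max_right _ _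
  set B := (Metric.closedBall (0 : ℂ) R)ᶜ with hB
  have hQB : Q B < ENNReal.ofReal (Real.pi * min 1 (ε / 2)) := by
    refine (measure_mono ?_).trans_lt hQK
    intro x hx
    refine ⟨mem_univ _, fun hxK => hx ?_⟩
    exact Metric.closedBall_subset_closedBall (le_max_left _ _) (hR' hxK)
  set a := Real.pi⁻¹ * Q.real B with ha
  have ha0 : 0 ≤ a := by positivity
  have ham : a < min 1 (ε / 2) := by
    have := ENNReal.toReal_lt_of_lt_ofReal hQB
    rwa [ha, inv_mul_lt_iff₀ hpi]
  have ha1 : a ≤ 1 := (ham.trans_le (min_le_left _ _)).le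
  have ha2 : a ≤ ε / 2 := (ham.trans_le (min_le_right _ _)).le
  obtain ⟨D, hDtop, hD⟩ := exists_lintegral_weight_kernel_le (δ := ε / 2) (by positivity)
  refine ⟨2 * R, ?_⟩
  have main := setLIntegral_exp_logPotential_le Q (S := (Metric.closedBall (0 : ℂ) (2 * R))ᶜ)
    (B := B) measurableSet_closedBall.compl measurableSet_closedBall.compl
    (w := fun x => ENNReal.ofReal ((1 + ‖x‖) ^ (-(2 + ε)))) (by fun_prop)
    (C := Real.log (4 * (1 + R))) ?_ (D := D) ?_
  · refine main.trans_lt (ENNReal.mul_lt_top ENNReal.ofReal_lt_top ?_)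
    refine ENNReal.add_lt_top.2 ⟨?_, lt_top_iff_ne_top.2 hDtop⟩
    exact (setLIntegral_le_lintegral _ _).trans_lt
      (integrable_one_add_norm_rpow_neg (by linarith)).lintegral_lt_top
  · intro x hx y hy
    have hx' : 2 * R < ‖x‖ := by simpa using hx
    have hy' : ‖y‖ ≤ R := by simpa [hB] using hy
    have h1 : ‖x‖ / 2 ≤ ‖x - y‖ := by
      have := norm_sub_norm_le x y
      linarith
    refine Real.log_le_log (div_pos (by positivity) (by linarith)) ?_
    rw [div_le_iff₀ (by linarith)]
    nlinarith
  · intro y hy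
    refine le_trans ?_ (hD y)
    refine (setLIntegral_le_lintegral _ _).trans (lintegral_mono fun x => ?_)
    rw [← ENNReal.ofReal_mul (by positivity)]
    refine ENNReal.ofReal_le_ofReal ?_
    have hx1 : 1 ≤ 1 + ‖x‖ := by linarith [norm_nonneg x]
    have hz1 : 1 ≤ 1 + (1 + ‖x‖) / ‖x - y‖ := by
      have : 0 ≤ (1 + ‖x‖) / ‖x - y‖ := by positivity
      linarith
    calc _ ≤ (1 + ‖x‖) ^ (-(2 + ε)) * ((1 + ‖x‖) * (1 + (1 + ‖x‖) / ‖x - y‖)) ^ a := by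
          gcongr
          exact exp_mul_logKernel_le ha0 x y
      _ = (1 + ‖x‖) ^ (-(2 + ε) + a) * (1 + (1 + ‖x‖) / ‖x - y‖) ^ a := by
          rw [Real.mul_rpow (by positivity) (by positivity), Real.rpow_add (by positivity)]
          ring
      _ ≤ (1 + ‖x‖) ^ (-(2 + ε / 2)) * (1 + (1 + ‖x‖) / ‖x - y‖) ^ (1 : ℝ) := by
          gcongr
          linarith
      _ = _ := by rw [Real.rpow_one]

/-- The exponential of the potential of a finite measure with point masses less than `2π` is
integrable against all weights that decay faster than `|x|⁻²`. -/
theorem lintegral_exp_logPotential_lt_top (Q : Measure ℂ) [IsFiniteMeasure Q]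
    (hQ : ∀ x, Q {x} < ENNReal.ofReal (2 * Real.pi)) {ε : ℝ} (hε : 0 < ε) :
    ∫⁻ x, ENNReal.ofReal ((1 + ‖x‖) ^ (-(2 + ε))) *
      ENNReal.ofReal (Real.exp (Real.pi⁻¹ * logPotential Q x)) < ⊤ := by
  obtain ⟨R, hR⟩ := exists_compl_ball_lintegral_exp_logPotential_lt_top Q hε
  set g : ℂ → ENNReal := fun x => ENNReal.ofReal (Real.exp (Real.pi⁻¹ * logPotential Q x)) with hg
  have hloc : (volume.withDensity g) (Metric.closedBall (0 : ℂ) R) < ⊤ := by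
    refine (isCompact_closedBall _ _).measure_lt_top_of_nhdsWithin fun x _ => ?_
    obtain ⟨r, hr, hfin⟩ := exists_ball_lintegral_exp_logPotential_lt_top Q (hQ x)
    refine ⟨Metric.ball x r, mem_nhdsWithin_of_mem_nhds (Metric.ball_mem_nhds x hr), ?_⟩
    rwa [withDensity_apply _ measurableSet_ball]
  rw [withDensity_apply _ measurableSet_closedBall] at hloc
  rw [← lintegral_add_compl _ (measurableSet_closedBall (x := (0 : ℂ)) (ε := R))]
  refine ENNReal.add_lt_top.2 ⟨?_, hR⟩
  refine (lintegral_mono fun x => ?_).trans_lt hloc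
  refine mul_le_of_le_one_left' ?_
  rw [ENNReal.ofReal_le_one]
  exact Real.rpow_le_one_of_one_le_of_nonpos (by linarith [norm_nonneg x]) (by linarith)

/-! ### Entire functions of polynomial growth in the mean -/

/-- Cauchy's estimate with the mean over the circle of radius `r` instead of the maximum. -/
lemma norm_cauchyPowerSeries_mul_pow_le {G : ℂ → ℂ} (hG : Differentiable ℂ G) (m : ℕ) {r : ℝ}
    (hr : 0 < r) : 2 * Real.pi * (‖cauchyPowerSeries G 0 1 m‖ * r ^ m) ≤
      ∫ θ in Ioo (-Real.pi) Real.pi, ‖G (circleMap 0 r θ)‖ := by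
  have hpi := Real.pi_pos
  lift r to NNReal using hr.le
  have h1 := hG.hasFPowerSeriesOnBall 0 (R := 1) one_pos
  have h2 := hG.hasFPowerSeriesOnBall 0 (R := r) (by exact_mod_cast hr)
  have h3 := h1.hasFPowerSeriesAt.eq_formalMultilinearSeries h2.hasFPowerSeriesAt
  have h4 := norm_cauchyPowerSeries_le G 0 r m
  rw [NNReal.coe_one] at h3
  rw [h3]
  have hper : Function.Periodic (fun θ => ‖G (circleMap 0 r θ)‖) (2 * Real.pi) := fun θ => by
    simp [periodic_circleMap 0 (r : ℝ) θ]
  have h5 := hper.intervalIntegral_add_eq 0 (-Real.pi)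
  rw [zero_add, show -Real.pi + 2 * Real.pi = Real.pi by ring,
    intervalIntegral.integral_of_le (a := -Real.pi) (by linarith),
    integral_Ioc_eq_integral_Ioo] at h5
  rw [h5, abs_of_pos hr] at h4
  have h6 : ((r : ℝ)⁻¹) ^ m * (r : ℝ) ^ m = 1 := by
    rw [← mul_pow, inv_mul_cancel₀ hr.ne', one_pow]
  calc _ ≤ 2 * Real.pi * (((2 * Real.pi)⁻¹ * ∫ θ in Ioo (-Real.pi) Real.pi,
        ‖G (circleMap 0 r θ)‖) * (r : ℝ)⁻¹ ^ m * r ^ m) := by gcongr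
    _ = _ := by
      rw [mul_assoc _ _ ((r : ℝ) ^ m), h6]
      field_simp

/-- Integration in polar coordinates, against a radial weight. -/
lemma lintegral_radial_mul_norm {G : ℂ → ℂ} (hG : Differentiable ℂ G) {w : ℝ → ℝ}
    (hw : Measurable w) (hw0 : ∀ r, 0 < r → 0 ≤ w r) :
    ∫⁻ x : ℂ, ENNReal.ofReal (w ‖x‖ * ‖G x‖) = ∫⁻ r in Ioi (0 : ℝ),
      ENNReal.ofReal (r * w r * ∫ θ in Ioo (-Real.pi) Real.pi, ‖G (circleMap 0 r θ)‖) := by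
  have hGc := hG.continuous
  rw [← Complex.lintegral_comp_polarCoord_symm]
  have e : ∀ p ∈ polarCoord.target, ENNReal.ofReal p.1 • ENNReal.ofReal
      (w ‖Complex.polarCoord.symm p‖ * ‖G (Complex.polarCoord.symm p)‖) =
      ENNReal.ofReal (p.1 * w p.1 * ‖G (circleMap 0 p.1 p.2)‖) := by
    intro p hp
    have hp0 : 0 < p.1 := hp.1
    rw [Complex.norm_polarCoord_symm, abs_of_pos hp0, smul_eq_mul, ← ENNReal.ofReal_mul hp0.le,
      mul_assoc]
    congr 5
    rw [Complex.polarCoord_symm_apply, circleMap, zero_add, Complex.exp_mul_I]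
    simp
  rw [setLIntegral_congr_fun polarCoord.open_target.measurableSet e, polarCoord_target,
    Measure.volume_eq_prod, ← Measure.prod_restrict, lintegral_prod]
  · refine setLIntegral_congr_fun measurableSet_Ioi fun r hr => ?_
    have hr : 0 < r := hr
    have h0 : 0 ≤ r * w r := mul_nonneg hr.le (hw0 r hr)
    have hc : Continuous fun θ => ‖G (circleMap 0 r θ)‖ := by fun_prop
    simp only [ENNReal.ofReal_mul h0]
    rw [lintegral_const_mul _ (by fun_prop), ofReal_integral_eq_lintegral_ofReal]
    · exact (hc.integrableOn_Icc (a := -Real.pi) (b := Real.pi)).mono_set Ioo_subset_Icc_self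
    · exact ae_of_all _ fun θ => norm_nonneg _
  · have : Continuous fun p : ℝ × ℝ => ‖G (circleMap 0 p.1 p.2)‖ := by
      unfold circleMap; fun_prop
    have h2 : Measurable fun p : ℝ × ℝ => w p.1 := hw.comp measurable_fst
    exact ((measurable_fst.mul h2).mul this.measurable).ennreal_ofReal.aemeasurable

/-- A nonzero coefficient of order `m ≥ s - 2` forces the integrand, in polar coordinates, to be at
least of the order `1 / r`, which is not integrable. -/
lemma cauchyPowerSeries_eq_zero_of_integrable {G : ℂ → ℂ} (hG : Differentiable ℂ G) {s : ℝ}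
    (hi : Integrable fun x => (1 + ‖x‖) ^ (-s) * ‖G x‖) {m : ℕ} (hm : s ≤ m + 2) :
    cauchyPowerSeries G 0 1 m = 0 := by
  by_contra hne
  have hpos : 0 < ‖cauchyPowerSeries G 0 1 m‖ := norm_pos_iff.2 hne
  have hpi := Real.pi_pos
  set c := 2 * Real.pi * ‖cauchyPowerSeries G 0 1 m‖ with hc
  have hc0 : 0 < c := by positivity
  have hfin := hi.lintegral_lt_top
  rw [lintegral_radial_mul_norm hG (w := fun r => (1 + r) ^ (-s)) (by fun_prop)
    (fun r hr => by positivity)] at hfin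
  have h1 : ∫⁻ r in Ioi (1 : ℝ), ENNReal.ofReal (c * (2 ^ (m + 2))⁻¹ * r ^ (-1 : ℝ)) < ⊤ := by
    refine (setLIntegral_mono' measurableSet_Ioi fun r hr => ?_).trans_lt
      ((lintegral_mono_set (Ioi_subset_Ioi zero_le_one)).trans_lt hfin)
    have hr : 1 < r := hr
    have hr0 : 0 < r := by linarith
    refine ENNReal.ofReal_le_ofReal ?_
    have h2 := norm_cauchyPowerSeries_mul_pow_le hG m hr0
    have h3 : (2 * r) ^ (-((m : ℝ) + 2)) ≤ (1 + r) ^ (-s) :=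
      calc (2 * r) ^ (-((m : ℝ) + 2)) ≤ (1 + r) ^ (-((m : ℝ) + 2)) :=
            Real.rpow_le_rpow_of_nonpos (by linarith) (by linarith) (by linarith)
        _ ≤ _ := Real.rpow_le_rpow_of_exponent_le (by linarith) (by linarith)
    have h4 : (2 * r) ^ (-((m : ℝ) + 2)) = (2 ^ (m + 2))⁻¹ * (r ^ (m + 2))⁻¹ := by
      rw [Real.rpow_neg (by positivity), show (m : ℝ) + 2 = ((m + 2 : ℕ) : ℝ) by push_cast; ring,
        Real.rpow_natCast, mul_pow, mul_inv]
    calc c * (2 ^ (m + 2))⁻¹ * r ^ (-1 : ℝ)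
        = r * ((2 ^ (m + 2))⁻¹ * (r ^ (m + 2))⁻¹) *
          (2 * Real.pi * (‖cauchyPowerSeries G 0 1 m‖ * r ^ m)) := by
          rw [Real.rpow_neg_one, hc]; field_simp; ring
      _ ≤ _ := by
          rw [← h4]
          gcongr
  have h2 : IntegrableOn (fun r : ℝ => c * (2 ^ (m + 2))⁻¹ * r ^ (-1 : ℝ)) (Ioi 1) := by
    refine ⟨(by fun_prop), ?_⟩
    rw [hasFiniteIntegral_iff_ofReal]
    · exact h1
    · refine (ae_restrict_mem measurableSet_Ioi).mono fun r hr => ?_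
      have hr : 1 < r := hr
      positivity
  have h3 := h2.const_mul (c * (2 ^ (m + 2))⁻¹)⁻¹
  have h4 : IntegrableOn (fun r : ℝ => r ^ (-1 : ℝ)) (Ioi 1) := by
    refine h3.congr (ae_of_all _ fun r => ?_)
    simp only
    rw [inv_mul_cancel_left₀ (by positivity)]
  exact absurd ((integrableOn_Ioi_rpow_iff one_pos).1 h4) (by norm_num)

/-- An entire function that is integrable against `(1 + |x|) ^ (-s)` is a polynomial of degree less
than `s - 2`. -/
theorem exists_polynomial_of_integrable {G : ℂ → ℂ} (hG : Differentiable ℂ G) {s : ℝ}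
    (hi : Integrable fun x => (1 + ‖x‖) ^ (-s) * ‖G x‖) :
    ∃ q : Polynomial ℂ, (∀ x, G x = q.eval x) ∧ ∀ m : ℕ, s ≤ m + 2 → q.coeff m = 0 := by
  set p := cauchyPowerSeries G 0 1 with hp
  have hps : HasFPowerSeriesOnBall G p 0 ⊤ := hG.hasFPowerSeriesOnBall 0 (R := 1) one_pos
  have h0 : ∀ m : ℕ, s ≤ m + 2 → p.coeff m = 0 := fun m hm => by
    have := cauchyPowerSeries_eq_zero_of_integrable hG hi hm
    rw [FormalMultilinearSeries.coeff, hp, this]; rfl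
  set n := ⌈s⌉₊ with hn
  refine ⟨∑ m ∈ Finset.range n, Polynomial.monomial m (p.coeff m), fun x => ?_, fun m hm => ?_⟩
  · have h1 := hps.hasSum (y := x) (by simp)
    rw [zero_add] at h1
    have h2 := h1.unique (hasSum_sum_of_ne_finset_zero (s := Finset.range n) fun m hm => ?_)
    · rw [h2, Polynomial.eval_finsetSum]
      refine Finset.sum_congr rfl fun m _ => ?_
      rw [FormalMultilinearSeries.apply_eq_pow_smul_coeff, Polynomial.eval_monomial, smul_eq_mul,
        mul_comm]
    · rw [FormalMultilinearSeries.apply_eq_pow_smul_coeff, h0, smul_zero]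
      have h3 : n ≤ m := by simpa using hm
      have h4 : s ≤ m := (Nat.le_ceil s).trans (by exact_mod_cast h3)
      linarith
  · rw [Polynomial.finsetSum_coeff]
    refine Finset.sum_eq_zero fun k _ => ?_
    rw [Polynomial.coeff_monomial]
    split_ifs with h
    · rw [h]; exact h0 m hm
    · rfl

/-! ### The Laplacian and the fundamental solution -/

lemma fderiv_fderiv_apply {E F : Type*} [NormedAddCommGroup E] [NormedSpace ℝ E]
    [NormedAddCommGroup F] [NormedSpace ℝ F] {f : E → F} (hf : ContDiff ℝ 2 f) (x v w : E) :
    fderiv ℝ (fun y => fderiv ℝ f y v) x w = fderiv ℝ (fderiv ℝ f) x w v := by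
  have h : DifferentiableAt ℝ (fderiv ℝ f) x :=
    (hf.fderiv_right (m := 1) (by norm_num)).differentiable (by norm_num) x
  rw [fderiv_clm_apply h (by fun_prop)]
  simp

/-- The Laplacian of the plane as the sum of the two iterated partial derivatives. -/
lemma laplacian_eq_fderiv {F : Type*} [NormedAddCommGroup F] [NormedSpace ℝ F] {f : ℂ → F}
    (hf : ContDiff ℝ 2 f) (x : ℂ) :
    (Δ f) x = fderiv ℝ (fun y => fderiv ℝ f y 1) x 1 + fderiv ℝ (fun y => fderiv ℝ f y I) x I := by
  rw [InnerProductSpace.laplacian_eq_iteratedFDeriv_complexPlane, fderiv_fderiv_apply hf,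
    fderiv_fderiv_apply hf]
  simp [iteratedFDeriv_two_apply]

lemma contDiff_fderiv_apply_const {E F : Type*} [NormedAddCommGroup E] [NormedSpace ℝ E]
    [NormedAddCommGroup F] [NormedSpace ℝ F] {f : E → F} {m n : WithTop ℕ∞} (hf : ContDiff ℝ n f)
    (hmn : m + 1 ≤ n) (v : E) : ContDiff ℝ m fun y => fderiv ℝ f y v :=
  (hf.fderiv_right hmn).clm_apply contDiff_const

lemma hasCompactSupport_fderiv_apply {E F : Type*} [NormedAddCommGroup E] [NormedSpace ℝ E]
    [NormedAddCommGroup F] [NormedSpace ℝ F] {f : E → F} (hf : HasCompactSupport f) (v : E) :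
    HasCompactSupport fun y => fderiv ℝ f y v :=
  hf.fderiv_apply ℝ v

lemma continuous_laplacian {f : ℂ → ℝ} (hf : ContDiff ℝ 2 f) : Continuous (Δ f) := by
  have h : Δ f = fun x => fderiv ℝ (fun y => fderiv ℝ f y 1) x 1 +
      fderiv ℝ (fun y => fderiv ℝ f y I) x I := funext fun x => laplacian_eq_fderiv hf x
  rw [h]
  have h1 := fun v => contDiff_fderiv_apply_const (contDiff_fderiv_apply_const hf
    (m := 1) (by norm_num) v) (m := 0) (by norm_num) v
  exact (h1 1).continuous.add (h1 I).continuous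

lemma hasCompactSupport_laplacian {f : ℂ → ℝ} (hf : ContDiff ℝ 2 f) (hc : HasCompactSupport f) :
    HasCompactSupport (Δ f) := by
  have h : Δ f = fun x => fderiv ℝ (fun y => fderiv ℝ f y 1) x 1 +
      fderiv ℝ (fun y => fderiv ℝ f y I) x I := funext fun x => laplacian_eq_fderiv hf x
  rw [h]
  exact (hasCompactSupport_fderiv_apply (hasCompactSupport_fderiv_apply hc 1) 1).add
    (hasCompactSupport_fderiv_apply (hasCompactSupport_fderiv_apply hc I) I)

lemma integral_mul_fderiv_of_hasCompactSupport {𝕜 : Type*} [RCLike 𝕜] {f g : ℂ → 𝕜}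
    (hf : ContDiff ℝ 1 f) (hg : ContDiff ℝ 1 g) (hc : HasCompactSupport g) (v : ℂ) :
    ∫ x, f x * fderiv ℝ g x v = -∫ x, fderiv ℝ f x v * g x := by
  have hf' := (contDiff_fderiv_apply_const hf (m := 0) (by norm_num) v).continuous
  have hg' := (contDiff_fderiv_apply_const hg (m := 0) (by norm_num) v).continuous
  refine integral_mul_fderiv_eq_neg_fderiv_mul_of_integrable ?_ ?_ ?_
    (fun x _ => hf.differentiable (by norm_num) x) (fun x _ => hg.differentiable (by norm_num) x)
  · exact (hf'.mul hg.continuous).integrable_of_hasCompactSupport hc.mul_left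
  · exact (hf.continuous.mul hg').integrable_of_hasCompactSupport
      (hasCompactSupport_fderiv_apply hc v).mul_left
  · exact (hf.continuous.mul hg.continuous).integrable_of_hasCompactSupport hc.mul_left

/-- Green's formula, for two functions one of which has compact support. -/
lemma integral_mul_laplacian {f φ : ℂ → ℝ} (hf : ContDiff ℝ 2 f) (hφ : ContDiff ℝ 2 φ)
    (hc : HasCompactSupport φ) : ∫ x, f x * (Δ φ) x = ∫ x, (Δ f) x * φ x := by
  have hd : ∀ v, ∫ x, f x * fderiv ℝ (fun y => fderiv ℝ φ y v) x v =
      ∫ x, fderiv ℝ (fun y => fderiv ℝ f y v) x v * φ x := fun v => by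
    have hφ' := contDiff_fderiv_apply_const hφ (m := 1) (by norm_num) v
    have hf' := contDiff_fderiv_apply_const hf (m := 1) (by norm_num) v
    rw [integral_mul_fderiv_of_hasCompactSupport (hf.of_le (by norm_num)) hφ'
      (hasCompactSupport_fderiv_apply hc v), integral_mul_fderiv_of_hasCompactSupport hf'
      (hφ.of_le (by norm_num)) hc, neg_neg]
  have hi : ∀ v, Integrable fun x => f x * fderiv ℝ (fun y => fderiv ℝ φ y v) x v := fun v =>
    (hf.continuous.mul (contDiff_fderiv_apply_const (contDiff_fderiv_apply_const hφ
      (m := 1) (by norm_num) v) (m := 0) (by norm_num) v).continuous).integrable_of_hasCompactSupport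
      (hasCompactSupport_fderiv_apply (hasCompactSupport_fderiv_apply hc v) v).mul_left
  have hi' : ∀ v, Integrable fun x => fderiv ℝ (fun y => fderiv ℝ f y v) x v * φ x := fun v =>
    ((contDiff_fderiv_apply_const (contDiff_fderiv_apply_const hf
      (m := 1) (by norm_num) v) (m := 0) (by norm_num) v).continuous.mul
      hφ.continuous).integrable_of_hasCompactSupport hc.mul_left
  simp_rw [laplacian_eq_fderiv hf, laplacian_eq_fderiv hφ, mul_add, add_mul]
  rw [integral_add (hi 1) (hi I), integral_add (hi' 1) (hi' I), hd, hd]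

lemma integral_laplacian_eq_zero {φ : ℂ → ℝ} (hφ : ContDiff ℝ 2 φ) (hc : HasCompactSupport φ) :
    ∫ x, (Δ φ) x = 0 := by
  have h := integral_mul_laplacian (f := fun _ => (1 : ℝ)) contDiff_const hφ hc
  have h2 : Δ (fun _ : ℂ => (1 : ℝ)) = 0 := by
    have := InnerProductSpace.laplacian_const (E := ℂ) (c := (1 : ℝ))
    exact this
  simpa [h2] using h

/-- The Laplacian of a radial function, written as a function of `|x|²`. -/
lemma laplacian_comp_norm_sq {F F' F'' : ℝ → ℝ} (h1 : ∀ s, 0 ≤ s → HasDerivAt F (F' s) s)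
    (h2 : ∀ s, 0 ≤ s → HasDerivAt F' (F'' s) s) (hF : ContDiff ℝ 2 fun x : ℂ => F (‖x‖ ^ 2))
    (x : ℂ) : (Δ fun x : ℂ => F (‖x‖ ^ 2)) x = 4 * (F' (‖x‖ ^ 2) + ‖x‖ ^ 2 * F'' (‖x‖ ^ 2)) := by
  have hN : ∀ x : ℂ, HasFDerivAt (fun x : ℂ => ‖x‖ ^ 2) (2 • innerSL ℝ x) x := fun x =>
    (hasStrictFDerivAt_norm_sq x).hasFDerivAt
  have e1 : ∀ v : ℂ, (fun y => fderiv ℝ (fun x : ℂ => F (‖x‖ ^ 2)) y v) =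
      fun y => F' (‖y‖ ^ 2) * (2 * inner ℝ v y) := fun v => by
    funext y
    have := (h1 (‖y‖ ^ 2) (by positivity)).comp_hasFDerivAt y (hN y)
    rw [show (fun x : ℂ => F (‖x‖ ^ 2)) = F ∘ fun x => ‖x‖ ^ 2 from rfl, this.fderiv]
    simp [real_inner_comm]
    left; ring
  have e2 : ∀ v y : ℂ, fderiv ℝ (fun y : ℂ => F' (‖y‖ ^ 2) * (2 * inner ℝ v y)) y v =
      F'' (‖y‖ ^ 2) * (2 * inner ℝ v y) ^ 2 + F' (‖y‖ ^ 2) * (2 * ‖v‖ ^ 2) := fun v y => by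
    have ha := (h2 (‖y‖ ^ 2) (by positivity)).comp_hasFDerivAt y (hN y)
    have hb : HasFDerivAt (fun y : ℂ => 2 * inner ℝ v y) ((2 : ℝ) • innerSL ℝ v) y :=
      ((innerSL ℝ v).hasFDerivAt (x := y)).const_mul 2
    have := ha.mul hb
    rw [show (fun y : ℂ => F' (‖y‖ ^ 2) * (2 * inner ℝ v y)) =
      (F' ∘ fun x : ℂ => ‖x‖ ^ 2) * fun y => 2 * inner ℝ v y from rfl, this.fderiv]
    simp only [Function.comp_apply, add_apply, smul_apply, innerSL_apply_apply, smul_eq_mul,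
      nsmul_eq_mul, real_inner_self_eq_norm_sq, real_inner_comm v y]
    push_cast
    ring
  rw [laplacian_eq_fderiv hF, e1, e1, e2, e2]
  have h3 : ‖x‖ ^ 2 = x.re ^ 2 + x.im ^ 2 := by
    rw [← Complex.normSq_eq_norm_sq, Complex.normSq_apply]; ring
  have h4 : inner ℝ (1 : ℂ) x = x.re := by simp [Complex.inner]
  have h5 : inner ℝ I x = x.im := by simp [Complex.inner]
  rw [h4, h5, norm_one, Complex.norm_I]
  linear_combination (-4) * F'' (‖x‖ ^ 2) * h3

/-- The substitution `s = |x|²`: the integral of `g(|x|²)` over the plane is `π ∫₀^∞ g`, expressed by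
a primitive `W` of `g`. -/
lemma integral_comp_norm_sq {g W : ℝ → ℝ} {ℓ : ℝ} (hW : ∀ s, 0 ≤ s → HasDerivAt W (g s) s)
    (hi : Integrable fun x : ℂ => g (‖x‖ ^ 2)) (hl : Filter.Tendsto W Filter.atTop (nhds ℓ)) :
    ∫ x : ℂ, g (‖x‖ ^ 2) = Real.pi * (ℓ - W 0) := by
  have hi' := (integrable_fun_norm_addHaar volume (E := ℂ) (f := fun t => g (t ^ 2))).1 hi
  rw [integral_fun_norm_addHaar volume (fun t => g (t ^ 2))]
  rw [Complex.finrank_real_complex] at hi' ⊢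
  have hd : ∀ y ∈ Ici (0 : ℝ), HasDerivAt (fun y => W (y ^ 2) / 2) (y ^ (2 - 1) • g (y ^ 2)) y := by
    intro y _
    have := ((hW (y ^ 2) (by positivity)).comp y (hasDerivAt_pow 2 y)).div_const 2
    refine this.congr_deriv ?_
    simp; ring
  have hlim : Filter.Tendsto (fun y : ℝ => W (y ^ 2) / 2) Filter.atTop (nhds (ℓ / 2)) :=
    (hl.comp (Filter.tendsto_pow_atTop two_ne_zero)).div_const 2
  rw [integral_Ioi_of_hasDerivAt_of_tendsto' hd hi' hlim]
  simp [measureReal_def]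
  ring

lemma integrable_comp_norm_sq_of_nonneg {g W : ℝ → ℝ} {ℓ : ℝ}
    (hW : ∀ s, 0 ≤ s → HasDerivAt W (g s) s) (hg : ∀ s, 0 ≤ s → 0 ≤ g s)
    (hl : Filter.Tendsto W Filter.atTop (nhds ℓ)) : Integrable fun x : ℂ => g (‖x‖ ^ 2) := by
  rw [integrable_fun_norm_addHaar volume (f := fun t => g (t ^ 2)), Complex.finrank_real_complex]
  have hd : ∀ y ∈ Ici (0 : ℝ), HasDerivAt (fun y => W (y ^ 2) / 2) (y ^ (2 - 1) • g (y ^ 2)) y := by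
    intro y _
    have := ((hW (y ^ 2) (by positivity)).comp y (hasDerivAt_pow 2 y)).div_const 2
    refine this.congr_deriv ?_
    simp; ring
  have hlim : Filter.Tendsto (fun y : ℝ => W (y ^ 2) / 2) Filter.atTop (nhds (ℓ / 2)) :=
    (hl.comp (Filter.tendsto_pow_atTop two_ne_zero)).div_const 2
  refine integrableOn_Ioi_deriv_of_nonneg' hd (fun y hy => ?_) hlim
  have hy : 0 < y := hy
  exact smul_nonneg (by positivity) (hg _ (by positivity))

lemma contDiff_half_log_norm_sq_add {c : ℝ} (hc : 0 < c) :
    ContDiff ℝ 2 fun x : ℂ => Real.log (‖x‖ ^ 2 + c) / 2 := by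
  have h : ContDiff ℝ 2 fun x : ℂ => ‖x‖ ^ 2 + c := (contDiff_norm_sq ℝ).add contDiff_const
  exact (h.log fun x => by positivity).div_const 2

lemma laplacian_half_log_norm_sq_add {c : ℝ} (hc : 0 < c) (x : ℂ) :
    (Δ fun x : ℂ => Real.log (‖x‖ ^ 2 + c) / 2) x = 2 * c / (‖x‖ ^ 2 + c) ^ 2 := by
  have h1 : ∀ s, 0 ≤ s → HasDerivAt (fun s => Real.log (s + c) / 2) ((2 * (s + c))⁻¹) s :=
    fun s hs => by
      have h0 : s + c ≠ 0 := by positivity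
      refine ((((hasDerivAt_id' s).add_const c).log h0).div_const 2).congr_deriv ?_
      field_simp
  have h2 : ∀ s, 0 ≤ s → HasDerivAt (fun s => (2 * (s + c))⁻¹) (-(2 * (s + c) ^ 2)⁻¹) s :=
    fun s hs => by
      have h0 : s + c ≠ 0 := by positivity
      refine ((((hasDerivAt_id' s).add_const c).const_mul 2).inv (by positivity)).congr_deriv ?_
      field_simp
  rw [laplacian_comp_norm_sq (F := fun s => Real.log (s + c) / 2) h1 h2
    (contDiff_half_log_norm_sq_add hc) x]
  have h0 : ‖x‖ ^ 2 + c ≠ 0 := by positivity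
  field_simp
  ring

lemma tendsto_neg_mul_inv_add_one (a : ℝ) :
    Filter.Tendsto (fun s : ℝ => -(a * (s + 1)⁻¹)) Filter.atTop (nhds 0) := by
  have h : Filter.Tendsto (fun s : ℝ => (s + 1)⁻¹) Filter.atTop (nhds 0) :=
    tendsto_inv_atTop_zero.comp (Filter.tendsto_atTop_add_const_right _ 1 Filter.tendsto_id)
  simpa using (h.const_mul a).neg

lemma hasDerivAt_neg_mul_inv_add_one (a : ℝ) {s : ℝ} (hs : 0 ≤ s) :
    HasDerivAt (fun s : ℝ => -(a * (s + 1)⁻¹)) (a / (s + 1) ^ 2) s := by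
  have h0 : s + 1 ≠ 0 := by positivity
  refine ((((hasDerivAt_id' s).add_const 1).inv h0).const_mul a).neg.congr_deriv ?_
  field_simp

lemma integrable_two_div_norm_sq_add_one_sq :
    Integrable fun x : ℂ => 2 / (‖x‖ ^ 2 + 1) ^ 2 :=
  integrable_comp_norm_sq_of_nonneg (g := fun s => 2 / (s + 1) ^ 2)
    (fun _ hs => hasDerivAt_neg_mul_inv_add_one 2 hs) (fun s _ => by positivity)
    (tendsto_neg_mul_inv_add_one 2)

lemma integral_two_div_norm_sq_add_one_sq :
    ∫ x : ℂ, 2 / (‖x‖ ^ 2 + 1) ^ 2 = 2 * Real.pi := by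
  rw [integral_comp_norm_sq (g := fun s => 2 / (s + 1) ^ 2)
    (fun _ hs => hasDerivAt_neg_mul_inv_add_one 2 hs) integrable_two_div_norm_sq_add_one_sq
    (tendsto_neg_mul_inv_add_one 2)]
  simp; ring

lemma abs_log_norm_le (x : ℂ) : |Real.log ‖x‖| ≤ ‖x‖ + ‖x‖ ^ (-1 : ℝ) := by
  have h0 := norm_nonneg x
  rcases h0.eq_or_lt with h | h
  · rw [← h]; simp
  have h1 := Real.log_le_sub_one_of_pos h
  have h2 := Real.log_le_sub_one_of_pos (inv_pos.2 h)
  rw [Real.log_inv] at h2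
  rw [Real.rpow_neg_one, abs_le]
  have := inv_pos.2 h
  constructor <;> linarith

lemma locallyIntegrable_norm_rpow_neg_one :
    LocallyIntegrable fun x : ℂ => ‖x‖ ^ (-1 : ℝ) := by
  intro x
  refine ⟨Metric.ball 0 (‖x‖ + 1), Metric.isOpen_ball.mem_nhds (by simp), ?_⟩
  exact integrableOn_norm_rpow_neg (by norm_num) _

lemma locallyIntegrable_log_norm : LocallyIntegrable fun x : ℂ => Real.log ‖x‖ := by
  have h : LocallyIntegrable fun x : ℂ => ‖x‖ + ‖x‖ ^ (-1 : ℝ) :=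
    continuous_norm.locallyIntegrable.add locallyIntegrable_norm_rpow_neg_one
  refine h.mono (Real.measurable_log.comp measurable_norm).aestronglyMeasurable
    (ae_of_all _ fun x => ?_)
  rw [Real.norm_eq_abs, Real.norm_eq_abs]
  exact (abs_log_norm_le x).trans (le_abs_self _)

lemma _root_.MeasureTheory.LocallyIntegrable.integrable_mul_of_hasCompactSupport {𝕜 : Type*}
    [RCLike 𝕜] {f g : ℂ → 𝕜} (hf : LocallyIntegrable f) (hg : Continuous g)
    (hc : HasCompactSupport g) : Integrable fun x => f x * g x := by
  have := hf.integrable_smul_left_of_hasCompactSupport hg hc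
  simpa [mul_comm] using this

/-- The logarithm is the fundamental solution of the Laplacian, up to the factor `2π`. It is
regularized as `½ log (|x|² + ε²)`, whose Laplacian is an approximate identity. -/
theorem integral_log_norm_mul_laplacian {φ : ℂ → ℝ} (hφ : ContDiff ℝ 2 φ)
    (hc : HasCompactSupport φ) :
    ∫ x, Real.log ‖x‖ * (Δ φ) x = 2 * Real.pi * φ 0 := by
  set ε : ℕ → ℝ := fun n => 1 / ((n : ℝ) + 1) with hε
  have hε0 : ∀ n, 0 < ε n := fun n => Nat.one_div_pos_of_nat
  have hε1 : ∀ n, ε n ≤ 1 := fun n => by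
    simp only [hε]; rw [div_le_one (by positivity)]; linarith [(Nat.cast_nonneg n : (0 : ℝ) ≤ n)]
  have hεl : Filter.Tendsto ε Filter.atTop (nhds 0) := tendsto_one_div_add_atTop_nhds_zero_nat
  have hΔc := continuous_laplacian hφ
  have hΔs := hasCompactSupport_laplacian hφ hc
  -- The two sides of Green's formula for the regularized logarithm have the two sides of the
  -- claim as limits.
  have hL : Filter.Tendsto (fun n => ∫ x : ℂ, Real.log (‖x‖ ^ 2 + ε n ^ 2) / 2 * (Δ φ) x)
      Filter.atTop (nhds (∫ x, Real.log ‖x‖ * (Δ φ) x)) := by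
    have hb : LocallyIntegrable fun x : ℂ => |Real.log ‖x‖| + Real.log (‖x‖ ^ 2 + 1) / 2 :=
      (locallyIntegrable_log_norm.mono (g := fun x : ℂ => |Real.log ‖x‖|)
        (Real.measurable_log.comp measurable_norm).abs.aestronglyMeasurable
        (ae_of_all _ fun x => by simp)).add
        (contDiff_half_log_norm_sq_add one_pos).continuous.locallyIntegrable
    refine tendsto_integral_of_dominated_convergence
      (fun x => ‖(|Real.log ‖x‖| + Real.log (‖x‖ ^ 2 + 1) / 2) * (Δ φ) x‖) ?_
      (hb.integrable_mul_of_hasCompactSupport hΔc hΔs).norm ?_ ?_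
    · intro n
      exact ((contDiff_half_log_norm_sq_add (pow_pos (hε0 n) 2)).continuous.mul
        hΔc).aestronglyMeasurable
    · intro n
      have hne : ∀ᵐ x : ℂ, x ≠ 0 := Measure.ae_ne volume 0
      filter_upwards [hne] with x hx
      have hx0 : 0 < ‖x‖ := norm_pos_iff.2 hx
      rw [norm_mul, norm_mul]
      refine mul_le_mul_of_nonneg_right ?_ (norm_nonneg _)
      have h1 : Real.log ‖x‖ ≤ Real.log (‖x‖ ^ 2 + ε n ^ 2) / 2 := by
        have : Real.log (‖x‖ ^ 2) ≤ Real.log (‖x‖ ^ 2 + ε n ^ 2) :=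
          Real.log_le_log (by positivity) (by nlinarith [hε0 n])
        rw [Real.log_pow] at this
        push_cast at this
        linarith
      have h2 : Real.log (‖x‖ ^ 2 + ε n ^ 2) ≤ Real.log (‖x‖ ^ 2 + 1) :=
        Real.log_le_log (by positivity) (by nlinarith [hε0 n, hε1 n])
      have h3 : 0 ≤ Real.log (‖x‖ ^ 2 + 1) := Real.log_nonneg (by nlinarith)
      rw [Real.norm_eq_abs, Real.norm_eq_abs, abs_of_nonneg (by positivity : 0 ≤ |Real.log ‖x‖| + _),
        abs_le]
      constructor
      · linarith [neg_abs_le (Real.log ‖x‖)]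
      · linarith [abs_nonneg (Real.log ‖x‖)]
    · have hne : ∀ᵐ x : ℂ, x ≠ 0 := Measure.ae_ne volume 0
      filter_upwards [hne] with x hx
      have hx0 : 0 < ‖x‖ := norm_pos_iff.2 hx
      refine Filter.Tendsto.mul_const _ ?_
      have h1 : Filter.Tendsto (fun n => ‖x‖ ^ 2 + ε n ^ 2) Filter.atTop (nhds (‖x‖ ^ 2)) := by
        simpa using (hεl.pow 2).const_add (‖x‖ ^ 2)
      have h2 := (h1.log (by positivity)).div_const 2
      rw [Real.log_pow] at h2
      simpa using h2
  have hR : Filter.Tendsto (fun n => ∫ u : ℂ, 2 / (‖u‖ ^ 2 + 1) ^ 2 * φ (ε n • u))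
      Filter.atTop (nhds (∫ u : ℂ, 2 / (‖u‖ ^ 2 + 1) ^ 2 * φ 0)) := by
    obtain ⟨M, hM⟩ := hφ.continuous.bounded_above_of_compact_support hc
    refine tendsto_integral_of_dominated_convergence (fun u => 2 / (‖u‖ ^ 2 + 1) ^ 2 * M) ?_
      (integrable_two_div_norm_sq_add_one_sq.mul_const M) ?_ ?_
    · intro n
      have := hφ.continuous
      exact integrable_two_div_norm_sq_add_one_sq.aestronglyMeasurable.mul
        (by fun_prop : Continuous fun u => φ (ε n • u)).aestronglyMeasurable
    · intro n
      refine ae_of_all _ fun u => ?_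
      rw [norm_mul, Real.norm_of_nonneg (by positivity)]
      gcongr
      exact hM _
    · refine ae_of_all _ fun u => Filter.Tendsto.const_mul _ ?_
      have h1 : Filter.Tendsto (fun n => ε n • u) Filter.atTop (nhds 0) := by
        simpa using hεl.smul_const u
      exact (hφ.continuous.tendsto 0).comp h1
  have hEq : ∀ n, ∫ x : ℂ, Real.log (‖x‖ ^ 2 + ε n ^ 2) / 2 * (Δ φ) x =
      ∫ u : ℂ, 2 / (‖u‖ ^ 2 + 1) ^ 2 * φ (ε n • u) := by
    intro n
    have h := hε0 n
    rw [integral_mul_laplacian (contDiff_half_log_norm_sq_add (pow_pos h 2)) hφ hc]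
    simp_rw [laplacian_half_log_norm_sq_add (pow_pos h 2)]
    have hs := Measure.integral_comp_smul (volume : Measure ℂ)
      (fun x : ℂ => 2 * ε n ^ 2 / (‖x‖ ^ 2 + ε n ^ 2) ^ 2 * φ x) (ε n)
    rw [Complex.finrank_real_complex, abs_of_pos (by positivity), smul_eq_mul,
      eq_inv_mul_iff_mul_eq₀ (by positivity)] at hs
    rw [← hs, ← integral_const_mul]
    refine integral_congr_ae (ae_of_all _ fun u => ?_)
    simp only [norm_smul, Real.norm_of_nonneg h.le]
    rw [← mul_assoc]
    congr 1
    have h0 : ‖u‖ ^ 2 + 1 ≠ 0 := by positivity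
    rw [show (ε n * ‖u‖) ^ 2 + ε n ^ 2 = ε n ^ 2 * (‖u‖ ^ 2 + 1) by ring]
    field_simp
  simp_rw [hEq] at hL
  rw [tendsto_nhds_unique hL hR, integral_mul_const, integral_two_div_norm_sq_add_one_sq]

/-! ### Logarithmic potentials of finite measures -/

lemma logKernel_le (x y : ℂ) : logKernel x y ≤ (1 + ‖x‖) * (1 + (1 + ‖x‖) / ‖x - y‖) := by
  have := Real.add_one_le_exp (logKernel x y)
  linarith [exp_logKernel_le x y]

/-- The integrability that allows to apply Fubini's theorem to potentials on bounded regions. -/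
lemma integrable_logKernel_restrict_prod (Q : Measure ℂ) [IsFiniteMeasure Q] (R : ℝ) :
    Integrable (Function.uncurry logKernel) ((volume.restrict (Metric.ball 0 R)).prod Q) := by
  obtain ⟨C, hC, hCy⟩ := exists_lintegral_weight_kernel_le (δ := 1) one_pos
  refine ⟨measurable_logKernel.aestronglyMeasurable, ?_⟩
  rw [hasFiniteIntegral_iff_ofReal (f := Function.uncurry logKernel)
    (ae_of_all _ fun p => logKernel_nonneg p.1 p.2),
    lintegral_prod_symm' _ measurable_logKernel.ennreal_ofReal]
  have hb : ∀ y, ∫⁻ x in Metric.ball 0 R, ENNReal.ofReal (Function.uncurry logKernel (x, y)) ≤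
      ENNReal.ofReal ((1 + R) ^ (4 : ℝ)) * C := by
    intro y
    calc _ ≤ ∫⁻ x in Metric.ball 0 R, ENNReal.ofReal ((1 + R) ^ (4 : ℝ)) *
          ENNReal.ofReal ((1 + ‖x‖) ^ (-(2 + 1) : ℝ) * (1 + (1 + ‖x‖) / ‖x - y‖)) := by
          refine setLIntegral_mono' measurableSet_ball fun x hx => ?_
          have hx : ‖x‖ < R := by simpa using hx
          have hx0 := norm_nonneg x
          rw [← ENNReal.ofReal_mul (Real.rpow_nonneg (by linarith) _)]
          refine ENNReal.ofReal_le_ofReal ((logKernel_le x y).trans ?_)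
          rw [← mul_assoc]
          refine mul_le_mul_of_nonneg_right ?_ (by positivity)
          have h1 : (1 + ‖x‖) ^ (4 : ℝ) * (1 + ‖x‖) ^ (-(2 + 1) : ℝ) = 1 + ‖x‖ := by
            rw [← Real.rpow_add (by positivity)]; norm_num
          exact h1.symm.le.trans (mul_le_mul_of_nonneg_right
            (Real.rpow_le_rpow (by positivity) (by linarith) (by norm_num)) (by positivity))
      _ ≤ _ := by
          rw [lintegral_const_mul' _ _ ENNReal.ofReal_ne_top]
          exact mul_le_mul_right ((setLIntegral_le_lintegral _ _).trans (hCy y)) _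
  refine (lintegral_mono hb).trans_lt ?_
  rw [lintegral_const]
  exact ENNReal.mul_lt_top (ENNReal.mul_lt_top ENNReal.ofReal_lt_top hC.lt_top)
    (measure_lt_top Q _)

lemma locallyIntegrable_logPotential (Q : Measure ℂ) [IsFiniteMeasure Q] :
    LocallyIntegrable (logPotential Q) := by
  intro x
  refine ⟨Metric.ball 0 (‖x‖ + 1), Metric.isOpen_ball.mem_nhds (by simp), ?_⟩
  exact (integrable_logKernel_restrict_prod Q _).integral_prod_left

lemma integral_logKernel_mul_laplacian {φ : ℂ → ℝ} (hφ : ContDiff ℝ 2 φ)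
    (hc : HasCompactSupport φ) (y : ℂ) : ∫ x, logKernel x y * (Δ φ) x =
      (∫ x, Real.log (1 + ‖x‖) * (Δ φ) x) - 2 * Real.pi * φ y := by
  have hΔc := continuous_laplacian hφ
  have hΔs := hasCompactSupport_laplacian hφ hc
  have hl1 : Continuous fun x : ℂ => Real.log (1 + ‖x‖) :=
    (by fun_prop : Continuous fun x : ℂ => 1 + ‖x‖).log fun x => by positivity
  set φy : ℂ → ℝ := fun x => φ (x + y) with hφy
  have hφy2 : ContDiff ℝ 2 φy := hφ.comp (contDiff_id.add contDiff_const)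
  have hcy : HasCompactSupport φy := hc.comp_homeomorph (Homeomorph.addRight y)
  have hΔy : ∀ x, (Δ φy) x = (Δ φ) (x + y) := by
    intro x
    rw [laplacian_eq_fderiv hφy2, laplacian_eq_fderiv hφ]
    have h1 : ∀ v, (fun z => fderiv ℝ φy z v) = fun z => fderiv ℝ φ (z + y) v := fun v => by
      funext z; rw [hφy, fderiv_comp_add_right]
    rw [h1, h1, fderiv_comp_add_right (f := fun z => fderiv ℝ φ z 1),
      fderiv_comp_add_right (f := fun z => fderiv ℝ φ z I)]
  have hfs : ∫ x, Real.log ‖x - y‖ * (Δ φ) x = 2 * Real.pi * φ y := by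
    have h := integral_log_norm_mul_laplacian hφy2 hcy
    simp_rw [hΔy] at h
    rw [← integral_sub_right_eq_self _ y] at h
    simpa [hφy] using h
  have hli : LocallyIntegrable fun x : ℂ => Real.log ‖x - y‖ := by
    have h := locallyIntegrable_log_norm
    rw [locallyIntegrable_iff] at h ⊢
    intro K hK
    have hK' : IsCompact ((fun x => x - y) '' K) := hK.image (by fun_prop)
    have h2 := h _ hK'
    have h3 := (measurePreserving_sub_right (volume : Measure ℂ) y).integrableOn_comp_preimage
      (Homeomorph.subRight y).measurableEmbedding (f := fun x => Real.log ‖x‖)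
      (s := (fun x => x - y) '' K)
    have h4 := h3.2 h2
    refine h4.mono_set fun x hx => ?_
    exact ⟨x, hx, rfl⟩
  have e : ∫ x, logKernel x y * (Δ φ) x = ∫ x, (Real.log (1 + ‖x‖) * (Δ φ) x +
      Real.log (1 + ‖y‖) * (Δ φ) x - Real.log ‖x - y‖ * (Δ φ) x) := by
    refine integral_congr_ae ?_
    filter_upwards [Measure.ae_ne volume y] with x hx
    rw [logKernel_eq hx]; ring
  have i1 : Integrable fun x : ℂ => Real.log (1 + ‖x‖) * (Δ φ) x :=
    hl1.locallyIntegrable.integrable_mul_of_hasCompactSupport hΔc hΔs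
  have i2 : Integrable fun x : ℂ => Real.log (1 + ‖y‖) * (Δ φ) x :=
    (hΔc.integrable_of_hasCompactSupport hΔs).const_mul _
  have i12 : Integrable fun x : ℂ => Real.log (1 + ‖x‖) * (Δ φ) x +
      Real.log (1 + ‖y‖) * (Δ φ) x := i1.add i2
  rw [e, integral_sub i12 (hli.integrable_mul_of_hasCompactSupport hΔc hΔs),
    integral_add i1 i2, integral_const_mul, integral_laplacian_eq_zero hφ hc, hfs]
  simp

/-- Up to the term with `log (1 + |x|)`, a logarithmic potential has the Laplacian `-2πQ`. -/
lemma integral_logPotential_mul_laplacian (Q : Measure ℂ) [IsFiniteMeasure Q] {φ : ℂ → ℝ}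
    (hφ : ContDiff ℝ 2 φ) (hc : HasCompactSupport φ) : ∫ x, logPotential Q x * (Δ φ) x =
      Q.real univ * (∫ x, Real.log (1 + ‖x‖) * (Δ φ) x) - 2 * Real.pi * ∫ y, φ y ∂Q := by
  have hΔc := continuous_laplacian hφ
  have hΔs := hasCompactSupport_laplacian hφ hc
  obtain ⟨R, hR⟩ := hΔs.isCompact.isBounded.subset_ball 0
  have h0 : ∀ x, x ∉ Metric.ball (0 : ℂ) R → (Δ φ) x = 0 := fun x hx =>
    image_eq_zero_of_notMem_tsupport fun h => hx (hR h)
  have e1 : ∀ f : ℂ → ℝ, ∫ x in Metric.ball 0 R, f x * (Δ φ) x = ∫ x, f x * (Δ φ) x := fun f =>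
    setIntegral_eq_integral_of_forall_compl_eq_zero fun x hx => by rw [h0 x hx, mul_zero]
  obtain ⟨M, hM⟩ := hΔc.bounded_above_of_compact_support hΔs
  have hint : Integrable (fun p : ℂ × ℂ => logKernel p.1 p.2 * (Δ φ) p.1)
      ((volume.restrict (Metric.ball 0 R)).prod Q) :=
    (integrable_logKernel_restrict_prod Q R).mul_bdd (c := M)
      (hΔc.comp continuous_fst).aestronglyMeasurable (ae_of_all _ fun p => hM p.1)
  rw [← e1]
  simp_rw [logPotential, ← integral_mul_const]
  have hswap : ∫ x in Metric.ball 0 R, (∫ y, logKernel x y * (Δ φ) x ∂Q) =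
      ∫ y, (∫ x in Metric.ball 0 R, logKernel x y * (Δ φ) x) ∂Q := integral_integral_swap hint
  rw [hswap]
  simp_rw [e1, integral_logKernel_mul_laplacian hφ hc]
  have hφi : Integrable φ Q := by
    obtain ⟨M', hM'⟩ := hφ.continuous.bounded_above_of_compact_support hc
    exact Integrable.of_bound hφ.continuous.aestronglyMeasurable M' (ae_of_all _ hM')
  rw [integral_sub (integrable_const _) (hφi.const_mul _), integral_const, integral_const_mul,
    smul_eq_mul]

/-- A potential of the signed measure `P - Q`. With the flux `Φ` of `P - Q` it behaves like
`Φ log |x|` at infinity, if only in the mean. -/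
noncomputable def signedPotential (P Q : Measure ℂ) (x : ℂ) : ℝ :=
  (P.real univ - Q.real univ) / (2 * Real.pi) * Real.log (1 + ‖x‖) -
    (2 * Real.pi)⁻¹ * (logPotential P x - logPotential Q x)

lemma continuous_log_one_add_norm : Continuous fun x : ℂ => Real.log (1 + ‖x‖) :=
  (by fun_prop : Continuous fun x : ℂ => 1 + ‖x‖).log fun x => by positivity

lemma measurable_signedPotential (P Q : Measure ℂ) [SFinite P] [SFinite Q] :
    Measurable (signedPotential P Q) :=
  ((continuous_log_one_add_norm.measurable).const_mul _).sub
    (((measurable_logPotential P).sub (measurable_logPotential Q)).const_mul _)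

lemma signedPotential_swap (P Q : Measure ℂ) (x : ℂ) :
    signedPotential Q P x = -signedPotential P Q x := by
  unfold signedPotential; ring

lemma locallyIntegrable_signedPotential (P Q : Measure ℂ) [IsFiniteMeasure P]
    [IsFiniteMeasure Q] : LocallyIntegrable (signedPotential P Q) := by
  have h1 := continuous_log_one_add_norm.locallyIntegrable (μ := volume)
  have h2 := (locallyIntegrable_logPotential P).sub (locallyIntegrable_logPotential Q)
  exact (h1.smul ((P.real univ - Q.real univ) / (2 * Real.pi))).sub (h2.smul (2 * Real.pi)⁻¹)

/-- `signedPotential P Q` has the distributional Laplacian `P - Q`: the smooth terms with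
`log (1 + |x|)` of the kernels cancel. -/
lemma integral_signedPotential_mul_laplacian (P Q : Measure ℂ) [IsFiniteMeasure P]
    [IsFiniteMeasure Q] {φ : ℂ → ℝ} (hφ : ContDiff ℝ 2 φ) (hc : HasCompactSupport φ) :
    ∫ x, signedPotential P Q x * (Δ φ) x = ∫ x, φ x ∂P - ∫ x, φ x ∂Q := by
  have hΔc := continuous_laplacian hφ
  have hΔs := hasCompactSupport_laplacian hφ hc
  have i1 := (continuous_log_one_add_norm.locallyIntegrable
    (μ := volume)).integrable_mul_of_hasCompactSupport hΔc hΔs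
  have i2 := (locallyIntegrable_logPotential P).integrable_mul_of_hasCompactSupport hΔc hΔs
  have i3 := (locallyIntegrable_logPotential Q).integrable_mul_of_hasCompactSupport hΔc hΔs
  have e : ∀ x, signedPotential P Q x * (Δ φ) x = (P.real univ - Q.real univ) / (2 * Real.pi) *
      (Real.log (1 + ‖x‖) * (Δ φ) x) - ((2 * Real.pi)⁻¹ * (logPotential P x * (Δ φ) x) -
        (2 * Real.pi)⁻¹ * (logPotential Q x * (Δ φ) x)) := fun x => by
    unfold signedPotential; ring
  have i23 : Integrable fun x => (2 * Real.pi)⁻¹ * (logPotential P x * (Δ φ) x) -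
        (2 * Real.pi)⁻¹ * (logPotential Q x * (Δ φ) x) := (i2.const_mul _).sub (i3.const_mul _)
  simp_rw [e]
  rw [integral_sub (i1.const_mul _) i23, integral_sub (i2.const_mul _) (i3.const_mul _),
    integral_const_mul, integral_const_mul, integral_const_mul,
    integral_logPotential_mul_laplacian P hφ hc, integral_logPotential_mul_laplacian Q hφ hc]
  have := Real.pi_pos
  field_simp
  ring

lemma exp_two_mul_signedPotential_le (P Q : Measure ℂ) (x : ℂ) :
    Real.exp (2 * signedPotential P Q x) ≤
      (1 + ‖x‖) ^ ((P.real univ - Q.real univ) / Real.pi) *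
        Real.exp (Real.pi⁻¹ * logPotential Q x) := by
  have hpi := Real.pi_pos
  have h0 := logPotential_nonneg P x
  rw [Real.rpow_def_of_pos (by positivity), ← Real.exp_add, signedPotential]
  gcongr
  have : 0 ≤ Real.pi⁻¹ * logPotential P x := by positivity
  have e : 2 * ((P.real univ - Q.real univ) / (2 * Real.pi) * Real.log (1 + ‖x‖) -
      (2 * Real.pi)⁻¹ * (logPotential P x - logPotential Q x)) =
      Real.log (1 + ‖x‖) * ((P.real univ - Q.real univ) / Real.pi) +
        Real.pi⁻¹ * logPotential Q x - Real.pi⁻¹ * logPotential P x := by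
    field_simp; ring
  rw [e]
  linarith

/-- The weighted integrability of `e^{2h}`, for the potential `h` of a measure of flux `Φ` without
point masses `≤ -2π`. Both the count of zero modes from below and the one from above rest on it. -/
theorem integrable_exp_two_mul_signedPotential (P Q : Measure ℂ) [IsFiniteMeasure P]
    [IsFiniteMeasure Q] (hQ : ∀ x, Q {x} < ENNReal.ofReal (2 * Real.pi)) {t : ℝ}
    (ht : 2 + (P.real univ - Q.real univ) / Real.pi < t) :
    Integrable fun x => (1 + ‖x‖) ^ (-t) * Real.exp (2 * signedPotential P Q x) := by
  set ε := t - (2 + (P.real univ - Q.real univ) / Real.pi) with hε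
  have h := lintegral_exp_logPotential_lt_top Q hQ (ε := ε) (by simpa [hε] using ht)
  have hm := measurable_signedPotential P Q
  refine ⟨Measurable.aestronglyMeasurable (by fun_prop), ?_⟩
  rw [hasFiniteIntegral_iff_ofReal (ae_of_all _ fun x => by positivity)]
  refine (lintegral_mono fun x => ?_).trans_lt h
  rw [← ENNReal.ofReal_mul (by positivity)]
  refine ENNReal.ofReal_le_ofReal ?_
  calc _ ≤ (1 + ‖x‖) ^ (-t) * ((1 + ‖x‖) ^ ((P.real univ - Q.real univ) / Real.pi) *
        Real.exp (Real.pi⁻¹ * logPotential Q x)) := by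
        gcongr; exact exp_two_mul_signedPotential_le P Q x
    _ = _ := by
        rw [← mul_assoc, ← Real.rpow_add (by positivity)]
        congr 2
        rw [hε]; ring

/-- If `Q` has compact support or vanishes, `h ≤ Φ log |x| + O(1)` at infinity. -/
lemma exists_signedPotential_le (P Q : Measure ℂ) [IsFiniteMeasure P] [IsFiniteMeasure Q]
    {K : Set ℂ} (hK : IsCompact K) (hQ : Q Kᶜ = 0) :
    ∃ R C : ℝ, ∀ x : ℂ, R ≤ ‖x‖ → signedPotential P Q x ≤
      (P.real univ - Q.real univ) / (2 * Real.pi) * Real.log (1 + ‖x‖) + C := by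
  obtain ⟨R', hR'⟩ := hK.isBounded.subset_closedBall 0
  set R := max R' 1 with hR
  have hR1 : 1 ≤ R := le_max_right _ _
  refine ⟨2 * R, (2 * Real.pi)⁻¹ * (Real.log (4 * (1 + R)) * Q.real univ), fun x hx => ?_⟩
  have h0 := logPotential_nonneg P x
  have hpi := Real.pi_pos
  have h1 : logPotential Q x ≤ Real.log (4 * (1 + R)) * Q.real univ := by
    have hlog : 0 ≤ Real.log (4 * (1 + R)) := Real.log_nonneg (by linarith)
    have hae : ∀ᵐ y ∂Q, logKernel x y ≤ Real.log (4 * (1 + R)) := by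
      filter_upwards [show ∀ᵐ y ∂Q, y ∈ K from hQ] with y hy
      have hy' : ‖y‖ ≤ R := (by simpa using hR' hy : ‖y‖ ≤ R').trans (le_max_left _ _)
      have h1 : ‖x‖ / 2 ≤ ‖x - y‖ := by
        have := norm_sub_norm_le x y
        linarith
      refine Real.log_le_log (div_pos (by positivity) (by linarith)) ?_
      rw [div_le_iff₀ (by linarith)]
      nlinarith
    have := integral_mono_of_nonneg (ae_of_all _ fun y => logKernel_nonneg x y)
      (integrable_const (Real.log (4 * (1 + R)))) hae
    simpa [logPotential, mul_comm] using this
  have h2 : 0 ≤ (2 * Real.pi)⁻¹ * logPotential P x := by positivity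
  have h3 : (2 * Real.pi)⁻¹ * logPotential Q x ≤
      (2 * Real.pi)⁻¹ * (Real.log (4 * (1 + R)) * Q.real univ) := by gcongr
  rw [signedPotential, mul_sub]
  linarith

/-! ### Weyl's lemma -/

section Weyl

open Metric ContinuousLinearMap
open scoped Convolution

variable {F : Type*} [NormedAddCommGroup F] [NormedSpace ℝ F]

lemma two_le_infty : (2 : WithTop ℕ∞) ≤ ∞ :=
  WithTop.coe_le_coe.2 (le_top : (2 : ℕ∞) ≤ ⊤)

/-- Polar coordinates around `x`, for a radial weight that vanishes at radii at least `R`. -/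
lemma integral_radial_smul {g : ℝ → ℝ} (hg : Continuous g) {R : ℝ} (hR : ∀ r, R ≤ r → g r = 0)
    {v : ℂ → F} (hv : Continuous v) (x : ℂ) : ∫ t : ℂ, g ‖t‖ • v (x + t) =
      ∫ r in Ioi (0 : ℝ), (r * g r) • ∫ θ in Ioo (-Real.pi) Real.pi, v (circleMap x r θ) := by
  rw [← Complex.integral_comp_polarCoord_symm]
  have e : ∀ p ∈ polarCoord.target, p.1 • (g ‖Complex.polarCoord.symm p‖ •
      v (x + Complex.polarCoord.symm p)) = (p.1 * g p.1) • v (circleMap x p.1 p.2) := by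
    intro p hp
    have hp0 : 0 < p.1 := hp.1
    rw [Complex.norm_polarCoord_symm, abs_of_pos hp0, smul_smul, Complex.polarCoord_symm_apply,
      circleMap, Complex.exp_mul_I]
    simp
  rw [setIntegral_congr_fun polarCoord.open_target.measurableSet e, polarCoord_target,
    Measure.volume_eq_prod, setIntegral_prod]
  · simp_rw [integral_smul]
  · have hc : Continuous fun p : ℝ × ℝ => (p.1 * g p.1) • v (circleMap x p.1 p.2) := by
      unfold circleMap; fun_prop
    have h1 : IntegrableOn (fun p : ℝ × ℝ => (p.1 * g p.1) • v (circleMap x p.1 p.2))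
        (Icc 0 R ×ˢ Icc (-Real.pi) Real.pi) (volume.prod volume) :=
      hc.continuousOn.integrableOn_compact (isCompact_Icc.prod isCompact_Icc)
    refine h1.of_forall_sdiff_eq_zero (measurableSet_Ioi.prod measurableSet_Ioo) ?_
    rintro ⟨r, θ⟩ ⟨⟨hr, hθ⟩, hn⟩
    have hrR : R ≤ r := by
      by_contra hlt
      exact hn ⟨⟨le_of_lt hr, (not_le.1 hlt).le⟩, Ioo_subset_Icc_self hθ⟩
    simp [hR r hrR]

/-- A function with the mean value property over circles has it for radial weights. -/
lemma integral_radial_smul_of_circleAverage [CompleteSpace F] {g : ℝ → ℝ} (hg : Continuous g)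
    {R : ℝ} (hR : ∀ r, R ≤ r → g r = 0) {v : ℂ → F} (hv : Continuous v) {x : ℂ}
    (hm : ∀ r, Real.circleAverage v x r = v x) :
    ∫ t : ℂ, g ‖t‖ • v (x + t) = (∫ t : ℂ, g ‖t‖) • v x := by
  have h1 : ∀ r, ∫ θ in Ioo (-Real.pi) Real.pi, v (circleMap x r θ) = (2 * Real.pi) • v x := by
    intro r
    rw [← hm r, Real.circleAverage_eq_integral_add (-Real.pi), smul_smul,
      mul_inv_cancel₀ (by positivity), one_smul,
      intervalIntegral.integral_comp_add_right (fun θ => v (circleMap x r θ)),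
      show 0 + -Real.pi = -Real.pi by ring, show 2 * Real.pi + -Real.pi = Real.pi by ring,
      intervalIntegral.integral_of_le (by linarith [Real.pi_pos]), integral_Ioc_eq_integral_Ioo]
  have h2 := integral_radial_smul hg hR (v := fun _ => (1 : ℝ)) continuous_const x
  simp only [smul_eq_mul, mul_one, integral_const, measureReal_restrict_apply_univ,
    Real.volume_real_Ioo] at h2
  rw [integral_radial_smul hg hR hv x, h2, ← integral_smul_const]
  simp_rw [h1, smul_smul]
  have h3 : max (Real.pi - -Real.pi) 0 = 2 * Real.pi := by
    rw [max_eq_left (by linarith [Real.pi_pos])]; ring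
  rw [h3]

/-- There is a radial mollifier of total mass one. -/
lemma exists_radial_mollifier : ∃ g : ℝ → ℝ, Continuous g ∧ (∀ r, 2 ≤ r → g r = 0) ∧
    ContDiff ℝ ∞ (fun t : ℂ => g ‖t‖) ∧ HasCompactSupport (fun t : ℂ => g ‖t‖) ∧
    ∫ t : ℂ, g ‖t‖ = 1 := by
  let b : ContDiffBump (0 : ℝ) := ⟨1, 2, one_pos, one_lt_two⟩
  have hbs : ContDiff ℝ ∞ fun t : ℂ => b (‖t‖ ^ 2) := b.contDiff.comp (contDiff_norm_sq ℝ)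
  have hb0 : ∀ r : ℝ, 2 ≤ r → b (r ^ 2) = 0 := fun r hr => by
    refine b.zero_of_le_dist ?_
    rw [dist_zero_right, Real.norm_of_nonneg (by positivity)]
    show (2 : ℝ) ≤ r ^ 2
    nlinarith
  have hbc : HasCompactSupport fun t : ℂ => b (‖t‖ ^ 2) := by
    refine HasCompactSupport.intro (isCompact_closedBall (0 : ℂ) 2) fun t ht => hb0 _ ?_
    have : 2 < ‖t‖ := by simpa using ht
    exact this.le
  have hpos : 0 < ∫ t : ℂ, b (‖t‖ ^ 2) := by
    refine hbs.continuous.integral_pos_of_hasCompactSupport_nonneg_nonzero hbc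
      (fun t => b.nonneg) (x := 0) ?_
    have : b (0 : ℝ) = 1 := b.one_of_mem_closedBall (by simp [b])
    simp [this]
  refine ⟨fun r => (∫ t : ℂ, b (‖t‖ ^ 2))⁻¹ * b (r ^ 2), ?_, ?_, ?_, ?_, ?_⟩
  · exact continuous_const.mul (b.continuous.comp (continuous_pow 2))
  · intro r hr; simp only [hb0 r hr, mul_zero]
  · exact contDiff_const.mul hbs
  · exact hbc.mul_left
  · rw [integral_const_mul, inv_mul_cancel₀ hpos.ne']

lemma convolution_lsmul_assoc [CompleteSpace F] {η ρ : ℂ → ℝ} (hη : Continuous η)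
    (hηc : HasCompactSupport η) (hρ : Continuous ρ) (hρc : HasCompactSupport ρ) {u : ℂ → F} (hu : LocallyIntegrable u) (x : ℂ) :
    ((ρ ⋆[mul ℝ ℝ, volume] η) ⋆[lsmul ℝ ℝ, volume] u) x =
      (ρ ⋆[lsmul ℝ ℝ, volume] (η ⋆[lsmul ℝ ℝ, volume] u)) x := by
  have hnu : LocallyIntegrable fun x => ‖u x‖ := hu.mono hu.aestronglyMeasurable.norm
    (ae_of_all _ fun x => by simp)
  refine convolution_assoc (mul ℝ ℝ) (lsmul ℝ ℝ) (lsmul ℝ ℝ) (lsmul ℝ ℝ) ?_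
    hρ.aestronglyMeasurable hη.aestronglyMeasurable hu.aestronglyMeasurable ?_ ?_ ?_
  · intro a b c; exact mul_smul a b c
  · exact ae_of_all _ fun y => hρc.convolutionExists_left _ hρ hη.locallyIntegrable y
  · exact ae_of_all _ fun y => hηc.norm.convolutionExists_left _ hη.norm hnu y
  · refine hρc.norm.convolutionExists_left _ hρ.norm (Continuous.locallyIntegrable ?_) x
    exact hηc.norm.continuous_convolution_left _ hη.norm hnu

/-- A locally integrable function all of whose mollifications have the mean value property agrees
with its mollification by a fixed radial kernel. -/
lemma ae_eq_convolution_of_circleAverage [CompleteSpace F] {u : ℂ → F} (hu : LocallyIntegrable u)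
    (hm : ∀ η : ℂ → ℝ, ContDiff ℝ ∞ η → HasCompactSupport η → ∀ x r,
      Real.circleAverage (η ⋆[lsmul ℝ ℝ, volume] u) x r = (η ⋆[lsmul ℝ ℝ, volume] u) x) :
    ∃ ρ : ℂ → ℝ, ContDiff ℝ ∞ ρ ∧ HasCompactSupport ρ ∧
      u =ᵐ[volume] ρ ⋆[lsmul ℝ ℝ, volume] u := by
  obtain ⟨g, hg, hg2, hρ, hρc, hρ1⟩ := exists_radial_mollifier
  set ρ : ℂ → ℝ := fun t => g ‖t‖ with hρdef
  refine ⟨ρ, hρ, hρc, ?_⟩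
  -- `η * (ρ * u) = ρ * (η * u) = η * u`, the latter by the mean value property of `η * u`
  have key : ∀ η : ℂ → ℝ, ContDiff ℝ ∞ η → HasCompactSupport η →
      (η ⋆[lsmul ℝ ℝ, volume] (ρ ⋆[lsmul ℝ ℝ, volume] u)) = η ⋆[lsmul ℝ ℝ, volume] u := by
    intro η hη hηc
    have hvc : Continuous (η ⋆[lsmul ℝ ℝ, volume] u) :=
      hηc.continuous_convolution_left _ hη.continuous hu
    funext x
    have hcomm : (ρ ⋆[mul ℝ ℝ, volume] η) = η ⋆[mul ℝ ℝ, volume] ρ := by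
      rw [← convolution_flip]
      congr 1
      ext; simp
    rw [← convolution_lsmul_assoc hρ.continuous hρc hη.continuous hηc hu, ← hcomm,
      convolution_lsmul_assoc hη.continuous hηc hρ.continuous hρc hu, convolution_def]
    simp only [lsmul_apply]
    have h1 := integral_radial_smul_of_circleAverage hg hg2 hvc (x := x) (hm η hη hηc x)
    rw [hρ1, one_smul] at h1
    rw [← h1, ← integral_neg_eq_self]
    refine integral_congr_ae (ae_of_all _ fun t => ?_)
    simp [hρdef]
  let b : ℕ → ContDiffBump (0 : ℂ) := fun n =>
    ⟨1 / ((n : ℝ) + 1), 2 * (1 / ((n : ℝ) + 1)), Nat.one_div_pos_of_nat, by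
      linarith [(Nat.one_div_pos_of_nat : 0 < 1 / ((n : ℝ) + 1))]⟩
  have hb : Filter.Tendsto (fun n => (b n).rOut) Filter.atTop (nhds 0) := by
    have := (tendsto_one_div_add_atTop_nhds_zero_nat (𝕜 := ℝ)).const_mul 2
    rwa [mul_zero] at this
  have hae := ContDiffBump.ae_convolution_tendsto_right_of_locallyIntegrable (μ := volume)
    (φ := b) (K := 2) hb (Filter.Eventually.of_forall fun n => le_rfl) hu
  have hρu : Continuous (ρ ⋆[lsmul ℝ ℝ, volume] u) :=
    hρc.continuous_convolution_left _ hρ.continuous hu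
  filter_upwards [hae] with x hx
  have h2 := ContDiffBump.convolution_tendsto_right_of_continuous (μ := volume) (φ := b) hb hρu x
  simp_rw [key _ (b _).contDiff_normed (b _).hasCompactSupport_normed] at h2
  exact tendsto_nhds_unique hx h2

lemma fderiv_convolution_apply {η : ℂ → ℝ} (hη : ContDiff ℝ 1 η) (hηc : HasCompactSupport η)
    {u : ℂ → F} (hu : LocallyIntegrable u) (x e : ℂ) :
    fderiv ℝ (η ⋆[lsmul ℝ ℝ, volume] u) x e =
      ((fun t => fderiv ℝ η t e) ⋆[lsmul ℝ ℝ, volume] u) x := by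
  rw [(hηc.hasFDerivAt_convolution_left (lsmul ℝ ℝ) hη hu x).fderiv, convolution_def,
    convolution_def, ContinuousLinearMap.integral_apply]
  · rfl
  · exact (hηc.fderiv ℝ).convolutionExists_left _ (hη.continuous_fderiv (by norm_num)) hu x

lemma fderiv_comp_const_sub_apply {f : ℂ → F} (hf : Differentiable ℝ f) (x s v : ℂ) :
    fderiv ℝ (fun s => f (x - s)) s v = -fderiv ℝ f (x - s) v := by
  have h1 : HasFDerivAt (fun s : ℂ => x - s) (-ContinuousLinearMap.id ℝ ℂ) s :=
    (hasFDerivAt_id s).const_sub x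
  have h2 := (hf (x - s)).hasFDerivAt.comp s h1
  rw [show (fun s => f (x - s)) = f ∘ fun s => x - s from rfl, h2.fderiv]
  simp

lemma laplacian_comp_const_sub {f : ℂ → ℝ} (hf : ContDiff ℝ 2 f) (x s : ℂ) :
    (Δ fun s => f (x - s)) s = (Δ f) (x - s) := by
  have hfx : ContDiff ℝ 2 fun s => f (x - s) := hf.comp (contDiff_const.sub contDiff_id)
  have h1 : ∀ v, fderiv ℝ (fun y => fderiv ℝ (fun s => f (x - s)) y v) s v =
      fderiv ℝ (fun y => fderiv ℝ f y v) (x - s) v := by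
    intro v
    have hd := (contDiff_fderiv_apply_const hf (m := 1) (by norm_num) v)
    have e : (fun y => fderiv ℝ (fun s => f (x - s)) y v) = fun y => -fderiv ℝ f (x - y) v :=
      funext fun y => fderiv_comp_const_sub_apply (hf.differentiable (by norm_num)) x y v
    rw [e, fderiv_fun_neg, neg_apply,
      fderiv_comp_const_sub_apply (f := fun y => fderiv ℝ f y v) (hd.differentiable (by norm_num)),
      neg_neg]
  rw [laplacian_eq_fderiv hfx, laplacian_eq_fderiv hf, h1, h1]

/-- The mollifications of a weakly harmonic function are harmonic. -/
lemma harmonicAt_convolution {u : ℂ → ℝ} (hu : LocallyIntegrable u)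
    (hΔ : ∀ φ : ℂ → ℝ, ContDiff ℝ ∞ φ → HasCompactSupport φ → ∫ x, u x * (Δ φ) x = 0)
    {η : ℂ → ℝ} (hη : ContDiff ℝ ∞ η) (hηc : HasCompactSupport η) (x : ℂ) :
    InnerProductSpace.HarmonicAt (η ⋆[lsmul ℝ ℝ, volume] u) x := by
  have hv : ContDiff ℝ ∞ (η ⋆[lsmul ℝ ℝ, volume] u) := hηc.contDiff_convolution_left _ hη hu
  have hη2 : ContDiff ℝ 2 η := hη.of_le two_le_infty
  have hv2 : ContDiff ℝ 2 (η ⋆[lsmul ℝ ℝ, volume] u) := hv.of_le two_le_infty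
  refine ⟨hv2.contDiffAt, Filter.Eventually.of_forall fun y => ?_⟩
  have h1 : ∀ e, fderiv ℝ (fun z => fderiv ℝ (η ⋆[lsmul ℝ ℝ, volume] u) z e) y e =
      ((fun t => fderiv ℝ (fun z => fderiv ℝ η z e) t e) ⋆[lsmul ℝ ℝ, volume] u) y := by
    intro e
    have e1 : (fun z => fderiv ℝ (η ⋆[lsmul ℝ ℝ, volume] u) z e) =
        (fun t => fderiv ℝ η t e) ⋆[lsmul ℝ ℝ, volume] u :=
      funext fun z => fderiv_convolution_apply (hη2.of_le (by norm_num)) hηc hu z e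
    rw [e1, fderiv_convolution_apply (contDiff_fderiv_apply_const hη2 (by norm_num) e)
      (hasCompactSupport_fderiv_apply hηc e) hu]
  have hex : ∀ e, ConvolutionExistsAt (fun t => fderiv ℝ (fun z => fderiv ℝ η z e) t e) u y
      (lsmul ℝ ℝ) volume := fun e =>
    (hasCompactSupport_fderiv_apply (hasCompactSupport_fderiv_apply hηc e) e).convolutionExists_left
      _ (contDiff_fderiv_apply_const (contDiff_fderiv_apply_const hη2 (m := 1) (by norm_num) e)
        (m := 0) (by norm_num) e).continuous hu y
  rw [laplacian_eq_fderiv hv2, h1, h1, ← ConvolutionExistsAt.add_distrib (hex 1) (hex I),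
    convolution_def, ← integral_sub_left_eq_self _ volume y]
  have h2 := hΔ (fun s => η (y - s)) (hη.comp (contDiff_const.sub contDiff_id))
    (hηc.comp_homeomorph (Homeomorph.subLeft y))
  rw [Pi.zero_apply, ← h2]
  refine integral_congr_ae (ae_of_all _ fun s => ?_)
  simp only [lsmul_apply, Pi.add_apply, smul_eq_mul, sub_sub_cancel]
  rw [laplacian_comp_const_sub hη2, laplacian_eq_fderiv hη2, mul_comm]

/-- **Weyl's lemma** in the plane: a weakly harmonic locally integrable function is the real part
of an entire function. -/
theorem exists_entire_re_ae_eq {u : ℂ → ℝ} (hu : LocallyIntegrable u)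
    (hΔ : ∀ φ : ℂ → ℝ, ContDiff ℝ ∞ φ → HasCompactSupport φ → ∫ x, u x * (Δ φ) x = 0) :
    ∃ w : ℂ → ℂ, Differentiable ℂ w ∧ ∀ᵐ x, u x = (w x).re := by
  obtain ⟨ρ, hρ, hρc, hae⟩ := ae_eq_convolution_of_circleAverage hu fun η hη hηc x r =>
    InnerProductSpace.HarmonicOnNhd.circleAverage_eq fun y _ =>
      harmonicAt_convolution hu hΔ hη hηc y
  obtain ⟨w, hw, hre⟩ := InnerProductSpace.HarmonicOnNhd.exists_analyticOnNhd_univ_re_eq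
    (f := ρ ⋆[lsmul ℝ ℝ, volume] u) fun y _ => harmonicAt_convolution hu hΔ hρ hρc y
  refine ⟨w, fun x => (hw x (mem_univ x)).differentiableAt, ?_⟩
  filter_upwards [hae] with x hx
  rw [hx, ← hre]

/-- The mollifications of a weak solution of the Cauchy-Riemann equation are entire. -/
lemma differentiable_convolution_of_dzbar {f : ℂ → ℂ} (hf : LocallyIntegrable f)
    (hz : ∀ φ : ℂ → ℂ, ContDiff ℝ ∞ φ → HasCompactSupport φ → ∫ x, f x * dzbar φ x = 0)
    {η : ℂ → ℝ} (hη : ContDiff ℝ ∞ η) (hηc : HasCompactSupport η) :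
    Differentiable ℂ (η ⋆[lsmul ℝ ℝ, volume] f) := by
  have hη1 : ContDiff ℝ 1 η := hη.of_le (le_trans (by norm_num) two_le_infty)
  have hv : ContDiff ℝ ∞ (η ⋆[lsmul ℝ ℝ, volume] f) := hηc.contDiff_convolution_left _ hη hf
  intro x
  rw [differentiableAt_complex_iff_differentiableAt_real]
  refine ⟨hv.differentiable (by simp) x, ?_⟩
  rw [fderiv_convolution_apply hη1 hηc hf, fderiv_convolution_apply hη1 hηc hf]
  have hex : ∀ e, Integrable fun t => (fderiv ℝ η t e) • f (x - t) := fun e =>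
    (hasCompactSupport_fderiv_apply hηc e).convolutionExists_left (lsmul ℝ ℝ)
      (contDiff_fderiv_apply_const hη1 (m := 0) (by norm_num) e).continuous hf x
  simp only [convolution_def, lsmul_apply]
  have h2 := hz (fun s => (η (x - s) : ℂ))
    (Complex.ofRealCLM.contDiff.comp (hη.comp (contDiff_const.sub contDiff_id)))
    ((hηc.comp_homeomorph (Homeomorph.subLeft x)).comp_left (g := fun r : ℝ => (r : ℂ)) (by simp))
  have e1 : ∀ s v, fderiv ℝ (fun s => (η (x - s) : ℂ)) s v = -(fderiv ℝ η (x - s) v : ℂ) := by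
    intro s v
    have hd : Differentiable ℝ fun s => η (x - s) :=
      (hη1.differentiable (by norm_num)).comp (differentiable_id.const_sub x)
    have := Complex.ofRealCLM.hasFDerivAt.comp s (hd s).hasFDerivAt
    rw [show (fun s => (η (x - s) : ℂ)) = Complex.ofRealCLM ∘ fun s => η (x - s) from rfl,
      this.fderiv, ContinuousLinearMap.comp_apply,
      fderiv_comp_const_sub_apply (hη1.differentiable (by norm_num))]
    simp
  rw [← integral_sub_left_eq_self _ volume x] at h2
  simp only [dzbar, e1, sub_sub_cancel] at h2
  have h3 : ∀ t, f (x - t) * ((-(fderiv ℝ η t 1 : ℂ) + I * -(fderiv ℝ η t I : ℂ)) / 2) =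
      (-1 / 2 : ℂ) * ((fderiv ℝ η t 1) • f (x - t)) +
      (-I / 2 : ℂ) * ((fderiv ℝ η t I) • f (x - t)) := by
    intro t
    rw [Complex.real_smul, Complex.real_smul]; ring
  simp_rw [h3] at h2
  rw [integral_add ((hex 1).const_mul _) ((hex I).const_mul _), integral_const_mul,
    integral_const_mul] at h2
  rw [smul_eq_mul]
  linear_combination (2 * I) * h2 + (∫ t, (fderiv ℝ η t I) • f (x - t)) * I_sq

/-- **Weyl's lemma** for the Cauchy-Riemann operator: a locally integrable function with weak
derivative `∂_z̄ f = 0` is entire, up to a null set. -/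
theorem exists_entire_ae_eq {f : ℂ → ℂ} (hf : LocallyIntegrable f)
    (hz : ∀ φ : ℂ → ℂ, ContDiff ℝ ∞ φ → HasCompactSupport φ → ∫ x, f x * dzbar φ x = 0) :
    ∃ g : ℂ → ℂ, Differentiable ℂ g ∧ ∀ᵐ x, f x = g x := by
  obtain ⟨ρ, hρ, hρc, hae⟩ := ae_eq_convolution_of_circleAverage hf fun η hη hηc x r =>
    (differentiable_convolution_of_dzbar hf hz hη hηc).diffContOnCl.circleAverage
  exact ⟨_, differentiable_convolution_of_dzbar hf hz hρ hρc, hae⟩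

end Weyl

/-! ### Zero modes -/

lemma ae_eq_of_integral_mul_eq {u v : ℂ → ℂ} (hu : LocallyIntegrable u) (hv : LocallyIntegrable v)
    (h : ∀ φ : ℂ → ℂ, ContDiff ℝ ∞ φ → HasCompactSupport φ → ∫ x, u x * φ x = ∫ x, v x * φ x) :
    u =ᵐ[volume] v := by
  refine ae_eq_of_integral_contDiff_smul_eq hu hv fun g hg hgc => ?_
  have := h (fun x => (g x : ℂ)) (Complex.ofRealCLM.contDiff.comp hg)
    (hgc.comp_left (g := fun r : ℝ => (r : ℂ)) (by simp))
  simpa [Complex.real_smul, mul_comm] using this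

lemma HasWeakDzbar.ae_eq {f u v : ℂ → ℂ} (hu : HasWeakDzbar f u) (hv : HasWeakDzbar f v) :
    u =ᵐ[volume] v :=
  ae_eq_of_integral_mul_eq hu.2.1 hv.2.1 fun φ hφ hc =>
    neg_injective ((hu.2.2 φ hφ hc).symm.trans (hv.2.2 φ hφ hc))

lemma HasWeakDz.ae_eq {f u v : ℂ → ℂ} (hu : HasWeakDz f u) (hv : HasWeakDz f v) :
    u =ᵐ[volume] v :=
  ae_eq_of_integral_mul_eq hu.2.1 hv.2.1 fun φ hφ hc =>
    neg_injective ((hu.2.2 φ hφ hc).symm.trans (hv.2.2 φ hφ hc))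

lemma HasWeakDzbar.congr_right {f u v : ℂ → ℂ} (hu : HasWeakDzbar f u) (h : u =ᵐ[volume] v) :
    HasWeakDzbar f v := by
  refine ⟨hu.1, hu.2.1.congr h, fun φ hφ hc => ?_⟩
  rw [hu.2.2 φ hφ hc]
  congr 1
  exact integral_congr_ae (h.mono fun x hx => by simp only [hx])

lemma HasWeakDz.congr_right {f u v : ℂ → ℂ} (hu : HasWeakDz f u) (h : u =ᵐ[volume] v) :
    HasWeakDz f v := by
  refine ⟨hu.1, hu.2.1.congr h, fun φ hφ hc => ?_⟩
  rw [hu.2.2 φ hφ hc]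
  congr 1
  exact integral_congr_ae (h.mono fun x hx => by simp only [hx])

lemma weakDzbar_spec {f u : ℂ → ℂ} (hu : HasWeakDzbar f u) : HasWeakDzbar f (weakDzbar f) := by
  have h : ∃ u, HasWeakDzbar f u := ⟨u, hu⟩
  rw [weakDzbar, dif_pos h]
  exact h.choose_spec

lemma weakDz_spec {f u : ℂ → ℂ} (hu : HasWeakDz f u) : HasWeakDz f (weakDz f) := by
  have h : ∃ u, HasWeakDz f u := ⟨u, hu⟩
  rw [weakDz, dif_pos h]
  exact h.choose_spec

lemma dz_conj {φ : ℂ → ℂ} (hφ : Differentiable ℝ φ) (x : ℂ) :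
    dz (fun y => conj (φ y)) x = conj (dzbar φ x) := by
  have h : ∀ v, fderiv ℝ (fun y => conj (φ y)) x v = conj (fderiv ℝ φ x v) := by
    intro v
    have := (Complex.conjCLE.toContinuousLinearMap.hasFDerivAt (x := φ x)).comp x (hφ x).hasFDerivAt
    rw [show (fun y => conj (φ y)) = Complex.conjCLE.toContinuousLinearMap ∘ φ from rfl,
      this.fderiv]
    simp
  simp only [dz, dzbar, h, map_div₀, map_add, map_mul, Complex.conj_I, map_ofNat]
  ring

lemma locallyIntegrable_conj {f : ℂ → ℂ} (hf : LocallyIntegrable f) :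
    LocallyIntegrable fun x => conj (f x) :=
  hf.mono (Complex.continuous_conj.comp_aestronglyMeasurable hf.aestronglyMeasurable)
    (ae_of_all _ fun x => by simp)

/-- A locally integrable function is a weak solution of `∂_z̄ f = 0` if and only if it is entire. -/
lemma hasWeakDzbar_zero_iff {f : ℂ → ℂ} :
    HasWeakDzbar f 0 ↔ ∃ g : ℂ → ℂ, Differentiable ℂ g ∧ ∀ᵐ x, f x = g x := by
  constructor
  · rintro ⟨hf, -, h⟩
    exact exists_entire_ae_eq hf fun φ hφ hc => by simpa using h φ hφ hc
  · rintro ⟨g, hg, hfg⟩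
    have hfg : f =ᵐ[volume] g := hfg
    refine ⟨hg.continuous.locallyIntegrable.congr hfg.symm, locallyIntegrable_zero,
      fun φ hφ hc => ?_⟩
    have hg1 : ContDiff ℝ 1 g := (hg.contDiff (n := 1)).restrict_scalars ℝ
    have hφ1 : ContDiff ℝ 1 φ := hφ.of_le (le_trans (by norm_num) two_le_infty)
    have hp := integral_mul_fderiv_of_hasCompactSupport hg1 hφ1 hc
    have hi : ∀ v, Integrable fun x => g x * fderiv ℝ φ x v := fun v =>
      (hg.continuous.mul (contDiff_fderiv_apply_const hφ1 (m := 0) (by norm_num)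
        v).continuous).integrable_of_hasCompactSupport (hasCompactSupport_fderiv_apply hc v).mul_left
    have e : ∀ x, g x * dzbar φ x = (1 / 2) * (g x * fderiv ℝ φ x 1) +
        (I / 2) * (g x * fderiv ℝ φ x I) := fun x => by rw [dzbar]; ring
    have hcr : ∀ x, fderiv ℝ g x I = I * fderiv ℝ g x 1 := fun x =>
      (differentiableAt_complex_iff_differentiableAt_real.1 (hg x)).2
    rw [integral_congr_ae (hfg.mono fun x hx => by simp only [hx]
      : (fun x => f x * dzbar φ x) =ᵐ[volume] fun x => g x * dzbar φ x)]
    simp_rw [e]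
    rw [integral_add ((hi 1).const_mul _) ((hi I).const_mul _), integral_const_mul,
      integral_const_mul, hp, hp]
    simp_rw [hcr, mul_assoc I]
    rw [integral_const_mul]
    simp only [Pi.zero_apply, zero_mul, integral_zero, neg_zero]
    linear_combination (-1 / 2 : ℂ) * (∫ x, fderiv ℝ g x 1 * φ x) * I_sq

lemma hasWeakDz_zero_iff_conj {f : ℂ → ℂ} :
    HasWeakDz f 0 ↔ HasWeakDzbar (fun x => conj (f x)) 0 := by
  have hconj : ∀ φ : ℂ → ℂ, ContDiff ℝ ∞ φ → HasCompactSupport φ →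
      ContDiff ℝ ∞ (fun y => conj (φ y)) ∧ HasCompactSupport fun y => conj (φ y) := fun φ hφ hc =>
    ⟨Complex.conjCLE.contDiff.comp hφ, hc.comp_left (g := fun z : ℂ => conj z) (by simp)⟩
  constructor
  · rintro ⟨hf, -, h⟩
    refine ⟨locallyIntegrable_conj hf, locallyIntegrable_zero, fun φ hφ hc => ?_⟩
    have h2 := h _ (hconj φ hφ hc).1 (hconj φ hφ hc).2
    simp_rw [dz_conj (hφ.differentiable (by simp))] at h2
    have h3 := congrArg conj h2
    rw [← integral_conj] at h3
    simpa using h3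
  · rintro ⟨hf, -, h⟩
    have hf' := locallyIntegrable_conj hf
    simp only [Complex.conj_conj] at hf'
    refine ⟨hf', locallyIntegrable_zero, fun φ hφ hc => ?_⟩
    have h2 := h _ (hconj φ hφ hc).1 (hconj φ hφ hc).2
    have hd : ∀ x, dzbar (fun y => conj (φ y)) x = conj (dz φ x) := fun x => by
      have := dz_conj ((hconj φ hφ hc).1.differentiable (by simp)) x
      simp only [Complex.conj_conj] at this
      rw [show dz φ x = dz (fun y => φ y) x from rfl, this, Complex.conj_conj]
    simp_rw [hd] at h2
    have h3 := congrArg conj h2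
    rw [← integral_conj] at h3
    simpa using h3

lemma hasWeakDz_zero_iff {f : ℂ → ℂ} :
    HasWeakDz f 0 ↔ ∃ g : ℂ → ℂ, Differentiable ℂ g ∧ ∀ᵐ x, f x = conj (g x) := by
  rw [hasWeakDz_zero_iff_conj, hasWeakDzbar_zero_iff]
  refine exists_congr fun g => and_congr_right fun _ => ?_
  refine Filter.eventually_congr (ae_of_all _ fun x => ?_)
  constructor
  · intro h; rw [← h, Complex.conj_conj]
  · intro h; rw [h, Complex.conj_conj]

lemma conj_mul_self_mul_exp (u : ℂ) (r : ℝ) : conj u * u * (Real.exp (2 * r) : ℂ) =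
    ((‖(Real.exp r : ℂ) * u‖ ^ 2 : ℝ) : ℂ) := by
  rw [norm_mul, Complex.norm_real, Real.norm_of_nonneg (Real.exp_nonneg r), mul_pow,
    ← Real.exp_nat_mul, mul_comm (conj u), Complex.mul_conj, Complex.normSq_eq_norm_sq]
  push_cast
  ring

/-- The integral that constitutes each half of the form vanishes only for the function zero. -/
lemma integral_conj_mul_self_mul_exp {u : ℂ → ℂ} {k : ℂ → ℝ} (hk : ∀ x, 0 < k x)
    (hu : MemLp (fun x => (k x : ℂ) * u x) 2) :
    0 ≤ ∫ x, ‖(k x : ℂ) * u x‖ ^ 2 ∧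
      (∫ x, ‖(k x : ℂ) * u x‖ ^ 2 = 0 → u =ᵐ[volume] 0) := by
  refine ⟨integral_nonneg fun x => by positivity, fun h => ?_⟩
  have hi : Integrable fun x => ‖(k x : ℂ) * u x‖ ^ 2 :=
    hu.integrable_norm_pow (p := 2) (by norm_num)
  have h2 := (integral_eq_zero_iff_of_nonneg (fun x => by positivity) hi).1 h
  filter_upwards [h2] with x hx
  have hx : ‖(k x : ℂ) * u x‖ ^ 2 = 0 := hx
  have h3 : (k x : ℂ) * u x = 0 := by simpa using hx
  exact (mul_eq_zero.1 h3).resolve_left (by exact_mod_cast (hk x).ne')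

lemma pauliForm_eq_zero {h : ℂ → ℝ} {ψ : Spinor} (hu : HasWeakDzbar (upPart h ψ) 0)
    (hv : HasWeakDz (downPart h ψ) 0) (ξ : Spinor) : pauliForm h ψ ξ = 0 := by
  have eu := (weakDzbar_spec hu).ae_eq hu
  have ev := (weakDz_spec hv).ae_eq hv
  rw [pauliForm, integral_eq_zero_of_ae, integral_eq_zero_of_ae]
  · simp
  · filter_upwards [ev] with x hx
    simp [hx]
  · filter_upwards [eu] with x hx
    simp [hx]

/-- The kernel of `H_h` consists of the weak solutions of `∂_z̄ (e^{-h} ψ₊) = 0` and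
`∂_z (e^h ψ₋) = 0`, since `(0, ψ) = π^h(ψ, ψ)` is a sum of squares. -/
lemma mem_graph_zero_iff_weak {h : ℂ → ℝ} {H : Spinor →ₗ.[ℂ] Spinor} (hH : IsFormOperator h H)
    (ψ : Spinor) : (ψ, 0) ∈ H.graph ↔
      HasWeakDzbar (upPart h ψ) 0 ∧ HasWeakDz (downPart h ψ) 0 := by
  rw [hH ψ 0]
  constructor
  · rintro ⟨hψ, hz⟩
    obtain ⟨⟨u, hu, hu2⟩, v, hv, hv2⟩ := hψ
    have h0 := hz ψ ⟨⟨u, hu, hu2⟩, v, hv, hv2⟩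
    have eu := (weakDzbar_spec hu).ae_eq hu
    have ev := (weakDz_spec hv).ae_eq hv
    have e1 : ∫ x, conj (weakDzbar (upPart h ψ) x) * weakDzbar (upPart h ψ) x
        * (Real.exp (2 * h x) : ℂ) = ((∫ x, ‖(Real.exp (h x) : ℂ) * u x‖ ^ 2 : ℝ) : ℂ) := by
      rw [← integral_complex_ofReal]
      refine integral_congr_ae (eu.mono fun x hx => ?_)
      simp only [hx]
      exact conj_mul_self_mul_exp _ _
    have e2 : ∫ x, conj (weakDz (downPart h ψ) x) * weakDz (downPart h ψ) x
        * (Real.exp (-(2 * h x)) : ℂ) =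
        ((∫ x, ‖(Real.exp (-h x) : ℂ) * v x‖ ^ 2 : ℝ) : ℂ) := by
      rw [← integral_complex_ofReal]
      refine integral_congr_ae (ev.mono fun x hx => ?_)
      simp only [hx]
      rw [← conj_mul_self_mul_exp, mul_neg]
    rw [inner_zero_left, pauliForm, e1, e2] at h0
    have h0' : 0 = 4 * (∫ x, ‖(Real.exp (h x) : ℂ) * u x‖ ^ 2) +
        4 * ∫ x, ‖(Real.exp (-h x) : ℂ) * v x‖ ^ 2 := by exact_mod_cast h0
    obtain ⟨pu, zu⟩ := integral_conj_mul_self_mul_exp (fun x => Real.exp_pos (h x)) hu2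
    obtain ⟨pv, zv⟩ := integral_conj_mul_self_mul_exp (fun x => Real.exp_pos (-h x)) hv2
    exact ⟨hu.congr_right (zu (by linarith)), hv.congr_right (zv (by linarith))⟩
  · rintro ⟨hu, hv⟩
    refine ⟨⟨⟨0, hu, by simp⟩, 0, hv, by simp⟩, fun ξ _ => ?_⟩
    rw [inner_zero_left, pauliForm_eq_zero hu hv]

/-- The zero modes: `ψ₊ = e^h f` and `ψ₋ = e^{-h} conj g`, with entire functions `f` and `g`. -/
theorem mem_graph_zero_iff {h : ℂ → ℝ} {H : Spinor →ₗ.[ℂ] Spinor} (hH : IsFormOperator h H)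
    (ψ : Spinor) : (ψ, 0) ∈ H.graph ↔
      (∃ f : ℂ → ℂ, Differentiable ℂ f ∧ ∀ᵐ x, ψ x 0 = (Real.exp (h x) : ℂ) * f x) ∧
      ∃ g : ℂ → ℂ, Differentiable ℂ g ∧ ∀ᵐ x, ψ x 1 = (Real.exp (-h x) : ℂ) * conj (g x) := by
  have hexp : ∀ (r : ℝ) (a b : ℂ), (Real.exp (-r) : ℂ) * a = b ↔ a = (Real.exp r : ℂ) * b := by
    intro r a b
    have h1 : (Real.exp r : ℂ) * (Real.exp (-r) : ℂ) = 1 := by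
      rw [← Complex.ofReal_mul, ← Real.exp_add]; simp
    constructor
    · rintro rfl; rw [← mul_assoc, h1, one_mul]
    · rintro rfl; rw [← mul_assoc, mul_comm (Real.exp (-r) : ℂ), h1, one_mul]
  rw [mem_graph_zero_iff_weak hH, hasWeakDzbar_zero_iff, hasWeakDz_zero_iff]
  refine and_congr (exists_congr fun f => and_congr_right fun _ => ?_)
    (exists_congr fun g => and_congr_right fun _ => ?_)
  · exact Filter.eventually_congr (ae_of_all _ fun x => hexp _ _ _)
  · refine Filter.eventually_congr (ae_of_all _ fun x => ?_)
    have := hexp (-h x) (ψ x 1) (conj (g x))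
    rwa [neg_neg] at this

/-! ### Entire functions that are square integrable against `e^{-2h}` -/

open Polynomial in
/-- An entire function `E` with `e^{-h} E ∈ L²`, where `h` is the potential of a measure of flux `Φ`,
is a polynomial of degree at most `Φ - 1`. -/
theorem exists_polynomial_of_memLp (P Q : Measure ℂ) [IsFiniteMeasure P] [IsFiniteMeasure Q]
    (hQ : ∀ x, Q {x} < ENNReal.ofReal (2 * Real.pi)) {E : ℂ → ℂ} (hE : Differentiable ℂ E)
    (hL : MemLp (fun x => (Real.exp (-signedPotential P Q x) : ℂ) * E x) 2) :
    ∃ q : ℂ[X], (∀ x, E x = q.eval x) ∧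
      ∀ m : ℕ, (P.real univ - Q.real univ) / (2 * Real.pi) < m + 1 → q.coeff m = 0 := by
  have hpi := Real.pi_pos
  set Φ := (P.real univ - Q.real univ) / (2 * Real.pi) with hΦ
  have hint : ∀ s : ℝ, Φ + 1 < s → Integrable fun x => (1 + ‖x‖) ^ (-s) * ‖E x‖ := by
    intro s hs
    have h1 := integrable_exp_two_mul_signedPotential P Q hQ (t := 2 * s) (by
      have : (P.real univ - Q.real univ) / Real.pi = 2 * Φ := by rw [hΦ]; field_simp
      rw [this]; linarith)
    have hm := measurable_signedPotential P Q
    have h2 : MemLp (fun x => (1 + ‖x‖) ^ (-s) * Real.exp (signedPotential P Q x)) 2 := by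
      rw [memLp_two_iff_integrable_sq (Measurable.aestronglyMeasurable (by fun_prop))]
      refine h1.congr (ae_of_all _ fun x => ?_)
      simp only
      rw [mul_pow, ← Real.exp_nat_mul, ← Real.rpow_natCast, ← Real.rpow_mul (by positivity)]
      congr 2
      push_cast; ring
    have h3 := h2.integrable_mul hL.norm
    refine h3.congr (ae_of_all _ fun x => ?_)
    simp only [Pi.mul_apply]
    rw [norm_mul, Complex.norm_real, Real.norm_of_nonneg (Real.exp_nonneg _), mul_assoc,
      ← mul_assoc (Real.exp _), ← Real.exp_add, add_neg_cancel, Real.exp_zero, one_mul]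
  obtain ⟨q, hq, -⟩ := exists_polynomial_of_integrable hE (hint (Φ + 2) (by linarith))
  -- the weight with `s = m + 2` is admissible as soon as `Φ < m + 1`, and excludes degree `m`
  refine ⟨q, hq, fun m hm => ?_⟩
  obtain ⟨q', hq', h0⟩ := exists_polynomial_of_integrable hE (hint (m + 2) (by linarith))
  have : q = q' := Polynomial.funext fun x => by rw [← hq, ← hq']
  rw [this]
  exact h0 m le_rfl

/-- The monomials of degree less than `Φ - 1` are square integrable against `e^{-2h}`. -/
theorem memLp_exp_neg_signedPotential_mul_pow (P Q : Measure ℂ) [IsFiniteMeasure P]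
    [IsFiniteMeasure Q] (hP : ∀ x, P {x} < ENNReal.ofReal (2 * Real.pi)) {m : ℕ}
    (hm : (m : ℝ) + 1 < (P.real univ - Q.real univ) / (2 * Real.pi)) :
    MemLp (fun x => (Real.exp (-signedPotential P Q x) : ℂ) * x ^ m) 2 := by
  have hpi := Real.pi_pos
  set Φ := (P.real univ - Q.real univ) / (2 * Real.pi) with hΦ
  have h1 := integrable_exp_two_mul_signedPotential Q P hP (t := -(2 * m)) (by
    have : (Q.real univ - P.real univ) / Real.pi = -(2 * Φ) := by rw [hΦ]; field_simp; ring
    rw [this]; linarith)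
  have hms := measurable_signedPotential P Q
  have hmeas : Measurable fun x => (Real.exp (-signedPotential P Q x) : ℂ) * x ^ m := by fun_prop
  rw [memLp_two_iff_integrable_sq_norm hmeas.aestronglyMeasurable]
  refine h1.mono' (hmeas.norm.pow_const 2).aestronglyMeasurable (ae_of_all _ fun x => ?_)
  rw [Real.norm_of_nonneg (by positivity), norm_mul, Complex.norm_real,
    Real.norm_of_nonneg (Real.exp_nonneg _), mul_pow, ← Real.exp_nat_mul, norm_pow, ← pow_mul,
    signedPotential_swap P Q, mul_comm]
  rw [neg_neg, show (2 * (m : ℝ)) = ((m * 2 : ℕ) : ℝ) by push_cast; ring, Real.rpow_natCast]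
  push_cast
  gcongr
  linarith

open Polynomial in
/-- Under the upper bound `h ≤ (m + 1) log |x| + O(1)` at infinity, a polynomial of degree `m` is not
square integrable against `e^{-2h}`. -/
theorem coeff_eq_zero_of_memLp {h : ℂ → ℝ} {m : ℕ} {R C : ℝ}
    (hh : ∀ x : ℂ, R ≤ ‖x‖ → h x ≤ (m + 1) * Real.log (1 + ‖x‖) + C) {q : ℂ[X]}
    (hq : q.natDegree ≤ m) (hL : MemLp (fun x => (Real.exp (-h x) : ℂ) * q.eval x) 2) :
    q.coeff m = 0 := by
  have hL2 := (memLp_two_iff_integrable_sq_norm hL.1).1 hL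
  have hcont : Continuous fun x : ℂ => (1 + ‖x‖) ^ (-(2 * ((m : ℝ) + 1))) * ‖(q ^ 2).eval x‖ := by
    refine Continuous.mul ?_ (by fun_prop)
    exact (by fun_prop : Continuous fun x : ℂ => 1 + ‖x‖).rpow_const fun x => Or.inl (by positivity)
  have hi : Integrable fun x : ℂ =>
      (1 + ‖x‖) ^ (-(2 * ((m : ℝ) + 1))) * ‖(q ^ 2).eval x‖ := by
    have h1 : IntegrableOn (fun x : ℂ => (1 + ‖x‖) ^ (-(2 * ((m : ℝ) + 1))) * ‖(q ^ 2).eval x‖)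
        (Metric.closedBall 0 R) :=
      hcont.continuousOn.integrableOn_compact (isCompact_closedBall _ _)
    have h2 : IntegrableOn (fun x : ℂ => (1 + ‖x‖) ^ (-(2 * ((m : ℝ) + 1))) * ‖(q ^ 2).eval x‖)
        (Metric.closedBall 0 R)ᶜ := by
      refine ((hL2.const_mul (Real.exp (2 * C))).integrableOn).mono' hcont.aestronglyMeasurable ?_
      refine (ae_restrict_mem measurableSet_closedBall.compl).mono fun x hx => ?_
      have hx' : R < ‖x‖ := by simpa using hx
      rw [Real.norm_of_nonneg (by positivity), norm_mul, Complex.norm_real,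
        Real.norm_of_nonneg (Real.exp_nonneg _), mul_pow, ← Real.exp_nat_mul, ← mul_assoc,
        ← Real.exp_add, eval_pow, norm_pow, Real.rpow_def_of_pos (by positivity)]
      gcongr
      have := hh x hx'.le
      push_cast
      linarith
    refine (integrableOn_univ).1 ?_
    rw [← union_compl_self (Metric.closedBall (0 : ℂ) R)]
    exact h1.union h2
  -- `q²` has degree at most `2m`, and its coefficient of that order is the square of `q.coeff m`
  obtain ⟨q', hq', h0⟩ := exists_polynomial_of_integrable (G := fun x => (q ^ 2).eval x)
    (q ^ 2).differentiable hi
  have he : q ^ 2 = q' := Polynomial.funext hq'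
  have h3 := h0 (m + m) (by push_cast; linarith)
  rw [← he, pow_two, coeff_mul_add_eq_of_natDegree_le hq hq] at h3
  exact mul_self_eq_zero.1 h3

/-! ### Dimension count -/

section Dimension

open Polynomial

/-- The spinor whose `i`-th component is the square integrable function `f`, the other one being
zero. -/
noncomputable def singleSpinor (i : Fin 2) (f : ℂ → ℂ) (hf : MemLp f 2) : Spinor :=
  (ContinuousLinearMap.comp_memLp' (ContinuousLinearMap.toSpanSingleton ℂ
    (EuclideanSpace.single i (1 : ℂ))) hf).toLp _

lemma singleSpinor_coeFn (i : Fin 2) (f : ℂ → ℂ) (hf : MemLp f 2) :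
    ∀ᵐ x, singleSpinor i f hf x = f x • EuclideanSpace.single i (1 : ℂ) := by
  filter_upwards [MemLp.coeFn_toLp (ContinuousLinearMap.comp_memLp'
    (ContinuousLinearMap.toSpanSingleton ℂ (EuclideanSpace.single i (1 : ℂ))) hf)] with x hx
  rw [singleSpinor, hx]
  simp

/-- The polynomials `p` for which `κ · p(T x)` is square integrable. -/
noncomputable def sqIntegrablePolynomials (κ : ℂ → ℂ) (T : ℂ →+* ℂ) : Submodule ℂ ℂ[X] where
  carrier := {p | MemLp (fun x => κ x * p.eval (T x)) 2}
  add_mem' {p q} hp hq := by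
    have : MemLp (fun x => κ x * p.eval (T x) + κ x * q.eval (T x)) 2 := MemLp.add hp hq
    simpa [mul_add] using this
  zero_mem' := by simp
  smul_mem' c p hp := by
    have : MemLp (fun x => c * (κ x * p.eval (T x))) 2 := MemLp.const_mul hp c
    simpa [mul_left_comm] using this

/-- The spinor `κ · p(T x)`, placed in the component `i`, as a linear function of the polynomial. -/
noncomputable def polynomialSpinor (i : Fin 2) (κ : ℂ → ℂ) (T : ℂ →+* ℂ) :
    sqIntegrablePolynomials κ T →ₗ[ℂ] Spinor where
  toFun p := singleSpinor i (fun x => κ x * p.1.eval (T x)) p.2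
  map_add' p q := by
    refine Lp.ext ?_
    filter_upwards [singleSpinor_coeFn i _ p.2, singleSpinor_coeFn i _ q.2,
      singleSpinor_coeFn i _ (p + q).2, Lp.coeFn_add
      (singleSpinor i (fun x => κ x * p.1.eval (T x)) p.2)
      (singleSpinor i (fun x => κ x * q.1.eval (T x)) q.2)] with x h1 h2 h3 h4
    rw [h3, h4, Pi.add_apply, h1, h2, ← add_smul]
    simp [mul_add]
  map_smul' c p := by
    refine Lp.ext ?_
    filter_upwards [singleSpinor_coeFn i _ p.2, singleSpinor_coeFn i _ (c • p).2, Lp.coeFn_smul c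
      (singleSpinor i (fun x => κ x * p.1.eval (T x)) p.2)] with x h1 h3 h4
    rw [h3, RingHom.id_apply, h4, Pi.smul_apply, h1, smul_smul]
    simp [mul_left_comm]

lemma polynomialSpinor_coeFn (i : Fin 2) (κ : ℂ → ℂ) (T : ℂ →+* ℂ)
    (p : sqIntegrablePolynomials κ T) : ∀ᵐ x, polynomialSpinor i κ T p x =
      (κ x * p.1.eval (T x)) • EuclideanSpace.single i (1 : ℂ) :=
  singleSpinor_coeFn i _ p.2

lemma polynomialSpinor_injective (i : Fin 2) {κ : ℂ → ℂ} (hκ : ∀ x, κ x ≠ 0) {T : ℂ →+* ℂ}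
    (hT : Continuous T) (hTT : ∀ x, T (T x) = x) :
    Function.Injective (polynomialSpinor i κ T) := by
  rw [injective_iff_map_eq_zero]
  intro p hp
  have h1 : (fun x => p.1.eval (T x)) =ᵐ[volume] fun _ => 0 := by
    filter_upwards [polynomialSpinor_coeFn i κ T p, Lp.coeFn_zero (EuclideanSpace ℂ (Fin 2)) 2
      (volume : Measure ℂ)] with x hx h0
    rw [hp, h0] at hx
    have := congrArg (fun v : EuclideanSpace ℂ (Fin 2) => v i) hx
    have h2 : κ x * p.1.eval (T x) = 0 := by simpa using this.symm
    exact (mul_eq_zero.1 h2).resolve_left (hκ x)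
  have h2 := (Continuous.ae_eq_iff_eq volume (p.1.continuous.comp hT) continuous_const).1 h1
  refine Subtype.ext (Polynomial.funext fun x => ?_)
  have := congrFun h2 (T x)
  simpa [hTT] using this

lemma rank_degreeLT (n : ℕ) : Module.rank ℂ (degreeLT ℂ n) = n := by
  rw [(degreeLTEquiv ℂ n).rank_eq, rank_fin_fun]

/-- Lower bound for the dimension of a space of spinors of the form `κ · T E` in the component `i`,
with entire `E`, where `T` is the identity or the complex conjugation: the first `n` monomials
provide independent elements. -/
lemma natCast_le_rank (K : Submodule ℂ Spinor) (i : Fin 2) {κ : ℂ → ℂ} (hκ : ∀ x, κ x ≠ 0)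
    (hκm : AEStronglyMeasurable κ) {T : ℂ →+* ℂ} (hT : Continuous T) (hTT : ∀ x, T (T x) = x)
    (hTn : ∀ x, ‖T x‖ = ‖x‖)
    (hK : ∀ ψ : Spinor, (∃ E : ℂ → ℂ, Differentiable ℂ E ∧
      ∀ᵐ x, ψ x = (κ x * T (E x)) • EuclideanSpace.single i (1 : ℂ)) → ψ ∈ K) {n : ℕ}
    (hn : ∀ k < n, MemLp (fun x => κ x * x ^ k) 2) : (n : Cardinal) ≤ Module.rank ℂ K := by
  have hmono : ∀ k < n, MemLp (fun x => κ x * T x ^ k) 2 := fun k hk =>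
    (hn k hk).congr_norm (hκm.mul (hT.pow k).aestronglyMeasurable)
      (ae_of_all _ fun x => by simp [hTn])
  have hle : degreeLT ℂ n ≤ sqIntegrablePolynomials κ T := by
    intro p hp
    have e : (fun x => κ x * p.eval (T x)) =
        fun x => ∑ k ∈ Finset.range n, p.coeff k * (κ x * T x ^ k) := by
      funext x
      rcases eq_or_ne p 0 with rfl | hp0
      · simp
      rw [eval_eq_sum_range' ((natDegree_lt_iff_degree_lt hp0).2 (mem_degreeLT.1 hp)),
        Finset.mul_sum]
      exact Finset.sum_congr rfl fun k _ => by ring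
    show MemLp (fun x => κ x * p.eval (T x)) 2
    rw [e]
    exact memLp_finsetSum _ fun k hk => (hmono k (Finset.mem_range.1 hk)).const_mul _
  -- the polynomial `p` in `T x` is `T E` for the entire function `E` that has the coefficients of
  -- `p`, transformed by `T`
  have hmem : ∀ p, polynomialSpinor i κ T p ∈ K := fun p => by
    refine hK _ ⟨fun x => (p.1.map T).eval x, (p.1.map T).differentiable, ?_⟩
    filter_upwards [polynomialSpinor_coeFn i κ T p] with x hx
    rw [hx]
    congr 2
    have := eval_map_apply T (T x) (p := p.1)
    rw [hTT] at this
    rw [this, hTT]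
  rw [← rank_degreeLT n]
  exact (Submodule.rank_mono hle).trans (LinearMap.rank_le_of_injective
    ((polynomialSpinor i κ T).codRestrict K hmem)
    fun p q h => polynomialSpinor_injective i hκ hT hTT (congrArg Subtype.val h))

/-- Upper bound for the dimension of such a space: all elements come from polynomials of degree less
than `n`. -/
lemma rank_le_natCast (K : Submodule ℂ Spinor) (i : Fin 2) {κ : ℂ → ℂ}
    (hκm : AEStronglyMeasurable κ) {T : ℂ →+* ℂ} (hT : Continuous T) (hTn : ∀ x, ‖T x‖ = ‖x‖)
    (hK : ∀ ψ ∈ K, ∃ E : ℂ → ℂ, Differentiable ℂ E ∧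
      ∀ᵐ x, ψ x = (κ x * T (E x)) • EuclideanSpace.single i (1 : ℂ)) {n : ℕ}
    (hn : ∀ E : ℂ → ℂ, Differentiable ℂ E → MemLp (fun x => κ x * E x) 2 →
      ∃ q : ℂ[X], q ∈ degreeLT ℂ n ∧ ∀ x, E x = q.eval x) :
    Module.rank ℂ K ≤ (n : Cardinal) := by
  have hle : K ≤ (((sqIntegrablePolynomials κ T ⊓ degreeLT ℂ n).comap
      (sqIntegrablePolynomials κ T).subtype).map (polynomialSpinor i κ T)) := by
    intro ψ hψ
    obtain ⟨E, hE, hψE⟩ := hK ψ hψ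
    have h1 : MemLp (fun x => κ x * E x) 2 := by
      refine (Lp.memLp ψ).of_le (hκm.mul hE.continuous.aestronglyMeasurable) ?_
      filter_upwards [hψE] with x hx
      rw [hx, norm_smul, norm_mul, norm_mul, hTn]
      simp
    obtain ⟨q, hqn, hqE⟩ := hn E hE h1
    have h2 : ∀ x, (q.map T).eval (T x) = T (E x) := fun x => by
      rw [hqE, eval_map_apply]
    have h3 : q.map T ∈ degreeLT ℂ n :=
      mem_degreeLT.2 ((degree_map_le).trans_lt (mem_degreeLT.1 hqn))
    have h4 : q.map T ∈ sqIntegrablePolynomials κ T := by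
      show MemLp (fun x => κ x * (q.map T).eval (T x)) 2
      simp_rw [h2]
      exact h1.congr_norm (hκm.mul (hT.comp hE.continuous).aestronglyMeasurable)
        (ae_of_all _ fun x => by simp [hTn])
    refine ⟨⟨q.map T, h4⟩, ⟨h4, h3⟩, Lp.ext ?_⟩
    filter_upwards [polynomialSpinor_coeFn i κ T ⟨q.map T, h4⟩, hψE] with x hx hx'
    rw [hx, hx', h2]
  refine (Submodule.rank_mono hle).trans ((rank_map_le _ _).trans ?_)
  refine le_trans ?_ (rank_degreeLT n).le
  refine LinearMap.rank_le_of_injective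
    (((sqIntegrablePolynomials κ T).subtype.comp (Submodule.subtype _)).codRestrict (degreeLT ℂ n)
      fun p => p.2.2) ?_
  intro p p' h
  have h' : p.1.1 = p'.1.1 := congrArg (fun y : degreeLT ℂ n => (y : ℂ[X])) h
  exact Subtype.ext (Subtype.ext h')

end Dimension

/-! ### The kernel as a space of spinors -/

/-- The kernel of `H`, as a subspace of the Hilbert space. -/
noncomputable def zeroModes (H : Spinor →ₗ.[ℂ] Spinor) : Submodule ℂ Spinor :=
  H.graph.comap (LinearMap.inl ℂ Spinor Spinor)

lemma mem_zeroModes {H : Spinor →ₗ.[ℂ] Spinor} {ψ : Spinor} :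
    ψ ∈ zeroModes H ↔ (ψ, 0) ∈ H.graph := Iff.rfl

lemma dimKer_eq_rank_zeroModes (H : Spinor →ₗ.[ℂ] Spinor) :
    dimKer H = Module.rank ℂ (zeroModes H) := by
  have h : zeroModes H = (LinearMap.ker H.toFun).map H.domain.subtype := by
    ext ψ
    rw [mem_zeroModes, LinearPMap.mem_graph_iff]
    constructor
    · rintro ⟨y, rfl, hy⟩
      exact ⟨y, hy, rfl⟩
    · rintro ⟨y, hy, rfl⟩
      exact ⟨y, rfl, hy⟩
  rw [h, dimKer]
  exact (Submodule.equivMapOfInjective _ H.domain.injective_subtype _).rank_eq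

lemma rank_zeroModes_eq_of_conj {H H₀ : Spinor →ₗ.[ℂ] Spinor} (U : Spinor ≃ₗᵢ[ℂ] Spinor)
    (hU : ∀ ψ η : Spinor, (ψ, η) ∈ H.graph ↔ (U ψ, U η) ∈ H₀.graph) :
    Module.rank ℂ (zeroModes H) = Module.rank ℂ (zeroModes H₀) := by
  have h : zeroModes H₀ = (zeroModes H).map (U.toLinearEquiv : Spinor →ₗ[ℂ] Spinor) := by
    ext ψ
    rw [Submodule.mem_map_equiv, mem_zeroModes, mem_zeroModes, hU, map_zero]
    simp
  rw [h]
  exact (U.toLinearEquiv.submoduleMap (zeroModes H)).rank_eq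

lemma ae_ne_zero_of_analyticOrderAt_ne_top {F : ℂ → ℂ} (hF : Differentiable ℂ F)
    (h : analyticOrderAt F 0 ≠ ⊤) : ∀ᵐ x, F x ≠ 0 := by
  have ha : AnalyticOnNhd ℂ F univ := fun x _ => hF.analyticAt x
  obtain ⟨x, hx⟩ : ∃ x, F x ≠ 0 := by
    by_contra! hx
    exact h (analyticOrderAt_eq_top.2 (Filter.Eventually.of_forall hx))
  have h1 := ae_restrict_le_codiscreteWithin (μ := (volume : Measure ℂ)) MeasurableSet.univ
    (ha.preimage_zero_mem_codiscrete hx)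
  rw [Measure.restrict_univ] at h1
  filter_upwards [h1] with y hy
  simpa using hy

/-- A gauge transformation does not change the set where a component vanishes, up to a null set. -/
lemma IsGaugeTransformation.ae_apply_eq_zero {n : ℂ → ℤ} {U : Spinor ≃ₗᵢ[ℂ] Spinor}
    (hU : IsGaugeTransformation n U) {ψ : Spinor} {j : Fin 2} (h : ∀ᵐ x, (U ψ) x j = 0) :
    ∀ᵐ x, ψ x j = 0 := by
  obtain ⟨F, G, hF, hG, hF0, hG0, hUψ⟩ := hU
  have hFn : analyticOrderAt F 0 ≠ ⊤ := by rw [hF0]; exact ENat.natCast_ne_top _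
  have hGn : analyticOrderAt G 0 ≠ ⊤ := by rw [hG0]; exact ENat.natCast_ne_top _
  filter_upwards [h, hUψ ψ, ae_ne_zero_of_analyticOrderAt_ne_top hF hFn,
    ae_ne_zero_of_analyticOrderAt_ne_top hG hGn] with x h1 h2 h3 h4
  rw [h2, PiLp.smul_apply, smul_eq_mul] at h1
  refine (mul_eq_zero.1 h1).resolve_left ?_
  have : F x * conj (G x) ≠ 0 := mul_ne_zero h3 (by simpa using h4)
  exact div_ne_zero this (by simpa using this)

/-! ### Dimension of the kernel in terms of the flux -/

open Polynomial in
/-- Nonnegative flux leaves no square integrable function of modulus `e^{h} |E|` with an entire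
`E ≠ 0`: the flux of `-h` being at most `0`, `E` is a polynomial of degree at most `-1`. -/
lemma ae_eq_zero_of_flux_nonneg (P Q : Measure ℂ) [IsFiniteMeasure P] [IsFiniteMeasure Q]
    (hP : ∀ x, P {x} < ENNReal.ofReal (2 * Real.pi)) (hΦ : 0 ≤ P.real univ - Q.real univ)
    {κ : ℂ → ℂ} (hκ : ∀ᵐ x, ‖κ x‖ = Real.exp (signedPotential P Q x)) {T : ℂ →+* ℂ}
    (hTn : ∀ x, ‖T x‖ = ‖x‖) {E f : ℂ → ℂ} (hE : Differentiable ℂ E) (hf : MemLp f 2)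
    (hfE : ∀ᵐ x, f x = κ x * T (E x)) : ∀ᵐ x, f x = 0 := by
  have hpi := Real.pi_pos
  have hL : MemLp (fun x => (Real.exp (-signedPotential Q P x) : ℂ) * E x) 2 := by
    have hm := measurable_signedPotential Q P
    refine hf.congr_norm ((Measurable.aestronglyMeasurable (by fun_prop)).mul
      hE.continuous.aestronglyMeasurable) ?_
    filter_upwards [hκ, hfE] with x h1 h2
    rw [h2, norm_mul, norm_mul, h1, hTn, signedPotential_swap P Q, neg_neg, Complex.norm_real,
      Real.norm_of_nonneg (Real.exp_nonneg _)]
  obtain ⟨q, hq, h0⟩ := exists_polynomial_of_memLp Q P hP hE hL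
  have hq0 : q = 0 := by
    ext m
    refine h0 m ?_
    have : (Q.real univ - P.real univ) / (2 * Real.pi) ≤ 0 :=
      div_nonpos_of_nonpos_of_nonneg (by linarith) (by positivity)
    have h1 : (0 : ℝ) < m + 1 := by positivity
    linarith
  filter_upwards [hfE] with x hx
  rw [hx, hq, hq0]
  simp

open Polynomial in
/-- The count of zero modes for nonnegative flux `Φ`. The spinors in `K` have one component of the
form `κ · T E` with `|κ| = e^{-h}`, the other one of the form `κ' · T' E` with `|κ'| = e^{h}`, where
`E` is entire. The second one vanishes; in the first one `E` is a polynomial of degree less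
than `Φ - 1`, or possibly equal to `Φ - 1` if no upper bound for `h` is known. -/
theorem rank_bounds_of_flux_nonneg (P Q : Measure ℂ) [IsFiniteMeasure P] [IsFiniteMeasure Q]
    (hP : ∀ x, P {x} < ENNReal.ofReal (2 * Real.pi))
    (hQ : ∀ x, Q {x} < ENNReal.ofReal (2 * Real.pi)) {Φ : ℝ}
    (hΦ : Φ = (P.real univ - Q.real univ) / (2 * Real.pi)) (hΦ0 : 0 ≤ Φ)
    {i j : Fin 2} (hij : i ≠ j) {κ κ' : ℂ → ℂ} (hκ0 : ∀ x, κ x ≠ 0)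
    (hκm : AEStronglyMeasurable κ)
    (hκ : ∀ᵐ x, ‖κ x‖ = Real.exp (-signedPotential P Q x))
    (hκ' : ∀ᵐ x, ‖κ' x‖ = Real.exp (signedPotential P Q x)) {T T' : ℂ →+* ℂ}
    (hT : Continuous T) (hTT : ∀ x, T (T x) = x) (hTn : ∀ x, ‖T x‖ = ‖x‖)
    (hTn' : ∀ x, ‖T' x‖ = ‖x‖) (K : Submodule ℂ Spinor)
    (hK : ∀ ψ : Spinor, ψ ∈ K ↔
      (∃ E : ℂ → ℂ, Differentiable ℂ E ∧ ∀ᵐ x, ψ x i = κ x * T (E x)) ∧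
      ∃ E : ℂ → ℂ, Differentiable ℂ E ∧ ∀ᵐ x, ψ x j = κ' x * T' (E x)) :
    (∀ n : ℕ, (n : ℝ) < Φ → (n : Cardinal) ≤ Module.rank ℂ K) ∧
    (∀ n : ℕ, Φ < n + 1 → Module.rank ℂ K ≤ n) ∧
    (∀ n : ℕ, Φ = n + 1 → (∃ R C : ℝ, ∀ x : ℂ, R ≤ ‖x‖ →
      signedPotential P Q x ≤ Φ * Real.log (1 + ‖x‖) + C) → Module.rank ℂ K ≤ n) ∧
    ∀ ψ ∈ K, ∀ᵐ x, ψ x j = 0 := by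
  have hpi := Real.pi_pos
  have hcomp : ∀ (ψ : Spinor) (k : Fin 2), MemLp (fun x => ψ x k) 2 := fun ψ k =>
    ContinuousLinearMap.comp_memLp' (EuclideanSpace.proj k : EuclideanSpace ℂ (Fin 2) →L[ℂ] ℂ)
      (Lp.memLp ψ)
  have hzero : ∀ ψ ∈ K, ∀ᵐ x, ψ x j = 0 := by
    intro ψ hψ
    obtain ⟨-, E, hE, hψE⟩ := (hK ψ).1 hψ
    refine ae_eq_zero_of_flux_nonneg P Q hP ?_ hκ' hTn' hE (hcomp ψ j) hψE
    rw [hΦ] at hΦ0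
    by_contra! h
    exact absurd hΦ0 (not_le.2 (div_neg_of_neg_of_pos h (by positivity)))
  have hvec : ∀ (v : EuclideanSpace ℂ (Fin 2)) (c : ℂ),
      v = c • EuclideanSpace.single i (1 : ℂ) ↔ v i = c ∧ v j = 0 := by
    intro v c
    constructor
    · rintro rfl
      simp [hij.symm]
    · rintro ⟨h1, h2⟩
      ext k
      have : k = i ∨ k = j := by omega
      rcases this with rfl | rfl
      · simp [h1]
      · simp [h2, hij.symm]
  have hmem : ∀ E : ℂ → ℂ, Differentiable ℂ E → MemLp (fun x => κ x * E x) 2 →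
      MemLp (fun x => (Real.exp (-signedPotential P Q x) : ℂ) * E x) 2 := by
    intro E hE hL
    have hm := measurable_signedPotential P Q
    refine hL.congr_norm ((Measurable.aestronglyMeasurable (by fun_prop)).mul
      hE.continuous.aestronglyMeasurable) ?_
    filter_upwards [hκ] with x h1
    rw [norm_mul, norm_mul, h1, Complex.norm_real, Real.norm_of_nonneg (Real.exp_nonneg _)]
  have hpoly : ∀ E : ℂ → ℂ, Differentiable ℂ E → MemLp (fun x => κ x * E x) 2 →
      ∃ q : ℂ[X], (∀ x, E x = q.eval x) ∧ ∀ m : ℕ, Φ < m + 1 → q.coeff m = 0 := by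
    intro E hE hL
    rw [hΦ]
    exact exists_polynomial_of_memLp P Q hQ hE (hmem E hE hL)
  have hrep : ∀ ψ ∈ K, ∃ E : ℂ → ℂ, Differentiable ℂ E ∧
      ∀ᵐ x, ψ x = (κ x * T (E x)) • EuclideanSpace.single i (1 : ℂ) := by
    intro ψ hψ
    obtain ⟨⟨E, hE, hψE⟩, -⟩ := (hK ψ).1 hψ
    refine ⟨E, hE, ?_⟩
    filter_upwards [hψE, hzero ψ hψ] with x h1 h2
    exact (hvec _ _).2 ⟨h1, h2⟩
  refine ⟨fun n hn => ?_, fun n hn => ?_, fun n hn hgr => ?_, hzero⟩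
  · refine natCast_le_rank K i hκ0 hκm hT hTT hTn (fun ψ hψ => ?_) fun k hk => ?_
    · obtain ⟨E, hE, hψE⟩ := hψ
      refine (hK ψ).2 ⟨⟨E, hE, ?_⟩, 0, differentiable_const 0, ?_⟩
      · filter_upwards [hψE] with x hx
        exact ((hvec _ _).1 hx).1
      · filter_upwards [hψE] with x hx
        simpa using ((hvec _ _).1 hx).2
    · have hk1 : (k : ℝ) + 1 ≤ n := by exact_mod_cast hk
      have h1 := memLp_exp_neg_signedPotential_mul_pow P Q hP (m := k)
        (by rw [← hΦ]; linarith)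
      refine h1.congr_norm (hκm.mul (continuous_pow k).aestronglyMeasurable) ?_
      filter_upwards [hκ] with x h2
      rw [norm_mul, norm_mul, h2, Complex.norm_real, Real.norm_of_nonneg (Real.exp_nonneg _)]
  · refine rank_le_natCast K i hκm hT hTn hrep fun E hE hL => ?_
    obtain ⟨q, hq, h0⟩ := hpoly E hE hL
    refine ⟨q, mem_degreeLT.2 ((degree_lt_iff_coeff_zero _ _).2 fun m hm => h0 m ?_), hq⟩
    have : (n : ℝ) ≤ m := by exact_mod_cast hm
    linarith
  · obtain ⟨R, C, hgr⟩ := hgr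
    refine rank_le_natCast K i hκm hT hTn hrep fun E hE hL => ?_
    obtain ⟨q, hq, h0⟩ := hpoly E hE hL
    have hdeg : q.natDegree ≤ n := natDegree_le_iff_coeff_eq_zero.2 fun m hm => h0 m (by
      have : (n : ℝ) + 1 ≤ m := by exact_mod_cast hm
      linarith)
    have hn0 : q.coeff n = 0 := by
      rw [hn] at hgr
      refine coeff_eq_zero_of_memLp hgr hdeg ?_
      have := hmem E hE hL
      simpa only [hq] using this
    refine ⟨q, mem_degreeLT.2 ((degree_lt_iff_coeff_zero _ _).2 fun m hm => ?_), hq⟩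
    rcases hm.eq_or_lt with rfl | hlt
    · exact hn0
    · exact coeff_eq_zero_of_natDegree_lt (hdeg.trans_lt hlt)

namespace SignedRadonMeasure

lemma HasFiniteTotalVariation.isFiniteMeasure_pos {ν : SignedRadonMeasure}
    (h : ν.HasFiniteTotalVariation) : IsFiniteMeasure ν.pos :=
  ⟨lt_of_le_of_lt (by simp [variation]) h⟩

lemma HasFiniteTotalVariation.isFiniteMeasure_neg {ν : SignedRadonMeasure}
    (h : ν.HasFiniteTotalVariation) : IsFiniteMeasure ν.neg :=
  ⟨lt_of_le_of_lt (by simp [variation]) h⟩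

lemma pos_singleton_eq_zero_or_neg_singleton_eq_zero (ν : SignedRadonMeasure) (z : ℂ) :
    ν.pos {z} = 0 ∨ ν.neg {z} = 0 := by
  obtain ⟨s, -, h0, h1⟩ := ν.mutuallySingular
  by_cases hz : z ∈ s
  · exact Or.inl (measure_mono_null (singleton_subset_iff.2 hz) h0)
  · exact Or.inr (measure_mono_null (singleton_subset_iff.2 hz) h1)

lemma pos_neg_singleton_lt_of_value {ν : SignedRadonMeasure} {z : ℂ}
    (h : ν.value {z} ∈ Ico (-Real.pi) Real.pi) :
    ν.pos {z} < ENNReal.ofReal (2 * Real.pi) ∧ ν.neg {z} < ENNReal.ofReal (2 * Real.pi) := by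
  have hpi := Real.pi_pos
  have hp : ν.pos {z} ≠ ⊤ := Bornology.isBounded_singleton.measure_lt_top.ne
  have hn : ν.neg {z} ≠ ⊤ := Bornology.isBounded_singleton.measure_lt_top.ne
  have h2pi : 0 < ENNReal.ofReal (2 * Real.pi) := by simpa using hpi
  rw [value] at h
  rcases ν.pos_singleton_eq_zero_or_neg_singleton_eq_zero z with h0 | h0
  · refine ⟨by rwa [h0], ?_⟩
    rw [measureReal_def, h0] at h
    rw [ENNReal.lt_ofReal_iff_toReal_lt hn, ← measureReal_def]
    have := h.1
    simp only [ENNReal.toReal_zero, zero_sub] at this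
    linarith
  · refine ⟨?_, by rwa [h0]⟩
    rw [measureReal_def ν.neg, h0] at h
    rw [ENNReal.lt_ofReal_iff_toReal_lt hp, ← measureReal_def]
    have := h.2
    simp only [ENNReal.toReal_zero, sub_zero] at this
    linarith

end SignedRadonMeasure

/-- The zero modes of the form operator, with the potential replaced by `signedPotential`: the
difference of two potentials is the real part of an entire function `w`, and `e^w` is absorbed in
the entire functions. -/
lemma exists_zeroModes_weights {ν : SignedRadonMeasure} [IsFiniteMeasure ν.pos]
    [IsFiniteMeasure ν.neg] {h : ℂ → ℝ} (hh : IsPotential h ν) {H : Spinor →ₗ.[ℂ] Spinor}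
    (hH : IsFormOperator h H) :
    ∃ κ κ' : ℂ → ℂ, (∀ x, κ x ≠ 0) ∧ (∀ x, κ' x ≠ 0) ∧
      AEStronglyMeasurable κ ∧ AEStronglyMeasurable κ' ∧
      (∀ᵐ x, ‖κ x‖ = Real.exp (signedPotential ν.pos ν.neg x)) ∧
      (∀ᵐ x, ‖κ' x‖ = Real.exp (-signedPotential ν.pos ν.neg x)) ∧
      ∀ ψ : Spinor, ψ ∈ zeroModes H ↔
        (∃ E : ℂ → ℂ, Differentiable ℂ E ∧ ∀ᵐ x, ψ x 0 = κ x * RingHom.id ℂ (E x)) ∧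
        ∃ E : ℂ → ℂ, Differentiable ℂ E ∧ ∀ᵐ x, ψ x 1 = κ' x * starRingEnd ℂ (E x) := by
  have hs := locallyIntegrable_signedPotential ν.pos ν.neg
  obtain ⟨w, hw, hre⟩ := exists_entire_re_ae_eq (hh.1.sub hs) (by
    intro φ hφ hc
    have hφ2 : ContDiff ℝ 2 φ := hφ.of_le two_le_infty
    have hΔc := continuous_laplacian hφ2
    have hΔs := hasCompactSupport_laplacian hφ2 hc
    simp_rw [Pi.sub_apply, sub_mul]
    rw [integral_sub (hh.1.integrable_mul_of_hasCompactSupport hΔc hΔs)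
      (hs.integrable_mul_of_hasCompactSupport hΔc hΔs), hh.2 φ hφ hc,
      integral_signedPotential_mul_laplacian ν.pos ν.neg hφ2 hc, sub_self])
  have hmh : AEStronglyMeasurable h := hh.1.aestronglyMeasurable
  have hcw := hw.continuous
  have hexp : ∀ z : ℂ, Complex.exp z * Complex.exp (-z) = 1 := fun z => by
    rw [← Complex.exp_add]; simp
  have hofReal : ∀ k : ℂ → ℝ, AEStronglyMeasurable k →
      AEStronglyMeasurable fun x => (Real.exp (k x) : ℂ) := fun k hk =>
    (Complex.continuous_ofReal.comp Real.continuous_exp).comp_aestronglyMeasurable hk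
  refine ⟨fun x => Real.exp (h x) * Complex.exp (-w x),
    fun x => Real.exp (-h x) * conj (Complex.exp (w x)), fun x => ?_, fun x => ?_,
    (hofReal h hmh).mul (by fun_prop : Continuous _).aestronglyMeasurable,
    (hofReal (fun x => -h x) hmh.neg).mul (by fun_prop : Continuous _).aestronglyMeasurable,
    ?_, ?_, fun ψ => ?_⟩
  · exact mul_ne_zero (by exact_mod_cast (Real.exp_pos _).ne') (Complex.exp_ne_zero _)
  · exact mul_ne_zero (by exact_mod_cast (Real.exp_pos _).ne')
      ((map_ne_zero _).2 (Complex.exp_ne_zero _))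
  · filter_upwards [hre] with x hx
    rw [norm_mul, Complex.norm_real, Real.norm_of_nonneg (Real.exp_nonneg _), Complex.norm_exp,
      ← Real.exp_add]
    simp only [Pi.sub_apply] at hx
    rw [Complex.neg_re, ← hx]
    congr 1; ring
  · filter_upwards [hre] with x hx
    rw [norm_mul, Complex.norm_real, Real.norm_of_nonneg (Real.exp_nonneg _), RCLike.norm_conj,
      Complex.norm_exp, ← Real.exp_add]
    simp only [Pi.sub_apply] at hx
    rw [← hx]
    congr 1; ring
  · rw [mem_zeroModes, mem_graph_zero_iff hH]
    refine and_congr ⟨?_, ?_⟩ ⟨?_, ?_⟩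
    · rintro ⟨f, hf, hψ⟩
      refine ⟨fun x => Complex.exp (w x) * f x, hw.cexp.mul hf, ?_⟩
      filter_upwards [hψ] with x hx
      rw [hx, RingHom.id_apply]
      linear_combination (-(Real.exp (h x) : ℂ) * f x) * hexp (w x)
    · rintro ⟨f, hf, hψ⟩
      refine ⟨fun x => Complex.exp (-w x) * f x, hw.neg.cexp.mul hf, ?_⟩
      filter_upwards [hψ] with x hx
      rw [hx, RingHom.id_apply, mul_assoc]
    · rintro ⟨f, hf, hψ⟩
      refine ⟨fun x => Complex.exp (-w x) * f x, hw.neg.cexp.mul hf, ?_⟩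
      filter_upwards [hψ] with x hx
      have := congrArg conj (hexp (w x))
      rw [map_mul, map_one] at this
      rw [hx, map_mul]
      linear_combination (-(Real.exp (-h x) : ℂ) * conj (f x)) * this
    · rintro ⟨f, hf, hψ⟩
      refine ⟨fun x => Complex.exp (w x) * f x, hw.cexp.mul hf, ?_⟩
      filter_upwards [hψ] with x hx
      rw [hx, map_mul, mul_assoc]

/-- The count of zero modes for either sign of the flux. -/
theorem zeroModes_bounds {ν : SignedRadonMeasure} (hν : ν.HasFiniteTotalVariation)
    (hatom : ∀ z, ν.value {z} ∈ Ico (-Real.pi) Real.pi) {h : ℂ → ℝ} (hh : IsPotential h ν)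
    {H : Spinor →ₗ.[ℂ] Spinor} (hH : IsFormOperator h H) :
    (∀ n : ℕ, (n : ℝ) < |ν.flux| → (n : Cardinal) ≤ Module.rank ℂ (zeroModes H)) ∧
    (∀ n : ℕ, |ν.flux| < n + 1 → Module.rank ℂ (zeroModes H) ≤ n) ∧
    (∀ n : ℕ, |ν.flux| = n + 1 → (ν.HasCompactSupport ∨ ν.HasDefiniteSign) →
      Module.rank ℂ (zeroModes H) ≤ n) ∧
    (0 ≤ ν.flux → ∀ ψ ∈ zeroModes H, ∀ᵐ x, ψ x 0 = 0) ∧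
    (ν.flux ≤ 0 → ∀ ψ ∈ zeroModes H, ∀ᵐ x, ψ x 1 = 0) := by
  have hpi := Real.pi_pos
  have := hν.isFiniteMeasure_pos
  have := hν.isFiniteMeasure_neg
  have hP := fun z => (SignedRadonMeasure.pos_neg_singleton_lt_of_value (hatom z)).1
  have hQ := fun z => (SignedRadonMeasure.pos_neg_singleton_lt_of_value (hatom z)).2
  obtain ⟨κ, κ', h0, h0', hm, hm', hn, hn', hz⟩ := exists_zeroModes_weights hh hH
  have hflux : ν.flux = (ν.pos.real univ - ν.neg.real univ) / (2 * Real.pi) := rfl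
  have hflux' : -ν.flux = (ν.neg.real univ - ν.pos.real univ) / (2 * Real.pi) := by
    rw [hflux]; ring
  have hpart : ∀ (P : Measure ℂ), (P = ν.pos ∨ P = ν.neg) → ν.HasCompactSupport →
      ∃ K : Set ℂ, IsCompact K ∧ P Kᶜ = 0 := by
    rintro P hPν ⟨K, hK, hK0⟩
    refine ⟨K, hK, ?_⟩
    rw [SignedRadonMeasure.variation, Measure.add_apply, add_eq_zero] at hK0
    rcases hPν with rfl | rfl
    exacts [hK0.1, hK0.2]
  have hposcase : 0 ≤ ν.flux → _ := fun hΦ => rank_bounds_of_flux_nonneg ν.pos ν.neg hP hQ hflux hΦ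
    (by decide : (1 : Fin 2) ≠ 0) h0' hm' hn' hn
    (T := starRingEnd ℂ) (T' := RingHom.id ℂ) Complex.continuous_conj Complex.conj_conj
    (fun x => RCLike.norm_conj x) (fun _ => rfl) (zeroModes H) fun ψ => (hz ψ).trans and_comm
  have hnegcase : ν.flux ≤ 0 → _ := fun hΦ => rank_bounds_of_flux_nonneg ν.neg ν.pos hQ hP hflux'
    (neg_nonneg.2 hΦ) (by decide : (0 : Fin 2) ≠ 1) h0 hm
    (by simpa only [signedPotential_swap ν.pos ν.neg, neg_neg] using hn)
    (by simpa only [signedPotential_swap ν.pos ν.neg] using hn')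
    (T := RingHom.id ℂ) (T' := starRingEnd ℂ) continuous_id (fun _ => rfl)
    (fun _ => rfl) (fun x => RCLike.norm_conj x) (zeroModes H) hz
  refine ⟨?_, ?_, ?_, fun hΦ => (hposcase hΦ).2.2.2, fun hΦ => (hnegcase hΦ).2.2.2⟩
  · rcases le_total 0 ν.flux with hΦ | hΦ
    · rw [abs_of_nonneg hΦ]; exact (hposcase hΦ).1
    · rw [abs_of_nonpos hΦ]; exact (hnegcase hΦ).1
  · rcases le_total 0 ν.flux with hΦ | hΦ
    · rw [abs_of_nonneg hΦ]; exact (hposcase hΦ).2.1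
    · rw [abs_of_nonpos hΦ]; exact (hnegcase hΦ).2.1
  · intro n hn1 hor
    have hn0 : (0 : ℝ) < n + 1 := by positivity
    rcases le_total 0 ν.flux with hΦ | hΦ
    · rw [abs_of_nonneg hΦ] at hn1
      refine (hposcase hΦ).2.2.1 n hn1 ?_
      obtain ⟨K, hK, hK0⟩ : ∃ K : Set ℂ, IsCompact K ∧ ν.neg Kᶜ = 0 := by
        rcases hor with hor | hor | hor
        · exact hpart _ (Or.inr rfl) hor
        · exact ⟨∅, isCompact_empty, by simp [hor]⟩
        · have : ν.flux ≤ 0 := by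
            rw [hflux, hor]
            exact div_nonpos_of_nonpos_of_nonneg (by simp) (by positivity)
          linarith
      rw [hflux]
      exact exists_signedPotential_le ν.pos ν.neg hK hK0
    · rw [abs_of_nonpos hΦ] at hn1
      refine (hnegcase hΦ).2.2.1 n hn1 ?_
      obtain ⟨K, hK, hK0⟩ : ∃ K : Set ℂ, IsCompact K ∧ ν.pos Kᶜ = 0 := by
        rcases hor with hor | hor | hor
        · exact hpart _ (Or.inl rfl) hor
        · have : 0 ≤ ν.flux := by
            rw [hflux, hor]
            exact div_nonneg (by simp) (by positivity)
          linarith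
        · exact ⟨∅, isCompact_empty, by simp [hor]⟩
      rw [hflux']
      exact exists_signedPotential_le ν.neg ν.pos hK hK0

/-- The dimension formula and the chirality of the zero modes. -/
theorem dimKer_isPauliOperator {μ : SignedRadonMeasure}
    (hμ : μ.reduction.HasFiniteTotalVariation) {H : Spinor →ₗ.[ℂ] Spinor}
    (hH : IsPauliOperator μ H) {Φ : ℝ} (hΦ : Φ = μ.reduction.flux) :
    (((¬ ∃ k : ℤ, Φ = k) ∨ Φ = 0) → dimKer H = (⌊|Φ|⌋₊ : Cardinal)) ∧
    ((∃ k : ℤ, Φ = k) → Φ ≠ 0 →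
      dimKer H = (⌊|Φ|⌋₊ : Cardinal) ∨ dimKer H = ((⌊|Φ|⌋₊ - 1 : ℕ) : Cardinal)) ∧
    ((∃ k : ℤ, Φ = k) → Φ ≠ 0 →
      (μ.reduction.HasCompactSupport ∨ μ.reduction.HasDefiniteSign) →
      dimKer H = ((⌊|Φ|⌋₊ - 1 : ℕ) : Cardinal)) ∧
    (∀ ψ : Spinor, (ψ, 0) ∈ H.graph →
      ∀ᵐ x : ℂ, sigma3.mulVec (ψ x).ofLp = (-(Real.sign Φ : ℂ)) • (ψ x).ofLp) := by
  obtain ⟨h, H₀, n, U, hh, hH₀, -, hU, hUH⟩ := hH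
  obtain ⟨b1, b2, b3, b4, b5⟩ := zeroModes_bounds hμ (μ.reduction_spec.2) hh hH₀
  rw [← hΦ] at b1 b2 b3 b4 b5
  rw [dimKer_eq_rank_zeroModes, rank_zeroModes_eq_of_conj U hUH]
  have hup := b2 ⌊|Φ|⌋₊ (Nat.lt_floor_add_one _)
  -- for integer `Φ ≠ 0`, `⌊|Φ|⌋₊ = |Φ|` is a positive natural number
  have hint : (∃ k : ℤ, Φ = k) → Φ ≠ 0 → ∃ m : ℕ, |Φ| = m + 1 ∧ ⌊|Φ|⌋₊ = m + 1 := by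
    rintro ⟨k, hk⟩ h0
    have hk0 : k ≠ 0 := by rintro rfl; exact h0 (by simpa using hk)
    obtain ⟨m, hm⟩ := Nat.exists_eq_succ_of_ne_zero (Int.natAbs_ne_zero.2 hk0)
    have h1 : |Φ| = ((m + 1 : ℕ) : ℝ) := by
      rw [hk, ← Int.cast_abs, Int.abs_eq_natAbs, hm]; simp
    exact ⟨m, by rw [h1]; push_cast; rfl, by rw [h1, Nat.floor_natCast]⟩
  refine ⟨fun hor => le_antisymm hup ?_, fun hk h0 => ?_, fun hk h0 hor => ?_, fun ψ hψ => ?_⟩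
  · rcases hor with hk | h0
    · refine b1 _ (lt_of_le_of_ne (Nat.floor_le (abs_nonneg _)) fun he => hk ?_)
      rcases abs_choice Φ with hc | hc
      · exact ⟨⌊|Φ|⌋₊, by rw [hc] at he; rw [hc, Int.cast_natCast, he]⟩
      · refine ⟨-(⌊|Φ|⌋₊ : ℤ), ?_⟩
        rw [Int.cast_neg, Int.cast_natCast, he, hc, neg_neg]
    · simp [h0]
  · obtain ⟨m, hm, hm'⟩ := hint hk h0
    have hlow := b1 m (by rw [hm]; linarith)
    rw [hm'] at hup ⊢
    obtain ⟨r, hr⟩ := Cardinal.lt_aleph0.1 (hup.trans_lt (Cardinal.natCast_lt_aleph0))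
    rw [hr] at hup hlow ⊢
    have h1 : r ≤ m + 1 := by exact_mod_cast hup
    have h2 : m ≤ r := by exact_mod_cast hlow
    have : r = m + 1 ∨ r = m := by omega
    rcases this with rfl | rfl
    · exact Or.inl rfl
    · exact Or.inr (by simp)
  · obtain ⟨m, hm, hm'⟩ := hint hk h0
    rw [hm', Nat.add_sub_cancel]
    exact le_antisymm (b3 m hm hor) (b1 m (by rw [hm]; linarith))
  · have hψ0 : U ψ ∈ zeroModes H₀ := by
      rw [mem_zeroModes, ← map_zero U]
      exact (hUH ψ 0).1 hψ
    have c0 := fun hs => hU.ae_apply_eq_zero (b4 hs _ hψ0)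
    have c1 := fun hs => hU.ae_apply_eq_zero (b5 hs _ hψ0)
    rcases lt_trichotomy Φ 0 with hs | hs | hs
    · filter_upwards [c1 hs.le] with x hx
      rw [Real.sign_of_neg hs]
      ext k
      fin_cases k <;> simp [sigma3, Matrix.mulVec, dotProduct, Fin.sum_univ_two, hx]
    · filter_upwards [c0 hs.ge, c1 hs.le] with x hx hx'
      rw [hs, Real.sign_zero]
      ext k
      fin_cases k <;> simp [sigma3, Matrix.mulVec, dotProduct, Fin.sum_univ_two, hx, hx']
    · filter_upwards [c0 hs.le] with x hx
      rw [Real.sign_of_pos hs]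
      ext k
      fin_cases k <;> simp [sigma3, Matrix.mulVec, dotProduct, Fin.sum_univ_two, hx]

/-! ### Existence of the form operator -/

/-- `D f = u` in the sense of distributions, for a first order differential operator `D` with
constant coefficients. Both `HasWeakDz` and `HasWeakDzbar` are definitionally of this form. -/
def HasWeakDeriv (D : (ℂ → ℂ) → ℂ → ℂ) (f u : ℂ → ℂ) : Prop :=
  LocallyIntegrable f ∧ LocallyIntegrable u ∧
  ∀ φ : ℂ → ℂ, ContDiff ℝ ∞ φ → HasCompactSupport φ → ∫ x, f x * D φ x = - ∫ x, u x * φ x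

lemma continuous_dzbar {φ : ℂ → ℂ} (hφ : ContDiff ℝ ∞ φ) : Continuous (dzbar φ) := by
  have h := fun v => (contDiff_fderiv_apply_const hφ (m := 0) (by simp) v).continuous
  exact ((h 1).add (continuous_const.mul (h I))).div_const 2

lemma continuous_dz {φ : ℂ → ℂ} (hφ : ContDiff ℝ ∞ φ) : Continuous (dz φ) := by
  have h := fun v => (contDiff_fderiv_apply_const hφ (m := 0) (by simp) v).continuous
  exact ((h 1).sub (continuous_const.mul (h I))).div_const 2

lemma hasCompactSupport_dzbar {φ : ℂ → ℂ} (hc : HasCompactSupport φ) :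
    HasCompactSupport (dzbar φ) := by
  have h1 := hasCompactSupport_fderiv_apply hc 1
  have h2 := (hasCompactSupport_fderiv_apply hc I).mul_left (f := fun _ => I)
  exact (h1.add h2).mul_right (f' := fun _ => (2 : ℂ)⁻¹)

lemma hasCompactSupport_dz {φ : ℂ → ℂ} (hc : HasCompactSupport φ) :
    HasCompactSupport (dz φ) := by
  have h1 := hasCompactSupport_fderiv_apply hc 1
  have h2 := (hasCompactSupport_fderiv_apply hc I).mul_left (f := fun _ => I)
  exact (h1.sub h2).mul_right (f' := fun _ => (2 : ℂ)⁻¹)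

lemma HasWeakDeriv.linearComb {D : (ℂ → ℂ) → ℂ → ℂ}
    (hD : ∀ φ : ℂ → ℂ, ContDiff ℝ ∞ φ → HasCompactSupport φ →
      Continuous (D φ) ∧ HasCompactSupport (D φ))
    {f g F u v : ℂ → ℂ} (hu : HasWeakDeriv D f u) (hv : HasWeakDeriv D g v) (c : ℂ)
    (hF : F =ᵐ[volume] fun x => c * f x + g x) :
    HasWeakDeriv D F fun x => c * u x + v x := by
  have hl : ∀ {f g : ℂ → ℂ}, LocallyIntegrable f → LocallyIntegrable g →
      LocallyIntegrable fun x => c * f x + g x := fun hf hg => (hf.smul c).add hg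
  refine ⟨(hl hu.1 hv.1).congr hF.symm, hl hu.2.1 hv.2.1, fun φ hφ hc => ?_⟩
  obtain ⟨hDc, hDs⟩ := hD φ hφ hc
  have e1 : (fun x => F x * D φ x) =ᵐ[volume] fun x => c * (f x * D φ x) + g x * D φ x := by
    filter_upwards [hF] with x hx
    rw [hx]; ring
  have e2 : ∀ x, (c * u x + v x) * φ x = c * (u x * φ x) + v x * φ x := fun x => by ring
  rw [integral_congr_ae e1, integral_add
    ((hu.1.integrable_mul_of_hasCompactSupport hDc hDs).const_mul c)
    (hv.1.integrable_mul_of_hasCompactSupport hDc hDs), integral_const_mul, hu.2.2 φ hφ hc,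
    hv.2.2 φ hφ hc]
  simp_rw [e2]
  rw [integral_add ((hu.2.1.integrable_mul_of_hasCompactSupport hφ.continuous hc).const_mul c)
    (hv.2.1.integrable_mul_of_hasCompactSupport hφ.continuous hc), integral_const_mul]
  ring

lemma HasWeakDzbar.linearComb {f g F u v : ℂ → ℂ} (hu : HasWeakDzbar f u) (hv : HasWeakDzbar g v)
    (c : ℂ) (hF : F =ᵐ[volume] fun x => c * f x + g x) :
    HasWeakDzbar F fun x => c * u x + v x :=
  HasWeakDeriv.linearComb (D := dzbar)
    (fun _ hφ hc => ⟨continuous_dzbar hφ, hasCompactSupport_dzbar hc⟩) hu hv c hF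

lemma HasWeakDz.linearComb {f g F u v : ℂ → ℂ} (hu : HasWeakDz f u) (hv : HasWeakDz g v)
    (c : ℂ) (hF : F =ᵐ[volume] fun x => c * f x + g x) :
    HasWeakDz F fun x => c * u x + v x :=
  HasWeakDeriv.linearComb (D := dz)
    (fun _ hφ hc => ⟨continuous_dz hφ, hasCompactSupport_dz hc⟩) hu hv c hF

lemma HasWeakDzbar.congr_left {f F u : ℂ → ℂ} (hu : HasWeakDzbar f u) (hF : F =ᵐ[volume] f) :
    HasWeakDzbar F u := by
  have := hu.linearComb hu 0 (F := F) (by simpa using hF)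
  simpa using this

lemma HasWeakDz.congr_left {f F u : ℂ → ℂ} (hu : HasWeakDz f u) (hF : F =ᵐ[volume] f) :
    HasWeakDz F u := by
  have := hu.linearComb hu 0 (F := F) (by simpa using hF)
  simpa using this

lemma upPart_linearComb (h : ℂ → ℝ) (c : ℂ) (ψ ψ' : Spinor) :
    upPart h (c • ψ + ψ') =ᵐ[volume] fun x => c * upPart h ψ x + upPart h ψ' x := by
  filter_upwards [Lp.coeFn_add (c • ψ) ψ', Lp.coeFn_smul c ψ] with x h1 h2
  rw [upPart, h1, Pi.add_apply, h2, upPart, upPart]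
  simp only [Pi.smul_apply, PiLp.add_apply, PiLp.smul_apply, smul_eq_mul]
  ring

lemma downPart_linearComb (h : ℂ → ℝ) (c : ℂ) (ψ ψ' : Spinor) :
    downPart h (c • ψ + ψ') =ᵐ[volume] fun x => c * downPart h ψ x + downPart h ψ' x := by
  filter_upwards [Lp.coeFn_add (c • ψ) ψ', Lp.coeFn_smul c ψ] with x h1 h2
  rw [downPart, h1, Pi.add_apply, h2, downPart, downPart]
  simp only [Pi.smul_apply, PiLp.add_apply, PiLp.smul_apply, smul_eq_mul]
  ring

lemma memLp_linearComb {r : ℂ → ℝ} {u v : ℂ → ℂ}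
    (hu : MemLp (fun x => (Real.exp (r x) : ℂ) * u x) 2)
    (hv : MemLp (fun x => (Real.exp (r x) : ℂ) * v x) 2) (c : ℂ) :
    MemLp (fun x => (Real.exp (r x) : ℂ) * (c * u x + v x)) 2 := by
  have : MemLp (fun x => c * ((Real.exp (r x) : ℂ) * u x) + (Real.exp (r x) : ℂ) * v x) 2 :=
    (hu.const_mul c).add hv
  refine this.congr_norm ?_ ?_
  · exact this.1.congr (ae_of_all _ fun x => by ring)
  · exact ae_of_all _ fun x => by congr 1; ring

lemma pauliFormDomain_linearComb {h : ℂ → ℝ} {ψ ψ' : Spinor} (hψ : ψ ∈ pauliFormDomain h)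
    (hψ' : ψ' ∈ pauliFormDomain h) (c : ℂ) : c • ψ + ψ' ∈ pauliFormDomain h := by
  obtain ⟨⟨u, hu, hu2⟩, v, hv, hv2⟩ := hψ
  obtain ⟨⟨u', hu', hu2'⟩, v', hv', hv2'⟩ := hψ'
  exact ⟨⟨_, hu.linearComb hu' c (upPart_linearComb h c ψ ψ'), memLp_linearComb hu2 hu2' c⟩,
    _, hv.linearComb hv' c (downPart_linearComb h c ψ ψ'), memLp_linearComb hv2 hv2' c⟩

lemma integrable_conj_mul_mul_exp {r : ℂ → ℝ} {u v : ℂ → ℂ}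
    (hu : MemLp (fun x => (Real.exp (r x) : ℂ) * u x) 2)
    (hv : MemLp (fun x => (Real.exp (r x) : ℂ) * v x) 2) :
    Integrable fun x => conj (u x) * v x * (Real.exp (2 * r x) : ℂ) := by
  refine (hu.star.integrable_mul hv).congr (ae_of_all _ fun x => ?_)
  simp only [Pi.mul_apply, Pi.star_apply, RCLike.star_def, map_mul, Complex.conj_ofReal]
  rw [two_mul, Real.exp_add]
  push_cast
  ring

lemma integral_conj_linearComb {r : ℂ → ℝ} {U u u' v : ℂ → ℂ} {c : ℂ}
    (hU : U =ᵐ[volume] fun x => c * u x + u' x)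
    (hu : MemLp (fun x => (Real.exp (r x) : ℂ) * u x) 2)
    (hu' : MemLp (fun x => (Real.exp (r x) : ℂ) * u' x) 2)
    (hv : MemLp (fun x => (Real.exp (r x) : ℂ) * v x) 2) :
    ∫ x, conj (U x) * v x * (Real.exp (2 * r x) : ℂ) =
      conj c * (∫ x, conj (u x) * v x * (Real.exp (2 * r x) : ℂ)) +
        ∫ x, conj (u' x) * v x * (Real.exp (2 * r x) : ℂ) := by
  rw [← integral_const_mul, ← integral_add ((integrable_conj_mul_mul_exp hu hv).const_mul _)
    (integrable_conj_mul_mul_exp hu' hv)]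
  refine integral_congr_ae ?_
  filter_upwards [hU] with x hx
  rw [hx, map_add, map_mul]
  ring

/-- For spinors in the form domain the canonical weak derivatives are square integrable against the
weights. -/
lemma memLp_weakDeriv_of_mem_pauliFormDomain {h : ℂ → ℝ} {ψ : Spinor}
    (hψ : ψ ∈ pauliFormDomain h) :
    HasWeakDzbar (upPart h ψ) (weakDzbar (upPart h ψ)) ∧
    MemLp (fun x => (Real.exp (h x) : ℂ) * weakDzbar (upPart h ψ) x) 2 ∧
    HasWeakDz (downPart h ψ) (weakDz (downPart h ψ)) ∧
    MemLp (fun x => (Real.exp (-h x) : ℂ) * weakDz (downPart h ψ) x) 2 := by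
  obtain ⟨⟨u, hu, hu2⟩, v, hv, hv2⟩ := hψ
  refine ⟨weakDzbar_spec hu, hu2.ae_eq ?_, weakDz_spec hv, hv2.ae_eq ?_⟩
  · filter_upwards [(weakDzbar_spec hu).ae_eq hu] with x hx
    rw [hx]
  · filter_upwards [(weakDz_spec hv).ae_eq hv] with x hx
    rw [hx]

lemma pauliForm_linearComb {h : ℂ → ℝ} {ψ ψ' ξ : Spinor} (hψ : ψ ∈ pauliFormDomain h)
    (hψ' : ψ' ∈ pauliFormDomain h) (hξ : ξ ∈ pauliFormDomain h) (c : ℂ) :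
    pauliForm h (c • ψ + ψ') ξ = conj c * pauliForm h ψ ξ + pauliForm h ψ' ξ := by
  obtain ⟨a1, a2, a3, a4⟩ := memLp_weakDeriv_of_mem_pauliFormDomain hψ
  obtain ⟨b1, b2, b3, b4⟩ := memLp_weakDeriv_of_mem_pauliFormDomain hψ'
  obtain ⟨-, d2, -, d4⟩ := memLp_weakDeriv_of_mem_pauliFormDomain hξ
  have eu := a1.linearComb b1 c (upPart_linearComb h c ψ ψ')
  have ev := a3.linearComb b3 c (downPart_linearComb h c ψ ψ')
  have i1 := integral_conj_linearComb ((weakDzbar_spec eu).ae_eq eu) a2 b2 d2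
  have i2 := integral_conj_linearComb (r := fun x => -h x) ((weakDz_spec ev).ae_eq ev) a4 b4 d4
  simp only [mul_neg] at i2
  rw [pauliForm, i1, i2, pauliForm, pauliForm]
  ring

lemma hasWeakDzbar_of_contDiff {φ : ℂ → ℂ} (hφ : ContDiff ℝ ∞ φ) : HasWeakDzbar φ (dzbar φ) := by
  refine ⟨hφ.continuous.locallyIntegrable, (continuous_dzbar hφ).locallyIntegrable,
    fun η hη hc => ?_⟩
  have h1 : (1 : WithTop ℕ∞) ≤ ∞ := le_trans (by norm_num) two_le_infty
  have hp := integral_mul_fderiv_of_hasCompactSupport (hφ.of_le h1) (hη.of_le h1) hc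
  have hi : ∀ v, Integrable fun x => φ x * fderiv ℝ η x v := fun v =>
    (hφ.continuous.mul (contDiff_fderiv_apply_const hη (m := 0) (by simp)
      v).continuous).integrable_of_hasCompactSupport (hasCompactSupport_fderiv_apply hc v).mul_left
  have hi' : ∀ v, Integrable fun x => fderiv ℝ φ x v * η x := fun v =>
    ((contDiff_fderiv_apply_const hφ (m := 0) (by simp)
      v).continuous.mul hη.continuous).integrable_of_hasCompactSupport hc.mul_left
  have e : ∀ x, φ x * dzbar η x = (1 / 2) * (φ x * fderiv ℝ η x 1) +
      (I / 2) * (φ x * fderiv ℝ η x I) := fun x => by rw [dzbar]; ring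
  have e' : ∀ x, dzbar φ x * η x = (1 / 2) * (fderiv ℝ φ x 1 * η x) +
      (I / 2) * (fderiv ℝ φ x I * η x) := fun x => by rw [dzbar]; ring
  simp_rw [e, e']
  rw [integral_add ((hi 1).const_mul _) ((hi I).const_mul _),
    integral_add ((hi' 1).const_mul _) ((hi' I).const_mul _), integral_const_mul,
    integral_const_mul, integral_const_mul, integral_const_mul, hp, hp]
  ring

lemma hasWeakDz_of_contDiff {φ : ℂ → ℂ} (hφ : ContDiff ℝ ∞ φ) : HasWeakDz φ (dz φ) := by
  refine ⟨hφ.continuous.locallyIntegrable, (continuous_dz hφ).locallyIntegrable,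
    fun η hη hc => ?_⟩
  have h1 : (1 : WithTop ℕ∞) ≤ ∞ := le_trans (by norm_num) two_le_infty
  have hp := integral_mul_fderiv_of_hasCompactSupport (hφ.of_le h1) (hη.of_le h1) hc
  have hi : ∀ v, Integrable fun x => φ x * fderiv ℝ η x v := fun v =>
    (hφ.continuous.mul (contDiff_fderiv_apply_const hη (m := 0) (by simp)
      v).continuous).integrable_of_hasCompactSupport (hasCompactSupport_fderiv_apply hc v).mul_left
  have hi' : ∀ v, Integrable fun x => fderiv ℝ φ x v * η x := fun v =>
    ((contDiff_fderiv_apply_const hφ (m := 0) (by simp)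
      v).continuous.mul hη.continuous).integrable_of_hasCompactSupport hc.mul_left
  have e : ∀ x, φ x * dz η x = (1 / 2) * (φ x * fderiv ℝ η x 1) -
      (I / 2) * (φ x * fderiv ℝ η x I) := fun x => by rw [dz]; ring
  have e' : ∀ x, dz φ x * η x = (1 / 2) * (fderiv ℝ φ x 1 * η x) -
      (I / 2) * (fderiv ℝ φ x I * η x) := fun x => by rw [dz]; ring
  simp_rw [e, e']
  rw [integral_sub ((hi 1).const_mul _) ((hi I).const_mul _),
    integral_sub ((hi' 1).const_mul _) ((hi' I).const_mul _), integral_const_mul,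
    integral_const_mul, integral_const_mul, integral_const_mul, hp, hp]
  ring

lemma continuous_ofReal_exp {k : ℂ → ℝ} (hk : Continuous k) :
    Continuous fun x => (Real.exp (k x) : ℂ) := by fun_prop

lemma hasWeakDeriv_zero_spinor (h : ℂ → ℝ) :
    HasWeakDzbar (upPart h 0) 0 ∧ HasWeakDz (downPart h 0) 0 := by
  rw [hasWeakDzbar_zero_iff, hasWeakDz_zero_iff]
  refine ⟨⟨0, differentiable_const 0, ?_⟩, 0, differentiable_const 0, ?_⟩ <;>
  · exact ae_of_all _ fun x => by simp [upPart, downPart]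

/-- The test spinors `e^h φ` in the upper and `e^{-h} φ` in the lower component belong to the form
domain. -/
lemma singleSpinor_mem_pauliFormDomain {h : ℂ → ℝ} (hh : Continuous h) {φ : ℂ → ℂ}
    (hφ : ContDiff ℝ ∞ φ) (hc : HasCompactSupport φ) (i : Fin 2) :
    ∃ hL : MemLp (fun x => (Real.exp (if i = 0 then h x else -h x) : ℂ) * φ x) 2,
      singleSpinor i _ hL ∈ pauliFormDomain h := by
  have hexp : ∀ r : ℝ, (Real.exp (-r) : ℂ) * (Real.exp r : ℂ) = 1 := fun r => by
    rw [← Complex.ofReal_mul, ← Real.exp_add]; simp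
  have hmem : ∀ {k : ℂ → ℝ} {η : ℂ → ℂ}, Continuous k → Continuous η → HasCompactSupport η →
      MemLp (fun x => (Real.exp (k x) : ℂ) * η x) 2 := fun hk hη hηc =>
    ((continuous_ofReal_exp hk).mul hη).memLp_of_hasCompactSupport hηc.mul_left
  have hk : Continuous fun x => if i = 0 then h x else -h x := by
    split_ifs
    exacts [hh, hh.neg]
  have hL := hmem hk hφ.continuous hc
  refine ⟨hL, ?_⟩
  have hcoe := singleSpinor_coeFn i _ hL
  have hcases : i = 0 ∨ i = 1 := by omega
  rcases hcases with rfl | rfl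
  · refine ⟨⟨dzbar φ, (hasWeakDzbar_of_contDiff hφ).congr_left ?_,
      hmem hh (continuous_dzbar hφ) (hasCompactSupport_dzbar hc)⟩, 0,
      hasWeakDz_zero_iff.2 ⟨0, differentiable_const 0, ?_⟩, by simp⟩
    · filter_upwards [hcoe] with x hx
      rw [upPart, hx, PiLp.smul_apply, PiLp.single_apply]
      simp only [if_true, smul_eq_mul, mul_one]
      rw [← mul_assoc, hexp, one_mul]
    · filter_upwards [hcoe] with x hx
      rw [downPart, hx, PiLp.smul_apply, PiLp.single_apply]
      simp
  · refine ⟨⟨0, hasWeakDzbar_zero_iff.2 ⟨0, differentiable_const 0, ?_⟩, by simp⟩, dz φ,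
      (hasWeakDz_of_contDiff hφ).congr_left ?_,
      hmem hh.neg (continuous_dz hφ) (hasCompactSupport_dz hc)⟩
    · filter_upwards [hcoe] with x hx
      rw [upPart, hx, PiLp.smul_apply, PiLp.single_apply]
      simp
    · filter_upwards [hcoe] with x hx
      have := hexp (-h x)
      rw [neg_neg] at this
      rw [downPart, hx, PiLp.smul_apply, PiLp.single_apply]
      simp only [if_true, one_ne_zero, if_false, smul_eq_mul, mul_one]
      rw [← mul_assoc, this, one_mul]

/-- The orthogonal complement of the form domain is trivial. -/
lemma eq_zero_of_forall_inner_pauliFormDomain {h : ℂ → ℝ} (hh : Continuous h) {η : Spinor}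
    (hη : ∀ ξ ∈ pauliFormDomain h, ⟪η, ξ⟫_ℂ = 0) : η = 0 := by
  have key : ∀ i : Fin 2, ∀ᵐ x, η x i = 0 := by
    intro i
    set k : ℂ → ℝ := fun x => if i = 0 then h x else -h x with hkdef
    have hk : Continuous k := by
      simp only [hkdef]
      split_ifs
      exacts [hh, hh.neg]
    have hηi : MemLp (fun x => η x i) 2 := ContinuousLinearMap.comp_memLp'
      (EuclideanSpace.proj i : EuclideanSpace ℂ (Fin 2) →L[ℂ] ℂ) (Lp.memLp η)
    have hli : LocallyIntegrable fun x => conj (η x i) :=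
      locallyIntegrable_conj (hηi.locallyIntegrable (by norm_num))
    have hli2 : LocallyIntegrable fun x => conj (η x i) * (Real.exp (k x) : ℂ) := by
      have := (locallyIntegrableOn_univ.2 hli).mul_continuousOn
        (continuous_ofReal_exp hk).continuousOn isOpen_univ.isLocallyClosed
      exact locallyIntegrableOn_univ.1 this
    have h0 := ae_eq_zero_of_integral_contDiff_smul_eq_zero hli2 fun φ hφ hc => by
      obtain ⟨hL, hmem⟩ := singleSpinor_mem_pauliFormDomain hh
        (Complex.ofRealCLM.contDiff.comp hφ)
        (hc.comp_left (g := fun r : ℝ => (r : ℂ)) (by simp)) i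
      have h1 := hη _ hmem
      rw [L2.inner_def] at h1
      rw [← h1]
      refine integral_congr_ae ?_
      filter_upwards [singleSpinor_coeFn i _ hL] with x hx
      rw [hx, inner_smul_right, EuclideanSpace.inner_single_right]
      simp [hkdef]
      ring
    filter_upwards [h0] with x hx
    simpa using hx
  refine Lp.ext ?_
  filter_upwards [key 0, key 1, Lp.coeFn_zero (EuclideanSpace ℂ (Fin 2)) 2
    (volume : Measure ℂ)] with x h1 h2 h3
  rw [h3]
  ext i
  fin_cases i
  exacts [h1, h2]

/-- For a continuous `h` the condition that determines `H_h` defines an operator: the form domain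
contains enough test spinors. -/
theorem exists_isFormOperator {h : ℂ → ℝ} (hh : Continuous h) :
    ∃ H : Spinor →ₗ.[ℂ] Spinor, IsFormOperator h H := by
  obtain ⟨z1, z2⟩ := hasWeakDeriv_zero_spinor h
  have h0 : (0 : Spinor) ∈ pauliFormDomain h := ⟨⟨0, z1, by simp⟩, 0, z2, by simp⟩
  have hlin : ∀ (c : ℂ) (p q : Spinor × Spinor),
      (p.1 ∈ pauliFormDomain h ∧ ∀ ξ ∈ pauliFormDomain h, ⟪p.2, ξ⟫_ℂ = pauliForm h p.1 ξ) →
      (q.1 ∈ pauliFormDomain h ∧ ∀ ξ ∈ pauliFormDomain h, ⟪q.2, ξ⟫_ℂ = pauliForm h q.1 ξ) →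
      (c • p.1 + q.1 ∈ pauliFormDomain h ∧
        ∀ ξ ∈ pauliFormDomain h, ⟪c • p.2 + q.2, ξ⟫_ℂ = pauliForm h (c • p.1 + q.1) ξ) := by
    rintro c p q ⟨hp, hp'⟩ ⟨hq, hq'⟩
    refine ⟨pauliFormDomain_linearComb hp hq c, fun ξ hξ => ?_⟩
    rw [inner_add_left, inner_smul_left, hp' ξ hξ, hq' ξ hξ, pauliForm_linearComb hp hq hξ]
  have hz : (0 : Spinor) ∈ pauliFormDomain h ∧
      ∀ ξ ∈ pauliFormDomain h, ⟪(0 : Spinor), ξ⟫_ℂ = pauliForm h 0 ξ :=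
    ⟨h0, fun ξ _ => by rw [inner_zero_left, pauliForm_eq_zero z1 z2]⟩
  let g : Submodule ℂ (Spinor × Spinor) :=
    { carrier := {p | p.1 ∈ pauliFormDomain h ∧
        ∀ ξ ∈ pauliFormDomain h, ⟪p.2, ξ⟫_ℂ = pauliForm h p.1 ξ}
      add_mem' := fun {p q} hp hq => by
        have := hlin 1 p q hp hq
        simpa using this
      zero_mem' := hz
      smul_mem' := fun c p hp => by
        have := hlin c p 0 hp hz
        simpa using this }
  refine ⟨g.toLinearPMap, fun ψ η => ?_⟩
  rw [Submodule.toLinearPMap_graph_eq]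
  · rfl
  · rintro ⟨ψ, η⟩ ⟨-, hη⟩ (rfl : ψ = 0)
    exact eq_zero_of_forall_inner_pauliFormDomain hh fun ξ hξ => by
      rw [hη ξ hξ, pauliForm_eq_zero z1 z2]

/-! ### Magnetic fields with a density -/

namespace SignedRadonMeasure

/-- The signed measure `d dx`. -/
noncomputable def ofDensity (d : ℂ → ℝ) (hd : Continuous d) (hi : Integrable d) :
    SignedRadonMeasure where
  pos := volume.withDensity fun x => ENNReal.ofReal (d x)
  neg := volume.withDensity fun x => ENNReal.ofReal (-d x)
  locallyFinite_pos :=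
    have := isFiniteMeasure_withDensity_ofReal hi.2
    inferInstance
  locallyFinite_neg :=
    have := isFiniteMeasure_withDensity_ofReal hi.neg.2
    inferInstance
  mutuallySingular := withDensity_ofReal_mutuallySingular hd.measurable

variable {d : ℂ → ℝ} (hd : Continuous d) (hi : Integrable d)

lemma hasFiniteTotalVariation_ofDensity : (ofDensity d hd hi).HasFiniteTotalVariation := by
  have h1 := isFiniteMeasure_withDensity_ofReal hi.2
  have h2 := isFiniteMeasure_withDensity_ofReal hi.neg.2
  rw [HasFiniteTotalVariation, variation, Measure.add_apply, ENNReal.add_lt_top]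
  exact ⟨h1.measure_univ_lt_top, h2.measure_univ_lt_top⟩

lemma flux_ofDensity : (ofDensity d hd hi).flux = (∫ x, d x) / (2 * Real.pi) := by
  rw [flux, value, measureReal_def, measureReal_def,
    integral_eq_lintegral_pos_part_sub_lintegral_neg_part hi]
  simp [ofDensity]

/-- A measure without point masses is its own reduction. -/
lemma reduction_ofDensity : (ofDensity d hd hi).reduction = ofDensity d hd hi := by
  have hs : ∀ (f : ℂ → ENNReal) (z : ℂ), (volume.withDensity f).real {z} = 0 := fun f z => by
    rw [measureReal_def, withDensity_absolutelyContinuous volume f (measure_singleton z)]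
    rfl
  refine (existsUnique_isReduction _).unique (reduction_spec _) ⟨⟨0, ?_, ?_⟩, fun z => ?_⟩
  · intro R
    simp
  · intro S _ _
    simp
  · have : (ofDensity d hd hi).value {z} = 0 := by
      rw [value]
      simp [ofDensity, hs]
    rw [this]
    constructor <;> linarith [Real.pi_pos]

lemma hasDefiniteSign_ofDensity (h : (∀ x, 0 ≤ d x) ∨ ∀ x, d x ≤ 0) :
    (ofDensity d hd hi).HasDefiniteSign := by
  rcases h with h | h
  · left
    have : (fun x => ENNReal.ofReal (-d x)) = 0 :=
      funext fun x => ENNReal.ofReal_eq_zero.2 (neg_nonpos.2 (h x))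
    simp only [ofDensity, this, withDensity_zero]
  · right
    have : (fun x => ENNReal.ofReal (d x)) = 0 :=
      funext fun x => ENNReal.ofReal_eq_zero.2 (h x)
    simp only [ofDensity, this, withDensity_zero]

lemma isPotential_ofDensity {h : ℂ → ℝ} (hh : ContDiff ℝ 2 h) (hΔ : Δ h = d) :
    IsPotential h (ofDensity d hd hi) := by
  refine ⟨hh.continuous.locallyIntegrable, fun φ hφ hc => ?_⟩
  rw [integral_mul_laplacian hh (hφ.of_le two_le_infty) hc, hΔ]
  have hm1 : Measurable fun x => ENNReal.ofReal (d x) := hd.measurable.ennreal_ofReal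
  have hm2 : Measurable fun x => ENNReal.ofReal (-d x) := hd.measurable.neg.ennreal_ofReal
  simp only [ofDensity]
  rw [integral_withDensity_eq_integral_toReal_smul hm1 (ae_of_all _ fun x => ENNReal.ofReal_lt_top),
    integral_withDensity_eq_integral_toReal_smul hm2 (ae_of_all _ fun x => ENNReal.ofReal_lt_top)]
  simp only [ENNReal.toReal_ofReal', smul_eq_mul]
  rw [← integral_sub]
  · refine integral_congr_ae (ae_of_all _ fun x => ?_)
    simp only
    rw [← sub_mul]
    congr 1
    rcases le_total (d x) 0 with h | h
    · rw [max_eq_right h, max_eq_left (by linarith)]; ring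
    · rw [max_eq_left h, max_eq_right (by linarith)]; ring
  · exact ((hd.max continuous_const).mul hφ.continuous).integrable_of_hasCompactSupport hc.mul_left
  · exact ((hd.neg.max continuous_const).mul
      hφ.continuous).integrable_of_hasCompactSupport hc.mul_left

end SignedRadonMeasure

lemma isPauliOperator_of_reduction_eq_self {μ : SignedRadonMeasure} (hμ : μ.reduction = μ)
    {h : ℂ → ℝ} (hh : IsPotential h μ) {H : Spinor →ₗ.[ℂ] Spinor} (hH : IsFormOperator h H) :
    IsPauliOperator μ H := by
  refine ⟨h, H, 0, LinearIsometryEquiv.refl ℂ Spinor, by rwa [hμ], hH, ⟨fun R => by simp,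
    fun S _ _ => by simp [hμ]⟩, ⟨fun _ => 1, fun _ => 1, differentiable_const 1,
    differentiable_const 1, fun z => ?_, fun z => ?_, fun ψ => ae_of_all _ fun x => ?_⟩,
    fun ψ η => Iff.rfl⟩
  · simpa using (analyticAt_const (x := z)).analyticOrderAt_eq_zero.2 (one_ne_zero (α := ℂ))
  · simpa using (analyticAt_const (x := z)).analyticOrderAt_eq_zero.2 (one_ne_zero (α := ℂ))
  · simp

/-! ### Radial examples with integer flux -/

/-- The potential `a log (e + |x|²) + c log log (e + |x|²)`, of flux `2a`. The second term does not
contribute to the flux, but decides on the square integrability of the critical zero mode. -/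
noncomputable def radialPotential (a c : ℝ) (x : ℂ) : ℝ :=
  a * Real.log (Real.exp 1 + ‖x‖ ^ 2) + c * Real.log (Real.log (Real.exp 1 + ‖x‖ ^ 2))

/-- The Laplacian of `radialPotential`, as a function of `s = |x|²`. -/
noncomputable def radialDensity (a c s : ℝ) : ℝ :=
  4 * (a * (Real.exp 1 / (Real.exp 1 + s) ^ 2) +
    c * (Real.exp 1 * Real.log (Real.exp 1 + s) - s) /
      ((Real.exp 1 + s) * Real.log (Real.exp 1 + s)) ^ 2)

lemma one_le_log_exp_one_add {s : ℝ} (hs : 0 ≤ s) : 1 ≤ Real.log (Real.exp 1 + s) := by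
  rw [Real.le_log_iff_exp_le (by positivity)]
  linarith

lemma hasDerivAt_log_exp_one_add {s : ℝ} (hs : 0 ≤ s) :
    HasDerivAt (fun s => Real.log (Real.exp 1 + s)) (1 / (Real.exp 1 + s)) s :=
  ((hasDerivAt_id s).const_add (Real.exp 1)).log (by positivity)

lemma contDiff_radialPotential (a c : ℝ) : ContDiff ℝ 2 (radialPotential a c) := by
  have h1 : ContDiff ℝ 2 fun x : ℂ => Real.log (Real.exp 1 + ‖x‖ ^ 2) :=
    (contDiff_const.add (contDiff_norm_sq ℝ)).log fun x => by positivity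
  have h2 : ContDiff ℝ 2 fun x : ℂ => Real.log (Real.log (Real.exp 1 + ‖x‖ ^ 2)) :=
    h1.log fun x => by
      have := one_le_log_exp_one_add (s := ‖x‖ ^ 2) (by positivity)
      positivity
  exact (contDiff_const.mul h1).add (contDiff_const.mul h2)

lemma laplacian_radialPotential (a c : ℝ) :
    Δ (radialPotential a c) = fun x => radialDensity a c (‖x‖ ^ 2) := by
  funext x
  have hF1 : ∀ s : ℝ, 0 ≤ s → HasDerivAt
      (fun s => a * Real.log (Real.exp 1 + s) + c * Real.log (Real.log (Real.exp 1 + s)))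
      (a / (Real.exp 1 + s) + c / ((Real.exp 1 + s) * Real.log (Real.exp 1 + s))) s := by
    intro s hs
    have hL := one_le_log_exp_one_add hs
    have he : 0 < Real.exp 1 + s := by positivity
    have h1 := hasDerivAt_log_exp_one_add hs
    refine ((h1.const_mul a).add ((h1.log (by positivity)).const_mul c)).congr_deriv ?_
    field_simp
  have hF2 : ∀ s : ℝ, 0 ≤ s → HasDerivAt
      (fun s => a / (Real.exp 1 + s) + c / ((Real.exp 1 + s) * Real.log (Real.exp 1 + s)))
      (-a / (Real.exp 1 + s) ^ 2 - c * (Real.log (Real.exp 1 + s) + 1) /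
        ((Real.exp 1 + s) * Real.log (Real.exp 1 + s)) ^ 2) s := by
    intro s hs
    have hL := one_le_log_exp_one_add hs
    have he : 0 < Real.exp 1 + s := by positivity
    have h1 := hasDerivAt_log_exp_one_add hs
    have h0 := (hasDerivAt_id s).const_add (Real.exp 1)
    refine (((hasDerivAt_const s a).div h0 (by simp only [id]; positivity)).add
      ((hasDerivAt_const s c).div (h0.mul h1) (by
        simp only [id, Pi.mul_apply]; positivity))).congr_deriv ?_
    simp only [id, Pi.mul_apply]
    field_simp
    ring
  have := laplacian_comp_norm_sq hF1 hF2 (contDiff_radialPotential a c) x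
  refine this.trans ?_
  have hL := one_le_log_exp_one_add (s := ‖x‖ ^ 2) (by positivity)
  rw [radialDensity]
  field_simp
  ring

lemma continuous_radialDensity (a c : ℝ) :
    Continuous fun x : ℂ => radialDensity a c (‖x‖ ^ 2) := by
  rw [← laplacian_radialPotential]
  exact continuous_laplacian (contDiff_radialPotential a c)

lemma tendsto_exp_one_add_atTop :
    Filter.Tendsto (fun s : ℝ => Real.exp 1 + s) Filter.atTop Filter.atTop :=
  Filter.tendsto_atTop_add_const_left _ _ Filter.tendsto_id

lemma tendsto_log_exp_one_add_atTop :
    Filter.Tendsto (fun s : ℝ => Real.log (Real.exp 1 + s)) Filter.atTop Filter.atTop :=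
  Real.tendsto_log_atTop.comp tendsto_exp_one_add_atTop

/-- The borderline integrability behind the critical zero mode. -/
lemma integrable_one_div_mul_log_sq : Integrable fun x : ℂ =>
    1 / ((Real.exp 1 + ‖x‖ ^ 2) * Real.log (Real.exp 1 + ‖x‖ ^ 2) ^ 2) := by
  refine integrable_comp_norm_sq_of_nonneg (ℓ := 0)
    (g := fun s => 1 / ((Real.exp 1 + s) * Real.log (Real.exp 1 + s) ^ 2))
    (W := fun s => -(Real.log (Real.exp 1 + s))⁻¹) (fun s hs => ?_) (fun s hs => by positivity) ?_
  · have hL := one_le_log_exp_one_add hs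
    refine ((hasDerivAt_log_exp_one_add hs).inv (by positivity)).neg.congr_deriv ?_
    field_simp
  · simpa using tendsto_log_exp_one_add_atTop.inv_tendsto_atTop.neg

lemma integrable_exp_one_div_sq : Integrable fun x : ℂ =>
    Real.exp 1 / (Real.exp 1 + ‖x‖ ^ 2) ^ 2 := by
  refine integrable_comp_norm_sq_of_nonneg (ℓ := 0)
    (g := fun s => Real.exp 1 / (Real.exp 1 + s) ^ 2)
    (W := fun s => -(Real.exp 1 / (Real.exp 1 + s))) (fun s hs => ?_) (fun s hs => by positivity) ?_
  · have h0 := (hasDerivAt_id s).const_add (Real.exp 1)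
    refine ((hasDerivAt_const s (Real.exp 1)).div h0
      (by simp only [id]; positivity)).neg.congr_deriv ?_
    simp only [id]
    field_simp
    ring
  · simpa using (tendsto_const_nhds.div_atTop tendsto_exp_one_add_atTop).neg

lemma integrable_radialDensity (a c : ℝ) :
    Integrable fun x : ℂ => radialDensity a c (‖x‖ ^ 2) := by
  have h := ((integrable_exp_one_div_sq.const_mul |a|).add ((integrable_exp_one_div_sq.add
    integrable_one_div_mul_log_sq).const_mul |c|)).const_mul 4
  refine h.mono' (continuous_radialDensity a c).aestronglyMeasurable (ae_of_all _ fun x => ?_)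
  simp only [Pi.add_apply]
  set s := ‖x‖ ^ 2 with hs
  have hs0 : 0 ≤ s := by positivity
  have hL := one_le_log_exp_one_add hs0
  have he : 0 < Real.exp 1 + s := by positivity
  set L := Real.log (Real.exp 1 + s) with hLdef
  have hL0 : 0 < L := by linarith
  rw [radialDensity, ← hLdef, Real.norm_eq_abs, abs_mul, abs_of_pos (by norm_num : (0 : ℝ) < 4)]
  gcongr
  refine (abs_add_le _ _).trans (add_le_add ?_ ?_)
  · rw [abs_mul, abs_of_nonneg (by positivity : 0 ≤ Real.exp 1 / (Real.exp 1 + s) ^ 2)]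
  · rw [mul_div_assoc, abs_mul]
    gcongr
    rw [sub_div]
    refine (abs_sub _ _).trans (add_le_add ?_ ?_)
    · rw [abs_of_nonneg (by positivity), div_le_div_iff₀ (by positivity) (by positivity), mul_pow]
      have : L * 1 ≤ L * L := by gcongr
      nlinarith [mul_nonneg (mul_nonneg (Real.exp_nonneg 1) (sq_nonneg (Real.exp 1 + s)))
        (sub_nonneg.2 this)]
    · rw [abs_of_nonneg (by positivity), div_le_div_iff₀ (by positivity) (by positivity), mul_pow]
      nlinarith [mul_nonneg (mul_nonneg he.le (sq_nonneg L)) (Real.exp_nonneg 1)]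

lemma integral_radialDensity (a c : ℝ) :
    ∫ x : ℂ, radialDensity a c (‖x‖ ^ 2) = 4 * Real.pi * a := by
  -- the primitive is `4 s F'(s)` for `h = F(|x|²)`, with `s / (e + s)` written as `1 - e / (e + s)`
  have hW : ∀ s : ℝ, 0 ≤ s → HasDerivAt (fun s => 4 * (a * (1 - Real.exp 1 / (Real.exp 1 + s)) +
      c * ((1 - Real.exp 1 / (Real.exp 1 + s)) / Real.log (Real.exp 1 + s))))
      (radialDensity a c s) s := by
    intro s hs
    have hL := one_le_log_exp_one_add hs
    have h0 := (hasDerivAt_id s).const_add (Real.exp 1)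
    have h1 := ((hasDerivAt_const s (Real.exp 1)).div h0 (by simp only [id]; positivity)).const_sub 1
    refine (((h1.const_mul a).add ((h1.div (hasDerivAt_log_exp_one_add hs)
      (by positivity)).const_mul c)).const_mul 4).congr_deriv ?_
    simp only [id, Pi.div_apply, radialDensity]
    field_simp
    ring
  have hl1 : Filter.Tendsto (fun s : ℝ => 1 - Real.exp 1 / (Real.exp 1 + s)) Filter.atTop
      (nhds (1 - 0)) :=
    tendsto_const_nhds.sub (tendsto_const_nhds.div_atTop tendsto_exp_one_add_atTop)
  have hl := ((hl1.const_mul a).add ((hl1.div_atTop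
    tendsto_log_exp_one_add_atTop).const_mul c)).const_mul 4
  rw [integral_comp_norm_sq hW (integrable_radialDensity a c) hl]
  simp
  ring

/-- The monomials up to the critical degree `n - 1` are square integrable in the presence of the
second logarithm. -/
lemma memLp_exp_neg_radialPotential_mul_pow {n k : ℕ} (hk : k < n) :
    MemLp (fun x : ℂ => (Real.exp (-radialPotential (n / 2) 1 x) : ℂ) * x ^ k) 2 := by
  have hcont : Continuous fun x : ℂ => (Real.exp (-radialPotential (n / 2) 1 x) : ℂ) * x ^ k :=
    (continuous_ofReal_exp (contDiff_radialPotential _ _).continuous.neg).mul (continuous_pow k)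
  rw [memLp_two_iff_integrable_sq_norm hcont.aestronglyMeasurable]
  refine integrable_one_div_mul_log_sq.mono' (hcont.norm.pow 2).aestronglyMeasurable
    (ae_of_all _ fun x => ?_)
  have hL := one_le_log_exp_one_add (s := ‖x‖ ^ 2) (by positivity)
  set L := Real.log (Real.exp 1 + ‖x‖ ^ 2) with hLdef
  have hL0 : 0 < L := by linarith
  have he : 0 < Real.exp 1 + ‖x‖ ^ 2 := by positivity
  have he1 : 1 ≤ Real.exp 1 + ‖x‖ ^ 2 := by
    have := Real.add_one_le_exp 1
    nlinarith [sq_nonneg ‖x‖]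
  have hexp : Real.exp (-radialPotential (n / 2) 1 x) ^ 2 =
      1 / ((Real.exp 1 + ‖x‖ ^ 2) ^ n * L ^ 2) := by
    rw [← Real.exp_nat_mul, radialPotential, ← hLdef,
      show ((2 : ℕ) : ℝ) * -((n : ℝ) / 2 * L + 1 * Real.log L) =
        -((n : ℝ) * L + ((2 : ℕ) : ℝ) * Real.log L) by push_cast; ring,
      Real.exp_neg, Real.exp_add, Real.exp_nat_mul, Real.exp_nat_mul, Real.exp_log hL0, hLdef,
      Real.exp_log he, one_div]
  rw [Real.norm_of_nonneg (by positivity), norm_mul, Complex.norm_real,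
    Real.norm_of_nonneg (Real.exp_nonneg _), mul_pow, hexp, norm_pow, ← pow_mul, mul_comm k 2,
    pow_mul, one_div_mul_eq_div, div_le_div_iff₀ (by positivity) (by positivity), one_mul,
    ← mul_assoc]
  gcongr
  calc (‖x‖ ^ 2) ^ k * (Real.exp 1 + ‖x‖ ^ 2)
      ≤ (Real.exp 1 + ‖x‖ ^ 2) ^ k * (Real.exp 1 + ‖x‖ ^ 2) := by
        gcongr
        linarith [Real.exp_nonneg 1]
    _ = (Real.exp 1 + ‖x‖ ^ 2) ^ (k + 1) := (pow_succ _ _).symm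
    _ ≤ (Real.exp 1 + ‖x‖ ^ 2) ^ n := pow_le_pow_right₀ he1 hk

lemma radialPotential_neg (a c : ℝ) (x : ℂ) :
    radialPotential (-a) (-c) x = -radialPotential a c x := by
  simp only [radialPotential]; ring

/-- The second logarithm, with the sign of the flux `N`, provides `|N|` zero modes. -/
lemma natAbs_le_rank_zeroModes {N : ℤ} (hN : N ≠ 0) {H : Spinor →ₗ.[ℂ] Spinor}
    (hH : IsFormOperator (radialPotential (N / 2) (Real.sign N)) H) :
    (N.natAbs : Cardinal) ≤ Module.rank ℂ (zeroModes H) := by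
  have hcont := (contDiff_radialPotential (N / 2) (Real.sign N)).continuous
  rcases hN.lt_or_gt with hneg | hpos
  · have hNr : (N : ℝ) < 0 := by exact_mod_cast hneg
    have hab : (N.natAbs : ℝ) = -N := by
      rw [Nat.cast_natAbs, abs_of_neg hneg]; push_cast; ring
    refine natCast_le_rank (zeroModes H) 0
      (κ := fun x => (Real.exp (radialPotential (N / 2) (Real.sign N) x) : ℂ))
      (fun x => by exact_mod_cast (Real.exp_pos _).ne')
      (continuous_ofReal_exp hcont).aestronglyMeasurable (T := RingHom.id ℂ) continuous_id
      (fun _ => rfl) (fun _ => rfl) (fun ψ hψ => ?_) fun k hk => ?_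
    · obtain ⟨E, hE, hψE⟩ := hψ
      rw [mem_zeroModes, mem_graph_zero_iff hH]
      refine ⟨⟨E, hE, ?_⟩, 0, differentiable_const 0, ?_⟩ <;>
      · filter_upwards [hψE] with x hx
        simp [hx]
    · have := memLp_exp_neg_radialPotential_mul_pow hk
      rw [hab] at this
      simp_rw [← radialPotential_neg] at this
      rwa [Real.sign_of_neg hNr, show (N : ℝ) / 2 = -(-N / 2) by ring]
  · have hNr : (0 : ℝ) < N := by exact_mod_cast hpos
    have hab : (N.natAbs : ℝ) = N := by rw [Nat.cast_natAbs, abs_of_pos hpos]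
    refine natCast_le_rank (zeroModes H) 1
      (κ := fun x => (Real.exp (-radialPotential (N / 2) (Real.sign N) x) : ℂ))
      (fun x => by exact_mod_cast (Real.exp_pos _).ne')
      (continuous_ofReal_exp hcont.neg).aestronglyMeasurable (T := starRingEnd ℂ)
      Complex.continuous_conj Complex.conj_conj (fun x => RCLike.norm_conj x) (fun ψ hψ => ?_)
      fun k hk => ?_
    · obtain ⟨E, hE, hψE⟩ := hψ
      rw [mem_zeroModes, mem_graph_zero_iff hH]
      refine ⟨⟨0, differentiable_const 0, ?_⟩, E, hE, ?_⟩ <;>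
      · filter_upwards [hψE] with x hx
        simp [hx]
    · have := memLp_exp_neg_radialPotential_mul_pow hk
      rw [hab] at this
      rwa [Real.sign_of_pos hNr]

lemma exists_radial_pauliOperator (a c : ℝ) :
    ∃ (μ : SignedRadonMeasure) (H : Spinor →ₗ.[ℂ] Spinor), μ.reduction.HasFiniteTotalVariation ∧
      μ.reduction.flux = 2 * a ∧ IsPauliOperator μ H ∧
      IsFormOperator (radialPotential a c) H ∧ (c = 0 → μ.reduction.HasDefiniteSign) := by
  have hd := continuous_radialDensity a c
  have hi := integrable_radialDensity a c
  have hC := contDiff_radialPotential a c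
  obtain ⟨H, hH⟩ := exists_isFormOperator hC.continuous
  have hred := SignedRadonMeasure.reduction_ofDensity hd hi
  refine ⟨SignedRadonMeasure.ofDensity _ hd hi, H, ?_, ?_,
    isPauliOperator_of_reduction_eq_self hred (SignedRadonMeasure.isPotential_ofDensity hd hi hC
      (laplacian_radialPotential a c)) hH, hH, ?_⟩
  · rw [hred]
    exact SignedRadonMeasure.hasFiniteTotalVariation_ofDensity hd hi
  · rw [hred, SignedRadonMeasure.flux_ofDensity, integral_radialDensity]
    have := Real.pi_pos
    field_simp
    ring
  · rintro rfl
    rw [hred]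
    refine SignedRadonMeasure.hasDefiniteSign_ofDensity hd hi ?_
    simp only [radialDensity, zero_mul, zero_div, add_zero]
    rcases le_total 0 a with ha | ha
    · exact Or.inl fun x => by positivity
    · exact Or.inr fun x => mul_nonpos_of_nonneg_of_nonpos (by norm_num)
        (mul_nonpos_of_nonpos_of_nonneg ha (by positivity))

/-- Both dimensions occur for every nonzero integer flux: the smaller one without the second
logarithm, when the field has a definite sign, the larger one with it. -/
theorem exists_dimKer_of_integer_flux {N : ℤ} (hN : N ≠ 0) :
    (∃ (μ : SignedRadonMeasure) (H : Spinor →ₗ.[ℂ] Spinor),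
      μ.reduction.HasFiniteTotalVariation ∧ μ.reduction.flux = N ∧ IsPauliOperator μ H ∧
      dimKer H = (N.natAbs : Cardinal)) ∧
    (∃ (μ : SignedRadonMeasure) (H : Spinor →ₗ.[ℂ] Spinor),
      μ.reduction.HasFiniteTotalVariation ∧ μ.reduction.flux = N ∧ IsPauliOperator μ H ∧
      dimKer H = ((N.natAbs - 1 : ℕ) : Cardinal)) := by
  have hfloor : ⌊|(N : ℝ)|⌋₊ = N.natAbs := by
    rw [← Int.cast_abs, Int.abs_eq_natAbs, Int.cast_natCast, Nat.floor_natCast]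
  have hN0 : (N : ℝ) ≠ 0 := by exact_mod_cast hN
  constructor
  · obtain ⟨μ, H, hfin, hflux, hP, hH, -⟩ := exists_radial_pauliOperator (N / 2) (Real.sign N)
    have hflux' : (N : ℝ) = μ.reduction.flux := by rw [hflux]; ring
    refine ⟨μ, H, hfin, hflux'.symm, hP, ?_⟩
    have hle := natAbs_le_rank_zeroModes hN hH
    rw [← dimKer_eq_rank_zeroModes] at hle
    have hdim := (dimKer_isPauliOperator hfin hP hflux').2.1 ⟨N, rfl⟩ hN0
    rw [hfloor] at hdim
    rcases hdim with hdim | hdim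
    · exact hdim
    · rw [hdim] at hle
      have h1 : N.natAbs ≤ N.natAbs - 1 := by exact_mod_cast hle
      have h2 : 0 < N.natAbs := Int.natAbs_pos.2 hN
      omega
  · obtain ⟨μ, H, hfin, hflux, hP, -, hsign⟩ := exists_radial_pauliOperator (N / 2) 0
    have hflux' : (N : ℝ) = μ.reduction.flux := by rw [hflux]; ring
    refine ⟨μ, H, hfin, hflux'.symm, hP, ?_⟩
    have hdim := (dimKer_isPauliOperator hfin hP hflux').2.2.1 ⟨N, rfl⟩ hN0 (Or.inr (hsign rfl))
    rwa [hfloor] at hdim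

end PauliMeasure

open PauliMeasure in
theorem theorem3p1 :
    (∀ μ : SignedRadonMeasure, μ.reduction.HasFiniteTotalVariation →
      ∀ H : Spinor →ₗ.[ℂ] Spinor, IsPauliOperator μ H → ∀ Φ : ℝ, Φ = μ.reduction.flux →
        (((¬ ∃ k : ℤ, Φ = k) ∨ Φ = 0) → dimKer H = (⌊|Φ|⌋₊ : Cardinal)) ∧
        ((∃ k : ℤ, Φ = k) → Φ ≠ 0 →
          dimKer H = (⌊|Φ|⌋₊ : Cardinal) ∨ dimKer H = ((⌊|Φ|⌋₊ - 1 : ℕ) : Cardinal)) ∧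
        ((∃ k : ℤ, Φ = k) → Φ ≠ 0 →
          (μ.reduction.HasCompactSupport ∨ μ.reduction.HasDefiniteSign) →
          dimKer H = ((⌊|Φ|⌋₊ - 1 : ℕ) : Cardinal)) ∧
        (∀ ψ : Spinor, (ψ, 0) ∈ H.graph →
          ∀ᵐ x : ℂ, sigma3.mulVec (ψ x).ofLp = (-(Real.sign Φ : ℂ)) • (ψ x).ofLp)) ∧
    (∀ N : ℤ, N ≠ 0 →
      (∃ (μ : SignedRadonMeasure) (H : Spinor →ₗ.[ℂ] Spinor),
        μ.reduction.HasFiniteTotalVariation ∧ μ.reduction.flux = N ∧ IsPauliOperator μ H ∧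
        dimKer H = (N.natAbs : Cardinal)) ∧
      (∃ (μ : SignedRadonMeasure) (H : Spinor →ₗ.[ℂ] Spinor),
        μ.reduction.HasFiniteTotalVariation ∧ μ.reduction.flux = N ∧ IsPauliOperator μ H ∧
        dimKer H = ((N.natAbs - 1 : ℕ) : Cardinal))) := by
  exact ⟨fun μ hμ H hH Φ hΦ => dimKer_isPauliOperator hμ hH hΦ,
    fun N hN => exists_dimKer_of_integer_flux hN⟩
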